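/- Let $k\ge 1$ be an integer, $b\in\mathbb R$, and let $f$ be a prenormalized antiholomorphic parabolic germ at $0\in\mathbb C$ of codimension $k$ with formal invariant $b$, that is, $z\mapsto f(\bar z)$ is holomorphic near $0$ and $$f(z)=\bar z+\tfrac12\,\bar z^{\,k+1}+\Bigl(\tfrac{k+1}{8}-\tfrac b2\Bigr)\bar z^{\,2k+1}+o(z^{2k+1}).$$ For integers $-k\le j\le k$ let $$Z_j(z)=-\frac1{kz^k}+b\log z-\frac{ji\pi b}{k}$$ be the time coordinates, with $\arg z\in(-\pi,\pi)$ for $|j|<k$, $\arg z\in(0,2\pi)$ for $j=k$ and $\arg z\in(-2\pi,0)$ for $j=-k$; $Z_j$ is used on the sector $\Omega_j=\{0<|z|<r,\ |\arg z-j\pi/k|<\pi/k\}$. Let $\ell_j$ be the vertical line through $Z_j(\delta e^{ij\pi/k})$, let $G_j$ be the expression of $f\circ f$ in the coordinate $Z_j$, and let $B_j$ be the closed strip between $\ell_j$ and $G_j(\ell_j)$. The petal $S_j\subset\Omega_j$ is the set of points that an iterate (forward or backward) of $f\circ f$ sends to a point $w\in\Omega_j$ with $Z_j(w)\in B_j$,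 where along the way the points of the $f\circ f$-orbit stay in $\Omega_j$ and their intermediate images under $f$ in $\Omega_{-j}$. Put $U_j=Z_j(S_j)$; thus $S_k=S_{-k}$ and $U_k=U_{-k}$. A system of Fatou coordinates of $f$ is a family $(\Phi_j)_{-k\le j\le k}$ of injective holomorphic maps $\Phi_j\colon U_j\to\mathbb C$ with $\Phi_k=\Phi_{-k}$ such that, for all $-k\le j\le k$ and wherever the composition is defined, $$\Phi_j\circ F\circ\Phi_{-j}^{-1}=\Sigma\circ T_{1/2},$$ where $F=Z_j\circ f\circ Z_{-j}^{-1}$ is the expression of $f$ in the charts $U_{-j}$, $U_j$, $\Sigma(W)=\overline W$ and $T_C(W)=W+C$. Then for every sufficiently small $r>0$ and every sufficiently small $\delta>0$ (depending on $r$), the following hold. 1. For every $-k\le j\le k$ the set $S_j$ is open and non-empty, $U_j$ is open, and $Z_j\colon S_j\to U_j$ is a bijection. 2. There is a system of Fatou coordinates $(\Phi_j)$ of $f$ that are also Fatou coordinates of $f\circ f$, i.e. $\Phi_j\circ(F\circ F)\circ\Phi_j^{-1}=T_1$ for every $j$ wherever the composition is defined. 3. If $(\Phi_j)$ and $(\widetilde\Phi_j)$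 are two systems of Fatou coordinates of $f$, then there are constants $C_0,C_k\in\mathbb R$ and $C_1,\dots,C_{k-1}\in\mathbb C$ such that $\Phi_j\circ\widetilde\Phi_j^{-1}=T_{C_j}$ and $\Phi_{-j}\circ\widetilde\Phi_{-j}^{-1}=T_{\overline{C_j}}$ for $j=0,\dots,k$. -/

import Mathlib

open scoped ComplexConjugate Topology

namespace AntiParabolic

/-- `f` represents a prenormalized antiholomorphic parabolic germ at `0` of codimension `k` with
(real) formal invariant `b` (of positive type when `k` is even): `z ↦ f (conj z)` is holomorphic
near `0`, and
`f z = conj z + (1/2) (conj z)^(k+1) + ((k+1)/8 - b/2) (conj z)^(2k+1) + o(z^(2k+1))`. -/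
def IsPrenormalized (k : ℕ) (b : ℝ) (f : ℂ → ℂ) : Prop :=
  AnalyticAt ℂ (fun z : ℂ => f (conj z)) 0 ∧
  (fun z : ℂ => f z - (conj z + (1 / 2 : ℂ) * conj z ^ (k + 1)
      + (((k : ℂ) + 1) / 8 - (b : ℂ) / 2) * conj z ^ (2 * k + 1)))
    =o[𝓝 0] (fun z : ℂ => z ^ (2 * k + 1))

/-- The determination of `log z` used in the `j`-th chart: `arg z` in `(-π, π)` for `|j| < k`,
in `(0, 2π)` for `j = k`, and in `(-2π, 0)` for `j = -k`. -/
noncomputable def timeLog (k : ℕ) (j : ℤ) (z : ℂ) : ℂ :=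
  if j = (k : ℤ) then Complex.log (-z) + Real.pi * Complex.I
  else if j = -(k : ℤ) then Complex.log (-z) - Real.pi * Complex.I
  else Complex.log z

/-- The time coordinate `Z_j(z) = -1/(k z^k) + b log z - j i π b / k`. -/
noncomputable def timeCoord (k : ℕ) (b : ℝ) (j : ℤ) (z : ℂ) : ℂ :=
  -1 / ((k : ℂ) * z ^ k) + (b : ℂ) * timeLog k j z
    - (j : ℂ) * Complex.I * (Real.pi : ℂ) * (b : ℂ) / (k : ℂ)

/-- The part of the punctured disc of radius `r` on which the `j`-th chart is used:
`|arg z - jπ/k| < π/k`. It is a sheet of `z ↦ -1/(k z^k)`, and for small `r` it contains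
the whole `j`-th petal. -/
def chartDomain (k : ℕ) (r : ℝ) (j : ℤ) : Set ℂ :=
  {z | z ≠ 0 ∧ ‖z‖ < r ∧
    |Complex.arg (z * Complex.exp (-((j : ℂ) * (Real.pi : ℂ) / (k : ℂ) * Complex.I)))|
      < Real.pi / k}

/-- The base point `z_j^* = δ e^{ijπ/k}`. -/
noncomputable def basePoint (k : ℕ) (δ : ℝ) (j : ℤ) : ℂ :=
  (δ : ℂ) * Complex.exp ((j : ℂ) * (Real.pi : ℂ) / (k : ℂ) * Complex.I)

/-- The vertical line `ℓ_j` through `Z_j(z_j^*)`, read in the variable `z`. -/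
def baseLine (k : ℕ) (b r δ : ℝ) (j : ℤ) : Set ℂ :=
  {z | z ∈ chartDomain k r j ∧
    (timeCoord k b j z).re = (timeCoord k b j (basePoint k δ j)).re}

/-- The curve `G_j(ℓ_j)` in the time coordinate, where `G_j` expresses `f ∘ f` in `Z_j`. -/
noncomputable def imageLine (k : ℕ) (b : ℝ) (f : ℂ → ℂ) (r δ : ℝ) (j : ℤ) : Set ℂ :=
  (fun z => timeCoord k b j (f (f z))) '' baseLine k b r δ j

/-- The closed strip `B_j` between `ℓ_j` and `G_j(ℓ_j)` (which lies to the right of `ℓ_j`). -/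
def strip (k : ℕ) (b : ℝ) (f : ℂ → ℂ) (r δ : ℝ) (j : ℤ) : Set ℂ :=
  {W | (timeCoord k b j (basePoint k δ j)).re ≤ W.re ∧
    ∃ V ∈ imageLine k b f r δ j, V.im = W.im ∧ W.re ≤ V.re}

/-- One iteration `z ↦ f (f z)` inside the disc of radius `r`, read in the charts: `z` and
`f (f z)` are in the domain of the chart `j` and `f z` in that of the chart `-j`. -/
def Step (k : ℕ) (f : ℂ → ℂ) (r : ℝ) (j : ℤ) (z z' : ℂ) : Prop :=
  z ∈ chartDomain k r j ∧ f z ∈ chartDomain k r (-j) ∧ z' ∈ chartDomain k r j ∧ z' = f (f z)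

/-- The petal `S_j`: the points some iterate of which, forward or backward, under `f ∘ f` lies in
the strip `B_j` (all the intermediate points being in the disc). -/
def petal (k : ℕ) (b : ℝ) (f : ℂ → ℂ) (r δ : ℝ) (j : ℤ) : Set ℂ :=
  {z | ∃ w ∈ chartDomain k r j, timeCoord k b j w ∈ strip k b f r δ j ∧
    (Relation.ReflTransGen (Step k f r j) z w ∨ Relation.ReflTransGen (Step k f r j) w z)}

/-- The petal in the time coordinate, `U_j = Z_j(S_j)`. -/
noncomputable def petalChart (k : ℕ) (b : ℝ) (f : ℂ → ℂ) (r δ : ℝ) (j : ℤ) : Set ℂ :=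
  timeCoord k b j '' petal k b f r δ j

/-- A system of Fatou coordinates of `f`: for `-k ≤ j ≤ k` a holomorphic diffeomorphism `Φ_j`
of `U_j` onto its image, with `Φ_k = Φ_{-k}` on the common petal `U_k = U_{-k}`, such that
`Φ_j ∘ F ∘ Φ_{-j}⁻¹ = Σ ∘ T_{1/2}`, i.e. `W ↦ conj (W + 1/2)`, wherever the left side is defined.
The latter is evaluated at `Φ_{-j}(Z_{-j}(z))`, `z ∈ S_{-j}`; `F` sends `Z_{-j}(z)` to `Z_j(f z)`. -/
structure IsFatouSystem (k : ℕ) (b : ℝ) (f : ℂ → ℂ) (r δ : ℝ) (Φ : ℤ → ℂ → ℂ) : Prop where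
  holomorphic : ∀ j : ℤ, |j| ≤ (k : ℤ) → DifferentiableOn ℂ (Φ j) (petalChart k b f r δ j)
  injective : ∀ j : ℤ, |j| ≤ (k : ℤ) → Set.InjOn (Φ j) (petalChart k b f r δ j)
  same_petal : ∀ W ∈ petalChart k b f r δ k, Φ k W = Φ (-k) W
  conjugates : ∀ j : ℤ, |j| ≤ (k : ℤ) →
    ∀ z ∈ petal k b f r δ (-j), f z ∈ petal k b f r δ j →
      Φ j (timeCoord k b j (f z)) = conj (Φ (-j) (timeCoord k b (-j) z) + 1 / 2)

/-- `Φ_j ∘ (F ∘ F) ∘ Φ_j⁻¹ = T_1` wherever the left side is defined: the `Φ_j` are Fatou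
coordinates of `f ∘ f`. -/
def NormalizesSquare (k : ℕ) (b : ℝ) (f : ℂ → ℂ) (r δ : ℝ) (Φ : ℤ → ℂ → ℂ) : Prop :=
  ∀ j : ℤ, |j| ≤ (k : ℤ) →
    ∀ z ∈ petal k b f r δ j, f (f z) ∈ petal k b f r δ j →
      Φ j (timeCoord k b j (f (f z))) = Φ j (timeCoord k b j z) + 1

end AntiParabolic

/-! Rotating the sector around `e^{ijπ/k}` onto `|arg x| < π/k` turns every time coordinate into
`±P`, where `P x = 1/(k x^k) + β log x` and `β = ±b`, with the sign `+` for odd `j` and `-` for even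
`j`. The germ sends the chart `j` to the chart `-j`, where it reads `x ↦ ω f(ω x)` with `ω =
e^{ijπ/k}`. The coefficient `(k+1)/8 - b/2` is the one for which this map acts on `P` as conjugation
followed by a translation by `±1/2`, up to `O(|x|^(k+1))`. The germ moves `P` to the right for odd
`j`, its inverse does so for even `j`; hence all indices reduce to one situation, two attracting
half shifts `φ₁`, `φ₂` (`ParabolicPair`).

Existence. Far to the right, `P` grows by about 1 at each step of `φ₂ ∘ φ₁`, with an error of order
`n^(-1-1/k)` after `n` steps. The errors are summable, so `P(x_n) - n` converges uniformly there
(`fatou_deep`), and the functional equation carries the limit to the whole basin. Since the error of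
the half shift tends to 0 along orbits, the limits for the two orders of composition are exchanged
by conjugation and translation by 1/2 (`fatou_conj`). The limit is a bounded perturbation of `P`, so
Cauchy estimates make it injective far to the right, and iteration makes it injective on the basin.

Petals. `P` is injective only away from the cut of the logarithm. A bounded potential that absorbs
all errors shows that orbits ending far to the right never come near that cut (`core_of_mem_basin`).
Every orbit far to the right meets the strip between a vertical line and its image, so the petal is
the basin, whatever the small `δ` (`mem_petal_iff`).

Uniqueness. A second Fatou coordinate, read in the first one, is an injective holomorphic map of a
half-plane commuting with translation by 1. It extends to an injective entire function and is
therefore a translation. The conjugacy relation makes the constants at `j` and `-j` conjugate; they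
are real for `j = 0`, and for `j = k` because the petals `k` and `-k` coincide. -/

namespace AntiParabolic

/-! ### Preliminaries from complex and real analysis -/

open Complex Set Filter

/-- A left inverse of a holomorphic map with nonvanishing derivative is holomorphic on the image,
which is open. -/
theorem isOpen_image_and_differentiableOn_leftInverse {s : Set ℂ} (hs : IsOpen s) {f g : ℂ → ℂ}
    (hf : DifferentiableOn ℂ f s) (hd : ∀ x ∈ s, deriv f x ≠ 0) (hg : ∀ x ∈ s, g (f x) = x) :
    IsOpen (f '' s) ∧ DifferentiableOn ℂ g (f '' s) := by
  have key : ∀ x ∈ s, HasStrictDerivAt f (deriv f x) x := fun x hx =>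
    (hf.analyticAt (hs.mem_nhds hx)).hasStrictDerivAt
  constructor
  · rw [isOpen_iff_mem_nhds]
    rintro _ ⟨x, hx, rfl⟩
    rw [← (key x hx).map_nhds_eq (hd x hx)]
    exact image_mem_map (hs.mem_nhds hx)
  · rintro _ ⟨x, hx, rfl⟩
    have : ∀ᶠ y in 𝓝 x, g (f y) = y := by
      filter_upwards [hs.mem_nhds hx] with y hy using hg y hy
    exact ((key x hx).to_local_left_inverse (hd x hx) this).hasDerivAt.differentiableAt.differentiableWithinAt

/-- An injective entire function commuting with `w ↦ w + 1` is a translation. -/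
theorem eq_add_const_of_injective_entire {H : ℂ → ℂ} (hH : Differentiable ℂ H)
    (hinj : Function.Injective H) (h1 : ∀ w, H (w + 1) = H w + 1) : ∃ C, ∀ w, H w = w + C := by
  obtain ⟨p, hp⟩ : ∃ p, deriv H p ≠ 0 := by
    by_contra! hcon
    have := is_const_of_deriv_eq_zero hH hcon 0 1
    exact zero_ne_one (hinj this)
  have hDdiff : Differentiable ℂ (dslope H p) := by
    intro w
    exact ((differentiableOn_dslope (s := univ) (c := p) univ_mem).2
      hH.differentiableOn).differentiableAt univ_mem
  have hD0 : ∀ w, dslope H p w ≠ 0 := by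
    intro w
    rcases eq_or_ne w p with rfl | hw
    · rwa [dslope_same]
    · rw [dslope_of_ne _ hw, slope_def_field]
      exact div_ne_zero (sub_ne_zero.2 (hinj.ne hw)) (sub_ne_zero.2 hw)
  -- Away from `p` this is `(w - p) / (H w - H p)`. It is entire and grows at most linearly, because
  -- injectivity and the open mapping property keep `H w` away from `H p`; so it is affine.
  set q : ℂ → ℂ := fun w => (dslope H p w)⁻¹ with hq
  have hqdiff : Differentiable ℂ q := fun w => (hDdiff w).inv (hD0 w)
  -- `H` stays away from `H p` outside the unit ball around `p`
  obtain ⟨ε, hε, hεb⟩ : ∃ ε > 0, Metric.ball (H p) ε ⊆ H '' Metric.ball p 1 := by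
    have hst : HasStrictDerivAt H (deriv H p) p :=
      ((hH.differentiableOn (s := univ)).analyticAt univ_mem).hasStrictDerivAt
    have : H '' Metric.ball p 1 ∈ 𝓝 (H p) := by
      rw [← hst.map_nhds_eq hp]
      exact image_mem_map (Metric.ball_mem_nhds p one_pos)
    exact Metric.mem_nhds_iff.1 this
  have hfar : ∀ w, 1 ≤ ‖w - p‖ → ε ≤ ‖H w - H p‖ := by
    intro w hw
    by_contra! hlt
    obtain ⟨v, hv, hvw⟩ := hεb (mem_ball_iff_norm.2 hlt)
    rw [hinj hvw, mem_ball_iff_norm] at hv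
    linarith
  have hqb : ∀ w, 1 ≤ ‖w - p‖ → ‖q w‖ ≤ ‖w - p‖ / ε := by
    intro w hw
    have hne : w ≠ p := by rintro rfl; simp at hw; linarith
    simp only [hq, dslope_of_ne _ hne, slope_def_field, inv_div, norm_div]
    exact div_le_div_of_nonneg_left (norm_nonneg _) hε (hfar w hw)
  -- so the slope of `q` is bounded
  have hEdiff : Differentiable ℂ (dslope q p) := by
    intro w
    exact ((differentiableOn_dslope (s := univ) (c := p) univ_mem).2
      hqdiff.differentiableOn).differentiableAt univ_mem
  have hbdd : Bornology.IsBounded (range (dslope q p)) := by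
    obtain ⟨K, hK⟩ := (isCompact_closedBall p 1).exists_bound_of_continuousOn
      hEdiff.continuous.continuousOn
    refine isBounded_iff_forall_norm_le.2 ⟨max K (1 / ε + ‖q p‖), ?_⟩
    rintro _ ⟨w, rfl⟩
    rcases le_total ‖w - p‖ 1 with hw | hw
    · exact (hK w (mem_closedBall_iff_norm.2 hw)).trans (le_max_left _ _)
    · refine le_trans ?_ (le_max_right _ _)
      have hne : w ≠ p := by rintro rfl; simp at hw; linarith
      have hpos : 0 < ‖w - p‖ := by linarith
      rw [dslope_of_ne _ hne, slope_def_field, norm_div, div_le_iff₀ hpos]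
      calc ‖q w - q p‖ ≤ ‖q w‖ + ‖q p‖ := norm_sub_le _ _
        _ ≤ ‖w - p‖ / ε + ‖q p‖ * ‖w - p‖ := by
            gcongr
            · exact hqb w hw
            · exact le_mul_of_one_le_right (norm_nonneg _) hw
        _ = _ := by ring
  obtain ⟨β, hβ⟩ := hEdiff.exists_const_forall_eq_of_bounded hbdd
  have hqaff : ∀ w, q w = q p + (w - p) * β := by
    intro w
    have := sub_smul_dslope q p w
    rw [hβ w, smul_eq_mul] at this
    rw [this]; ring
  -- A nonconstant affine function has a zero, and `q`, being a reciprocal, has none.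
  have hβ0 : β = 0 := by
    by_contra hne
    have := hqaff (p - q p / β)
    rw [show q p + (p - q p / β - p) * β = 0 by field_simp; ring] at this
    exact inv_ne_zero (hD0 _) this
  have hlin : ∀ w, H w = H p + (w - p) * dslope H p p := by
    intro w
    have h2 : dslope H p w = dslope H p p := by
      have := hqaff w
      rw [hβ0, mul_zero, add_zero] at this
      exact inv_injective this
    have := sub_smul_dslope H p w
    rw [h2, smul_eq_mul] at this
    rw [this]; ring
  have hone : dslope H p p = 1 := by
    have := h1 p
    rw [hlin (p + 1)] at this
    linear_combination this
  refine ⟨H p - p, fun w => ?_⟩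
  rw [hlin w, hone]; ring

/-- An injective holomorphic function on a right half-plane commuting with `w ↦ w + 1` is a
translation. -/
theorem eq_add_const_of_injOn_halfPlane {M : ℝ} {H : ℂ → ℂ}
    (hH : DifferentiableOn ℂ H {w | M < w.re}) (hinj : InjOn H {w | M < w.re})
    (h1 : ∀ w : ℂ, M < w.re → H (w + 1) = H w + 1) : ∃ C, ∀ w : ℂ, M < w.re → H w = w + C := by
  have hopen : IsOpen {w : ℂ | M < w.re} := isOpen_lt continuous_const continuous_re
  have hn : ∀ (n : ℕ) (w : ℂ), M < w.re → H (w + n) = H w + n := by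
    intro n w hw
    induction n with
    | zero => simp
    | succ n ih =>
      have : M < (w + n).re := by
        have := n.cast_nonneg (α := ℝ)
        simp; linarith
      push_cast
      rw [← add_assoc, h1 _ this, ih]; ring
  set N : ℂ → ℕ := fun w => ⌈M + 1 - w.re⌉₊ with hN
  have hNw : ∀ w, M < (w + N w).re := by
    intro w
    have := Nat.le_ceil (M + 1 - w.re)
    simp only [add_re, natCast_re, hN]; linarith
  -- The jumps of `N` do no harm: every shift landing in the half-plane gives the same value, so
  -- near each point a fixed integer can be used.
  set E : ℂ → ℂ := fun w => H (w + N w) - N w with hE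
  have hEn : ∀ (n : ℕ) (w : ℂ), M < (w + n).re → E w = H (w + n) - n := by
    intro n w hw
    have e1 := hn n _ (hNw w)
    have e2 := hn (N w) _ hw
    rw [show w + N w + n = w + n + N w by ring] at e1
    simp only [hE]
    linear_combination e2 - e1
  have hEdiff : Differentiable ℂ E := by
    intro w
    set n := N w
    have hev : E =ᶠ[𝓝 w] fun v => H (v + n) - n := by
      have : IsOpen {v : ℂ | M < (v + n).re} := hopen.preimage (by fun_prop : Continuous fun v : ℂ => v + n)
      filter_upwards [this.mem_nhds (hNw w)] with v hv using hEn n v hv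
    refine DifferentiableAt.congr_of_eventuallyEq ?_ hev
    have h2 : DifferentiableAt ℂ H (w + n) := hH.differentiableAt (hopen.mem_nhds (hNw w))
    exact (DifferentiableAt.comp w h2 (by fun_prop : DifferentiableAt ℂ (fun v => v + (n : ℂ)) w)).sub_const _
  have hEinj : Function.Injective E := by
    intro v w hvw
    have hv : M < (v + (N v + N w : ℕ)).re := by
      have := hNw v
      have h3 := (N w).cast_nonneg (α := ℝ)
      simp only [add_re, natCast_re, Nat.cast_add] at *; linarith
    have hw : M < (w + (N v + N w : ℕ)).re := by
      have := hNw w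
      have h3 := (N v).cast_nonneg (α := ℝ)
      simp only [add_re, natCast_re, Nat.cast_add] at *; linarith
    rw [hEn _ _ hv, hEn _ _ hw] at hvw
    exact add_right_cancel (b := ((N v + N w : ℕ) : ℂ)) (hinj hv hw (sub_left_inj.1 hvw))
  obtain ⟨C, hC⟩ := eq_add_const_of_injective_entire hEdiff hEinj (by
    intro w
    have hw : M < (w + 1 + N w).re := by
      have := hNw w
      simp only [add_re, natCast_re, one_re] at *; linarith
    rw [hEn _ _ hw, hEn _ _ (hNw w), show w + 1 + N w = w + N w + 1 by ring, h1 _ (hNw w)]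
    ring)
  refine ⟨C, fun w hw => ?_⟩
  have := hEn 0 w (by simpa using hw)
  rw [hC] at this
  simpa using this.symm

/-- A bounded potential whose increments dominate `(1 + |t|) ^ (-a)`. -/
theorem exists_potential {a : ℝ} (ha : 1 < a) : ∃ (Φ : ℝ → ℝ) (K : ℝ), (∀ t, 0 ≤ Φ t ∧ Φ t ≤ K) ∧
    ∀ t t', t + 1 / 2 ≤ t' → (1 + |t|) ^ (-a) ≤ Φ t' - Φ t := by
  have hint : MeasureTheory.Integrable (fun s : ℝ => (1 + ‖s‖) ^ (-a)) :=
    integrable_one_add_norm (by simpa using ha)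
  have hpos : ∀ s : ℝ, 0 ≤ (1 + ‖s‖) ^ (-a) := fun s => by positivity
  -- The factor 2 makes up for the length 1/2 of the interval, and `2 ^ a` for `1 + |s| ≤ 2 (1 +
  -- |t|)` on it.
  set c : ℝ := 2 * 2 ^ a with hc
  have hc0 : 0 ≤ c := by positivity
  refine ⟨fun t => c * ∫ s in Iic t, (1 + ‖s‖) ^ (-a), c * ∫ s : ℝ, (1 + ‖s‖) ^ (-a), ?_, ?_⟩
  · intro t
    refine ⟨mul_nonneg hc0 (MeasureTheory.integral_nonneg fun s => hpos s), ?_⟩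
    exact mul_le_mul_of_nonneg_left
      (MeasureTheory.setIntegral_le_integral hint (Eventually.of_forall hpos)) hc0
  · intro t t' htt
    have h1 : ∫ s in t..(t + 1 / 2), (1 + ‖s‖) ^ (-a) ≤ ∫ s in t..t', (1 + ‖s‖) ^ (-a) := by
      refine intervalIntegral.integral_mono_interval le_rfl (by linarith) htt
        (Eventually.of_forall hpos) hint.intervalIntegrable
    have h2 : ∫ s in t..(t + 1 / 2), (2 : ℝ) ^ (-a) * (1 + |t|) ^ (-a)
        ≤ ∫ s in t..(t + 1 / 2), (1 + ‖s‖) ^ (-a) := by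
      refine intervalIntegral.integral_mono_on (by linarith) (by simp)
        hint.intervalIntegrable ?_
      intro s hs
      rw [← Real.mul_rpow (by norm_num) (by positivity)]
      refine Real.rpow_le_rpow_of_nonpos (by positivity) ?_ (by linarith)
      rw [Real.norm_eq_abs]
      have : |s| ≤ |t| + |s - t| := by
        calc |s| = |t + (s - t)| := by ring_nf
          _ ≤ _ := abs_add_le _ _
      have h3 : |s - t| ≤ 1 / 2 := by rw [abs_le]; constructor <;> linarith [hs.1, hs.2]
      linarith [abs_nonneg t]
    rw [intervalIntegral.integral_const, smul_eq_mul] at h2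
    rw [← mul_sub, intervalIntegral.integral_Iic_sub_Iic hint.integrableOn hint.integrableOn]
    have h4 : c * ((t + 1 / 2 - t) * (2 ^ (-a) * (1 + |t|) ^ (-a))) = (1 + |t|) ^ (-a) := by
      rw [hc, Real.rpow_neg (by norm_num : (0 : ℝ) ≤ 2)]
      have : (2 : ℝ) ^ a ≠ 0 := by positivity
      field_simp
      ring
    rw [← h4]
    exact mul_le_mul_of_nonneg_left (h2.trans h1) hc0

/-- A bounded holomorphic function on a half-plane is Lipschitz further inside. -/
theorem norm_sub_le_of_bounded_halfPlane {M d K : ℝ} (hd : 0 < d) {u : ℂ → ℂ}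
    (hu : DifferentiableOn ℂ u {w | M < w.re}) (hK : ∀ w : ℂ, M < w.re → ‖u w‖ ≤ K) {x y : ℂ}
    (hx : M + d < x.re) (hy : M + d < y.re) : ‖u x - u y‖ ≤ K / d * ‖x - y‖ := by
  have hopen : IsOpen {w : ℂ | M < w.re} := isOpen_lt continuous_const continuous_re
  have hconv : Convex ℝ {w : ℂ | M + d < w.re} := convex_halfSpace_re_gt _
  rw [norm_sub_rev, norm_sub_rev x]
  refine hconv.norm_image_sub_le_of_norm_deriv_le (f := u) (𝕜 := ℂ) ?_ ?_ hx hy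
  · intro w hw
    exact hu.differentiableAt (hopen.mem_nhds (by simp only [mem_ofPred_eq] at *; linarith))
  · intro w hw
    have hball : ∀ z ∈ Metric.closedBall w d, M < z.re := by
      intro z hz
      have h1 := (abs_re_le_norm (z - w)).trans (mem_closedBall_iff_norm.1 hz)
      have := (abs_le.1 h1).1
      simp only [sub_re, mem_ofPred_eq] at *
      linarith
    refine norm_deriv_le_of_forall_mem_sphere_norm_le hd ?_
      fun z hz => hK z (hball z (Metric.sphere_subset_closedBall hz))
    refine DifferentiableOn.diffContOnCl ?_
    rw [closure_ball _ hd.ne']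
    exact hu.mono hball

/-- In this region 0 is the only zero of `exp s - 1`. The real part is controlled by `‖exp s‖ - 1`.
The imaginary part is controlled by Jordan's inequality up to `π/2`; beyond that the cosine is
nonpositive and `exp s` is at distance at least 1 from 1. -/
theorem norm_le_six_mul_norm_exp_sub_one {s : ℂ} (h0 : 0 ≤ s.re) (h1 : |s.im| ≤ 3 * Real.pi / 2) :
    ‖s‖ ≤ 6 * ‖exp s - 1‖ := by
  have hpi := Real.pi_lt_d2
  have hpi0 := Real.pi_pos
  have hre : (exp s).re = Real.exp s.re * Real.cos s.im := exp_re s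
  have him : (exp s).im = Real.exp s.re * Real.sin s.im := exp_im s
  have hE := Real.add_one_le_exp s.re
  have hsre : s.re ≤ ‖exp s - 1‖ := by
    have := norm_sub_norm_le (exp s) 1
    rw [norm_exp, norm_one] at this
    linarith
  have hs : ‖s‖ ≤ s.re + |s.im| := by
    have := norm_le_abs_re_add_abs_im s
    rwa [abs_of_nonneg h0] at this
  suffices |s.im| ≤ 5 * ‖exp s - 1‖ by linarith
  rcases le_total |s.im| (Real.pi / 2) with h | h
  · have hsin : 2 / Real.pi * |s.im| ≤ |Real.sin s.im| := Real.mul_abs_le_abs_sin h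
    have h2 : |Real.sin s.im| ≤ |(exp s - 1).im| := by
      rw [sub_im, one_im, sub_zero, him, abs_mul, Real.abs_exp]
      exact le_mul_of_one_le_left (abs_nonneg _) (by linarith)
    have h3 := h2.trans (abs_im_le_norm _)
    have h4 : 1 / 2 * |s.im| ≤ 2 / Real.pi * |s.im| := by
      refine mul_le_mul_of_nonneg_right ?_ (abs_nonneg _)
      rw [div_le_div_iff₀ (by norm_num) hpi0]; linarith
    linarith [norm_nonneg (exp s - 1)]
  · have hcos : Real.cos s.im ≤ 0 := by
      rw [← Real.cos_abs]
      exact Real.cos_nonpos_of_pi_div_two_le_of_le h (by linarith)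
    have h2 : 1 ≤ ‖exp s - 1‖ := by
      refine le_trans ?_ (abs_re_le_norm _)
      rw [sub_re, one_re, hre, abs_sub_comm]
      refine le_trans ?_ (le_abs_self _)
      nlinarith [Real.exp_pos s.re]
    linarith

/-- Quantitative surjectivity of a perturbation of the identity: with Lipschitz defect 1/2, the
image of a ball of radius `ε` contains the ball of radius `ε / 2` about the image of its centre. -/
theorem exists_eq_of_lipschitz_sub {H : ℂ → ℂ} {x₀ w : ℂ} {ε : ℝ} (hε : 0 ≤ ε)
    (hH : ∀ x ∈ Metric.closedBall x₀ ε, ∀ y ∈ Metric.closedBall x₀ ε,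
      ‖H x - H y - (x - y)‖ ≤ 1 / 2 * ‖x - y‖) (h0 : ‖H x₀ - w‖ ≤ ε / 2) :
    ∃ x ∈ Metric.closedBall x₀ ε, H x = w := by
  have happ : ApproximatesLinearOn H ((ContinuousLinearEquiv.refl ℂ ℂ : ℂ ≃L[ℂ] ℂ) : ℂ →L[ℂ] ℂ)
      (Metric.closedBall x₀ ε) (1 / 2 : NNReal) := by
    intro x hx y hy
    simpa using hH x hx y hy
  have := happ.surjOn_closedBall_of_nonlinearRightInverse
    (ContinuousLinearEquiv.refl ℂ ℂ).toNonlinearRightInverse hε Subset.rfl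
  have hw : w ∈ Metric.closedBall (H x₀) (((((ContinuousLinearEquiv.refl ℂ ℂ).toNonlinearRightInverse.nnnorm : NNReal) : ℝ)⁻¹ - (1 / 2 : NNReal)) * ε) := by
    rw [mem_closedBall_iff_norm, norm_sub_rev]
    have : (((ContinuousLinearEquiv.refl ℂ ℂ).toNonlinearRightInverse.nnnorm : NNReal) : ℝ) = 1 := by
      simp [ContinuousLinearEquiv.toNonlinearRightInverse]
    rw [this]
    refine h0.trans (le_of_eq ?_)
    push_cast; ring
  exact this hw

end AntiParabolic

/-! ### The coordinate on the model sector -/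

namespace AntiParabolic

open Complex Set Filter

/-- The sector `|arg x| < π / k` of the punctured disc of radius `r`. -/
def sector (k : ℕ) (r : ℝ) : Set ℂ := {x | x ≠ 0 ∧ ‖x‖ < r ∧ |arg x| < Real.pi / k}

/-- The coordinate `1 / (k x^k) + β log x` on the sector. -/
noncomputable def sectorTime (k : ℕ) (β : ℝ) (x : ℂ) : ℂ := 1 / ((k : ℂ) * x ^ k) + β * log x

/-- Smallness of the radius `r`: on the sector the coordinate is of size at least about `Λ` and
close to its principal part. -/
structure SmallRadius (k : ℕ) (β Λ r : ℝ) : Prop where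
  one_le : 1 ≤ k
  pos : 0 < r
  le_one_div : Λ ≤ 1 / (k * r ^ k)
  log_le : ∀ ρ : ℝ, 0 < ρ → ρ < r → |β| * (|Real.log ρ| + Real.pi) ≤ 1 / 100 * (1 / (k * ρ ^ k))

theorem eventually_smallRadius {k : ℕ} (hk : 1 ≤ k) (β Λ : ℝ) :
    ∃ r₀ > 0, ∀ r, 0 < r → r < r₀ → SmallRadius k β Λ r := by
  have hk0 : (0 : ℝ) < k := by exact_mod_cast hk
  have hpow : Tendsto (fun ρ : ℝ => ρ ^ k) (𝓝[>] 0) (𝓝 0) := by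
    have : Tendsto (fun ρ : ℝ => ρ ^ k) (𝓝 0) (𝓝 (0 ^ k)) := (continuous_pow k).tendsto 0
    rw [zero_pow (by omega)] at this
    exact this.mono_left nhdsWithin_le_nhds
  have hlog : Tendsto (fun ρ : ℝ => Real.log ρ * ρ ^ k) (𝓝[>] 0) (𝓝 0) := by
    have := tendsto_log_mul_rpow_nhdsGT_zero hk0
    simpa using this
  have h1 : Tendsto (fun ρ : ℝ => |β| * k * (|Real.log ρ * ρ ^ k| + Real.pi * ρ ^ k)) (𝓝[>] 0) (𝓝 0) := by
    have := ((hlog.abs).add (hpow.const_mul Real.pi)).const_mul (|β| * k)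
    simpa using this
  have h2 : Tendsto (fun ρ : ℝ => Λ * (k * ρ ^ k)) (𝓝[>] 0) (𝓝 0) := by
    have := (hpow.const_mul (k : ℝ)).const_mul Λ
    simpa using this
  have e1 := h1.eventually (gt_mem_nhds (show (0 : ℝ) < 1 / 100 by norm_num))
  have e2 := h2.eventually (gt_mem_nhds (show (0 : ℝ) < 1 by norm_num))
  obtain ⟨r₀, hr₀, hr⟩ := mem_nhdsGT_iff_exists_Ioo_subset.1 (e1.and e2)
  refine ⟨r₀, hr₀, fun r h0 hlt => ⟨hk, h0, ?_, ?_⟩⟩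
  · rw [le_div_iff₀ (by positivity)]
    exact (hr ⟨h0, hlt⟩).2.le
  · intro ρ hρ hρr
    have := (hr ⟨hρ, hρr.trans hlt⟩).1
    rw [mul_one_div, le_div_iff₀ (by positivity)]
    rw [abs_mul, abs_of_pos (pow_pos hρ k)] at this
    linarith

theorem sector_mono {k : ℕ} {r r' : ℝ} (h : r ≤ r') : sector k r ⊆ sector k r' :=
  fun _ hx => ⟨hx.1, hx.2.1.trans_le h, hx.2.2⟩

theorem pi_div_le {k : ℕ} (hk : 1 ≤ k) : Real.pi / k ≤ Real.pi :=
  div_le_self Real.pi_pos.le (by exact_mod_cast hk)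

theorem mem_slitPlane_of_mem_sector {k : ℕ} (hk : 1 ≤ k) {r : ℝ} {x : ℂ} (hx : x ∈ sector k r) :
    x ∈ slitPlane := by
  rw [mem_slitPlane_iff_arg]
  refine ⟨fun h => ?_, hx.1⟩
  have := hx.2.2
  rw [h, abs_of_pos Real.pi_pos] at this
  exact absurd (pi_div_le hk) (not_le.2 this)

theorem isOpen_sector {k : ℕ} (hk : 1 ≤ k) (r : ℝ) : IsOpen (sector k r) := by
  rw [isOpen_iff_mem_nhds]
  intro x hx
  have h1 : ContinuousAt arg x := continuousAt_arg (mem_slitPlane_of_mem_sector hk hx)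
  filter_upwards [isOpen_ne.mem_nhds hx.1,
    (isOpen_lt continuous_norm continuous_const).mem_nhds hx.2.1,
    h1.abs.eventually (gt_mem_nhds hx.2.2)] with y a b c using ⟨a, b, c⟩

theorem norm_principal (k : ℕ) (x : ℂ) : ‖1 / ((k : ℂ) * x ^ k)‖ = 1 / (k * ‖x‖ ^ k) := by simp

/-- The logarithmic term is unbounded in the real direction only. This is why the strip to be
avoided around the cut has the bounded half-width `|β| π`. -/
theorem abs_im_time_sub_le (k : ℕ) (β : ℝ) (x : ℂ) :
    |(sectorTime k β x).im - (1 / ((k : ℂ) * x ^ k)).im| ≤ |β| * Real.pi := by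
  rw [← sub_im, sectorTime, add_sub_cancel_left, im_ofReal_mul, abs_mul, log_im]
  gcongr
  exact abs_arg_le_pi x

namespace SmallRadius

variable {k : ℕ} {β Λ r : ℝ} (h : SmallRadius k β Λ r) {x : ℂ}

include h

theorem cast_pos : (0 : ℝ) < k := by exact_mod_cast h.one_le

theorem le_principal (hx : x ∈ sector k r) : 1 / (k * r ^ k) ≤ 1 / (k * ‖x‖ ^ k) := by
  have := h.cast_pos
  have := norm_pos_iff.2 hx.1
  have := hx.2.1.le
  gcongr

theorem beta_le (hx : x ∈ sector k r) : |β| * 300 ≤ 1 / (k * ‖x‖ ^ k) := by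
  have h1 := h.log_le _ (norm_pos_iff.2 hx.1) hx.2.1
  nlinarith [abs_nonneg β, mul_nonneg (abs_nonneg β) (abs_nonneg (Real.log ‖x‖)), Real.pi_gt_three]

theorem norm_time_sub_le (hx : x ∈ sector k r) :
    ‖sectorTime k β x - 1 / ((k : ℂ) * x ^ k)‖ ≤ 1 / 100 * (1 / (k * ‖x‖ ^ k)) := by
  refine le_trans ?_ (h.log_le _ (norm_pos_iff.2 hx.1) hx.2.1)
  rw [sectorTime, add_sub_cancel_left, norm_mul, norm_real, Real.norm_eq_abs]
  gcongr
  refine (norm_le_abs_re_add_abs_im _).trans ?_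
  rw [log_re, log_im]
  gcongr
  exact abs_arg_le_pi x

theorem norm_time_le (hx : x ∈ sector k r) :
    ‖sectorTime k β x‖ ≤ 101 / 100 * (1 / (k * ‖x‖ ^ k)) := by
  have h1 := h.norm_time_sub_le hx
  have h2 := norm_sub_norm_le (sectorTime k β x) (1 / ((k : ℂ) * x ^ k))
  rw [norm_principal] at h2
  linarith

theorem le_norm_time (hx : x ∈ sector k r) :
    99 / 100 * (1 / (k * ‖x‖ ^ k)) ≤ ‖sectorTime k β x‖ := by
  have h1 := h.norm_time_sub_le hx
  rw [norm_sub_rev] at h1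
  have h2 := norm_sub_norm_le (1 / ((k : ℂ) * x ^ k)) (sectorTime k β x)
  rw [norm_principal] at h2
  linarith

theorem mul_pow_le (hΛ : 100 ≤ Λ) (hx : 0 ≤ ‖x‖ ∧ ‖x‖ < r) : k * ‖x‖ ^ k ≤ 1 / 100 := by
  have h0 := h.cast_pos
  have h1 : k * ‖x‖ ^ k ≤ k * r ^ k := by gcongr; exact hx.2.le
  have h2 := hΛ.trans h.le_one_div
  rw [le_div_iff₀ (by have := h.pos; positivity)] at h2
  linarith

theorem principal_eq (hx : x ≠ 0) : 1 / ((k : ℂ) * x ^ k)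
    = ((1 / (k * ‖x‖ ^ k) : ℝ) : ℂ) * exp (((-(k * arg x) : ℝ) : ℂ) * I) := by
  have h1 : x ^ k = (‖x‖ : ℂ) ^ k * exp (((k * arg x : ℝ) : ℂ) * I) := by
    conv_lhs => rw [← norm_mul_exp_arg_mul_I x, mul_pow, ← exp_nat_mul]
    push_cast; ring_nf
  have h2 : (‖x‖ : ℂ) ≠ 0 := by simpa using hx
  have h3 : (k : ℂ) ≠ 0 := by exact_mod_cast h.cast_pos.ne'
  rw [h1, ofReal_neg, neg_mul, exp_neg]
  have := exp_ne_zero (((k * arg x : ℝ) : ℂ) * I)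
  push_cast at *
  field_simp

theorem principal_re (hx : x ≠ 0) : (1 / ((k : ℂ) * x ^ k)).re
    = 1 / (k * ‖x‖ ^ k) * Real.cos (k * arg x) := by
  rw [h.principal_eq hx, re_ofReal_mul, exp_ofReal_mul_I_re, Real.cos_neg]

theorem principal_im (hx : x ≠ 0) : (1 / ((k : ℂ) * x ^ k)).im
    = -(1 / (k * ‖x‖ ^ k) * Real.sin (k * arg x)) := by
  rw [h.principal_eq hx, im_ofReal_mul, exp_ofReal_mul_I_im, Real.sin_neg, mul_neg]

theorem abs_mul_arg_lt (hx : x ∈ sector k r) : |k * arg x| < Real.pi := by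
  have := hx.2.2
  rw [lt_div_iff₀ h.cast_pos] at this
  rwa [abs_mul, Nat.abs_cast, mul_comm]

/-- The principal part has argument `-k arg x`. Beyond `3π/4` its cosine is below `-1/2`, which the
one percent error of the logarithm cannot compensate. -/
theorem abs_mul_arg_le (hx : x ∈ sector k r) (h0 : 0 ≤ (sectorTime k β x).re) :
    |k * arg x| ≤ 3 * Real.pi / 4 := by
  have hpos : 0 < 1 / (k * ‖x‖ ^ k) := by
    have := h.cast_pos
    have := norm_pos_iff.2 hx.1
    positivity
  by_contra! hlt
  have h1 := h.abs_mul_arg_lt hx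
  have hc : Real.cos (k * arg x) ≤ -(1 / 2) := by
    rw [← Real.cos_abs]
    have h2 : Real.cos |k * arg x| ≤ Real.cos (3 * Real.pi / 4) :=
      Real.cos_le_cos_of_nonneg_of_le_pi (by positivity) h1.le hlt.le
    have h3 : Real.cos (3 * Real.pi / 4) ≤ Real.cos (2 * Real.pi / 3) :=
      Real.cos_le_cos_of_nonneg_of_le_pi (by positivity) (by linarith [Real.pi_pos])
        (by linarith [Real.pi_pos])
    have h4 : Real.cos (2 * Real.pi / 3) = -(1 / 2) := by
      rw [show 2 * Real.pi / 3 = Real.pi - Real.pi / 3 by ring, Real.cos_pi_sub, Real.cos_pi_div_three]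
    linarith
  have h5 := (abs_re_le_norm _).trans (h.norm_time_sub_le hx)
  rw [sub_re, h.principal_re hx.1] at h5
  have h6 := (abs_le.1 h5).2
  nlinarith

theorem hasDerivAt_time (hx : x ∈ sector k r) : HasDerivAt (sectorTime k β)
    (-(1 / x ^ (k + 1)) + β / x) x := by
  have hk : (k : ℂ) ≠ 0 := by exact_mod_cast h.cast_pos.ne'
  have hx0 := hx.1
  have h1 : HasDerivAt (fun x : ℂ => 1 / ((k : ℂ) * x ^ k)) (-(1 / x ^ (k + 1))) x := by
    have := ((hasDerivAt_pow k x).const_mul (k : ℂ)).fun_inv (mul_ne_zero hk (pow_ne_zero k hx0))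
    have e : -(1 / x ^ (k + 1)) = -(k * (k * x ^ (k - 1))) / (k * x ^ k) ^ 2 := by
      obtain ⟨n, rfl⟩ : ∃ n, k = n + 1 := ⟨k - 1, by have := h.one_le; omega⟩
      rw [add_tsub_cancel_right]
      field_simp
      ring
    rw [e]
    simpa only [one_div] using this
  have h2 := (hasDerivAt_log (mem_slitPlane_of_mem_sector h.one_le hx)).const_mul (β : ℂ)
  exact h1.add h2

theorem deriv_time_ne_zero (hx : x ∈ sector k r) : deriv (sectorTime k β) x ≠ 0 := by
  rw [(h.hasDerivAt_time hx).deriv]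
  intro h0
  have hx0 := hx.1
  have hk0 := h.cast_pos
  have hn := norm_pos_iff.2 hx.1
  have h1 : (β : ℂ) * x ^ k = 1 := by
    have : -(1 / x ^ (k + 1)) + (β : ℂ) / x = (β * x ^ k - 1) / x ^ (k + 1) := by
      field_simp; ring
    rw [this, div_eq_zero_iff, or_iff_left (pow_ne_zero _ hx0)] at h0
    linear_combination h0
  have h2 : |β| * ‖x‖ ^ k = 1 := by
    have := congrArg norm h1
    simpa using this
  have h3 := h.beta_le hx
  rw [le_div_iff₀ (by positivity)] at h3
  have hk1 : (1 : ℝ) ≤ k := by exact_mod_cast h.one_le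
  nlinarith

theorem differentiableOn_time : DifferentiableOn ℂ (sectorTime k β) (sector k r) :=
  fun _ hx => (h.hasDerivAt_time hx).differentiableAt.differentiableWithinAt

/-- With `t = log x₂ - log x₁` and `s = k t`, equality of the coordinates reads `(exp s - 1) / (k
x₂^k) = β t`. The left side has norm at least `300 |β| ‖exp s - 1‖`, while the right side is at most
`6 |β| ‖exp s - 1‖`; this forces `t = 0`. The order of the norms gives `s` a nonnegative real part.
-/
theorem time_inj_aux {x₁ x₂ : ℂ} (h₁ : x₁ ∈ sector k r) (h₂ : x₂ ∈ sector k r)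
    (heq : sectorTime k β x₁ = sectorTime k β x₂)
    (harg : |k * arg x₁ - k * arg x₂| ≤ 3 * Real.pi / 2) (hn : ‖x₁‖ ≤ ‖x₂‖) : x₁ = x₂ := by
  have hk : (k : ℂ) ≠ 0 := by exact_mod_cast h.cast_pos.ne'
  have hk1 : (1 : ℝ) ≤ k := by exact_mod_cast h.one_le
  set t := log x₂ - log x₁ with ht
  set s : ℂ := k * t with hs
  have hn1 := norm_pos_iff.2 h₁.1
  have hsre : 0 ≤ s.re := by
    have : s.re = k * (Real.log ‖x₂‖ - Real.log ‖x₁‖) := by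
      simp [hs, ht, log_re]
    rw [this]
    exact mul_nonneg (by positivity) (sub_nonneg.2 (Real.log_le_log hn1 hn))
  have hsim : |s.im| ≤ 3 * Real.pi / 2 := by
    have : s.im = k * arg x₂ - k * arg x₁ := by
      simp [hs, ht, log_im]; ring
    rwa [this, abs_sub_comm]
  have hes : exp s = x₂ ^ k / x₁ ^ k := by
    rw [hs, exp_nat_mul, ht, exp_sub, exp_log h₁.1, exp_log h₂.1, div_pow]
  have hrel : 1 / ((k : ℂ) * x₂ ^ k) * (exp s - 1) = β * t := by
    have hx1 := h₁.1
    have hx2 := h₂.1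
    have : 1 / ((k : ℂ) * x₂ ^ k) * (exp s - 1)
        = 1 / ((k : ℂ) * x₁ ^ k) - 1 / ((k : ℂ) * x₂ ^ k) := by
      rw [hes]; field_simp
    rw [this, ht]
    simp only [sectorTime] at heq
    linear_combination heq
  have h6 := norm_le_six_mul_norm_exp_sub_one hsre hsim
  have hnorm := congrArg norm hrel
  rw [norm_mul, norm_principal, norm_mul, norm_real, Real.norm_eq_abs] at hnorm
  have hts : ‖t‖ ≤ ‖s‖ := by
    rw [hs, norm_mul, norm_natCast]
    exact le_mul_of_one_le_left (norm_nonneg _) hk1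
  have hbeta := h.beta_le h₂
  have hpos : 0 < 1 / (k * ‖x₂‖ ^ k) := by
    have := norm_pos_iff.2 h₂.1
    positivity
  have hz : ‖exp s - 1‖ = 0 := by
    by_contra hne
    have hp : 0 < ‖exp s - 1‖ := lt_of_le_of_ne (norm_nonneg _) (Ne.symm hne)
    have : |β| * ‖t‖ ≤ |β| * (6 * ‖exp s - 1‖) :=
      mul_le_mul_of_nonneg_left (hts.trans h6) (abs_nonneg _)
    rw [← hnorm] at this
    have h7 : |β| * 300 * ‖exp s - 1‖ ≤ 1 / (k * ‖x₂‖ ^ k) * ‖exp s - 1‖ :=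
      mul_le_mul_of_nonneg_right hbeta hp.le
    have h8 := mul_pos hpos hp
    linarith
  have ht0 : t = 0 := by
    rw [hz, mul_zero] at h6
    exact norm_le_zero_iff.1 (hts.trans h6)
  rw [← exp_log h₁.1, ← exp_log h₂.1]
  rw [ht, sub_eq_zero] at ht0
  rw [ht0]

/-- Points near the two edges of the sector could share a value. If the real part is nonnegative,
both angles `k arg` lie in `[-3π/4, 3π/4]`. If the imaginary part exceeds what the logarithm
contributes, the two angles have the same sign. In both cases they differ by at most `3π/2`. -/
theorem time_inj {x₁ x₂ : ℂ} (h₁ : x₁ ∈ sector k r) (h₂ : x₂ ∈ sector k r)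
    (heq : sectorTime k β x₁ = sectorTime k β x₂)
    (hcore : 0 ≤ (sectorTime k β x₁).re ∨ |β| * Real.pi < |(sectorTime k β x₁).im|) : x₁ = x₂ := by
  have harg : |k * arg x₁ - k * arg x₂| ≤ 3 * Real.pi / 2 := by
    rcases hcore with h0 | h0
    · have a := h.abs_mul_arg_le h₁ h0
      have b := h.abs_mul_arg_le h₂ (heq ▸ h0)
      rw [abs_le] at *
      constructor <;> linarith [a.1, a.2, b.1, b.2]
    · have key : ∀ x ∈ sector k r, (|β| * Real.pi < (sectorTime k β x).im → k * arg x < 0) ∧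
          ((sectorTime k β x).im < -(|β| * Real.pi) → 0 < k * arg x) := by
        intro x hx
        have hpos : 0 < 1 / (k * ‖x‖ ^ k) := by
          have := h.cast_pos
          have := norm_pos_iff.2 hx.1
          positivity
        have h1 := abs_le.1 (abs_im_time_sub_le k β x)
        rw [h.principal_im hx.1] at h1
        have h2 := abs_lt.1 (h.abs_mul_arg_lt hx)
        constructor
        · intro h3
          by_contra! h4
          have := Real.sin_nonneg_of_nonneg_of_le_pi h4 h2.2.le
          nlinarith [h1.1, h1.2]
        · intro h3
          by_contra! h4
          have := Real.sin_nonpos_of_nonpos_of_neg_pi_le h4 h2.1.le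
          nlinarith [h1.1, h1.2]
      have a := abs_lt.1 (h.abs_mul_arg_lt h₁)
      have b := abs_lt.1 (h.abs_mul_arg_lt h₂)
      have hpi := Real.pi_pos
      rw [abs_le]
      rcases lt_abs.1 h0 with h0 | h0
      · have c := (key x₁ h₁).1 h0
        have d := (key x₂ h₂).1 (heq ▸ h0)
        constructor <;> linarith
      · have c := (key x₁ h₁).2 (by linarith)
        have d := (key x₂ h₂).2 (heq ▸ (by linarith))
        constructor <;> linarith
  rcases le_total ‖x₁‖ ‖x₂‖ with hn | hn
  · exact h.time_inj_aux h₁ h₂ heq harg hn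
  · exact (h.time_inj_aux h₂ h₁ heq.symm (by rwa [abs_sub_comm]) hn).symm

/-- The point of the sector at which the principal part of the coordinate is `ζ`. -/
theorem exists_principal_eq {ζ : ℂ} (hζ : ζ ∈ slitPlane) (hr : 1 / (k * r ^ k) < ‖ζ‖) :
    ∃ x ∈ sector k r, 1 / ((k : ℂ) * x ^ k) = ζ ∧ log x = -(log ((k : ℂ) * ζ) / k) := by
  have hk0 := h.cast_pos
  have hk : (k : ℂ) ≠ 0 := by exact_mod_cast hk0.ne'
  have hζ0 : ζ ≠ 0 := slitPlane_ne_zero hζ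
  have hkζ : (k : ℂ) * ζ ≠ 0 := mul_ne_zero hk hζ0
  have hargeq : arg ((k : ℂ) * ζ) = arg ζ := by
    have := arg_real_mul ζ hk0
    simpa using this
  have harglt : |arg ζ| < Real.pi := by
    rw [abs_lt]
    exact ⟨neg_pi_lt_arg ζ, lt_of_le_of_ne (arg_le_pi ζ) (slitPlane_arg_ne_pi hζ)⟩
  set L : ℂ := -(log ((k : ℂ) * ζ) / k) with hL
  have hLim : L.im = -(arg ζ / k) := by
    rw [hL, neg_im, div_natCast_im, log_im, hargeq]
  have hLabs : |L.im| < Real.pi / k := by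
    rw [hLim, abs_neg, abs_div, Nat.abs_cast]
    gcongr
  have hlog : log (exp L) = L := by
    have := abs_lt.1 (hLabs.trans_le (pi_div_le h.one_le))
    exact log_exp this.1 this.2.le
  have hpow : exp L ^ k = ((k : ℂ) * ζ)⁻¹ := by
    rw [← exp_nat_mul, hL, mul_neg, mul_div_cancel₀ _ hk, exp_neg, exp_log hkζ]
  refine ⟨exp L, ⟨exp_ne_zero _, ?_, ?_⟩, ?_, hlog⟩
  · have h1 : ‖exp L‖ ^ k = (k * ‖ζ‖)⁻¹ := by
      rw [← norm_pow, hpow, norm_inv, norm_mul, norm_natCast]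
    refine lt_of_pow_lt_pow_left₀ k h.pos.le ?_
    have hrk : 0 < r ^ k := pow_pos h.pos k
    rw [div_lt_iff₀ (by positivity)] at hr
    rw [h1, inv_lt_iff_one_lt_mul₀ (by positivity)]
    linarith
  · rw [← log_im, hlog]; exact hLabs
  · rw [hpow]; field_simp

theorem exists_time_eq {W : ℂ} (hW : 2 * (1 / (k * r ^ k)) < W.re) :
    ∃ x ∈ sector k r, sectorTime k β x = W := by
  have hk0 := h.cast_pos
  have hk : (k : ℂ) ≠ 0 := by exact_mod_cast hk0.ne'
  have hk1 : (1 : ℝ) ≤ k := by exact_mod_cast h.one_le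
  have hR : 0 < 1 / (k * r ^ k) := by have := h.pos; positivity
  have hWn : W.re ≤ ‖W‖ := (le_abs_self _).trans (abs_re_le_norm W)
  -- Since `W` has positive real part, its distance to the closed negative axis is `‖W‖`.
  have hball : ∀ ζ ∈ Metric.closedBall W (‖W‖ / 2), ζ ∈ slitPlane ∧ ‖W‖ / 2 ≤ ‖ζ‖ := by
    intro ζ hζ
    rw [mem_closedBall_iff_norm] at hζ
    have h2 : ‖W‖ / 2 ≤ ‖ζ‖ := by
      have := norm_sub_norm_le W ζ
      rw [norm_sub_rev] at this
      linarith
    refine ⟨?_, h2⟩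
    by_contra hns
    rw [mem_slitPlane_iff, not_or, not_lt, not_not] at hns
    have h3 : ‖W‖ ^ 2 ≤ ‖ζ - W‖ ^ 2 := by
      rw [← normSq_eq_norm_sq, ← normSq_eq_norm_sq, normSq_apply, normSq_apply]
      simp only [sub_re, sub_im, hns.2]
      nlinarith [hns.1]
    have h4 : ‖ζ - W‖ ^ 2 ≤ (‖W‖ / 2) ^ 2 := by gcongr
    nlinarith
  -- The coordinate as a function of its principal part `ζ`, using `log x = -log (k ζ) / k`. The
  -- derivative of `p - id` is `-β / (k ζ)`, which is small, so `p ζ = W` can be solved by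
  -- perturbation.
  set p : ℂ → ℂ := fun ζ => ζ - β / k * log (k * ζ) with hp
  have hkslit : ∀ ζ ∈ slitPlane, (k : ℂ) * ζ ∈ slitPlane := by
    intro ζ hζ
    have : arg ((k : ℂ) * ζ) = arg ζ := by simpa using arg_real_mul ζ hk0
    rw [mem_slitPlane_iff_arg] at hζ ⊢
    rw [this]
    exact ⟨hζ.1, mul_ne_zero hk hζ.2⟩
  have hptime : ∀ ζ ∈ slitPlane, 1 / (k * r ^ k) < ‖ζ‖ → ∃ x ∈ sector k r, sectorTime k β x = p ζ ∧
      1 / ((k : ℂ) * x ^ k) = ζ := by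
    intro ζ hζ hn
    obtain ⟨x, hx, h1, h2⟩ := h.exists_principal_eq hζ hn
    refine ⟨x, hx, ?_, h1⟩
    rw [sectorTime, h1, h2, hp]
    ring
  obtain ⟨ζ, hζ, hζW⟩ : ∃ ζ ∈ Metric.closedBall W (‖W‖ / 2), p ζ = W := by
    refine exists_eq_of_lipschitz_sub (by positivity) ?_ ?_
    · intro x hx y hy
      have hd : ∀ ζ ∈ Metric.closedBall W (‖W‖ / 2),
          HasDerivAt (fun ζ => p ζ - ζ) (-(β / k * (k / (k * ζ)))) ζ := by
        intro ζ hζ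
        have h1 : HasDerivAt (fun ζ : ℂ => (k : ℂ) * ζ) k ζ := by
          simpa using (hasDerivAt_id ζ).const_mul (k : ℂ)
        have h2 := (h1.clog (hkslit ζ (hball ζ hζ).1)).const_mul ((β : ℂ) / k)
        have h3 := h2.neg
        refine h3.congr_of_eventuallyEq (Eventually.of_forall fun ζ => ?_)
        simp [hp]
      have hb : ∀ ζ ∈ Metric.closedBall W (‖W‖ / 2), ‖-((β : ℂ) / k * (k / (k * ζ)))‖ ≤ 1 / 2 := by
        intro ζ hζ
        have hζ0 := (hball ζ hζ).2
        have hζpos : 0 < ‖ζ‖ := by linarith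
        have hζ1 : ζ ≠ 0 := norm_pos_iff.1 hζpos
        obtain ⟨x, hx, -, h2⟩ := hptime ζ (hball ζ hζ).1 (by linarith)
        have h3 := h.beta_le hx
        rw [← norm_principal, h2] at h3
        rw [show -((β : ℂ) / k * (k / (k * ζ))) = -(β / (k * ζ)) by field_simp, norm_neg, norm_div,
          norm_mul, norm_real, Real.norm_eq_abs, Complex.norm_natCast, div_le_iff₀ (by positivity)]
        nlinarith [abs_nonneg β]
      have := (convex_closedBall W (‖W‖ / 2)).norm_image_sub_le_of_norm_hasDerivWithin_le
        (fun ζ hζ => (hd ζ hζ).hasDerivWithinAt) hb hy hx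
      rw [show p x - p y - (x - y) = p x - x - (p y - y) by ring]
      exact this
    · obtain ⟨x, hx, h1, h2⟩ := hptime W (hball W (Metric.mem_closedBall_self (by positivity))).1
        (by linarith)
      have h3 := h.norm_time_sub_le hx
      rw [← norm_principal, h1, h2] at h3
      linarith [norm_nonneg W]
  obtain ⟨x, hx, h1, -⟩ := hptime ζ (hball ζ hζ).1 (by linarith [(hball ζ hζ).2])
  exact ⟨x, hx, h1.trans hζW⟩

/-- The inverse of the coordinate on a right half-plane. -/
theorem exists_time_inverse : ∃ Q : ℂ → ℂ,
    DifferentiableOn ℂ Q {W | 2 * (1 / (k * r ^ k)) < W.re} ∧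
    (∀ W : ℂ, 2 * (1 / (k * r ^ k)) < W.re → Q W ∈ sector k r ∧ sectorTime k β (Q W) = W) ∧
    ∀ x ∈ sector k r, 2 * (1 / (k * r ^ k)) < (sectorTime k β x).re → Q (sectorTime k β x) = x := by
  have hR : 0 < 1 / (k * r ^ k) := by have := h.cast_pos; have := h.pos; positivity
  set s := {x | x ∈ sector k r ∧ 2 * (1 / (k * r ^ k)) < (sectorTime k β x).re} with hs
  have hso : IsOpen s := by
    have h1 : ContinuousOn (fun x => (sectorTime k β x).re) (sector k r) :=
      continuous_re.comp_continuousOn h.differentiableOn_time.continuousOn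
    exact h1.isOpen_inter_preimage (isOpen_sector h.one_le r) isOpen_Ioi
  classical
  set Q : ℂ → ℂ := fun W => if hW : 2 * (1 / (k * r ^ k)) < W.re then
    (h.exists_time_eq hW).choose else 0 with hQ
  have hQ1 : ∀ W : ℂ, 2 * (1 / (k * r ^ k)) < W.re →
      Q W ∈ sector k r ∧ sectorTime k β (Q W) = W := by
    intro W hW
    simp only [hQ, dif_pos hW]
    exact (h.exists_time_eq hW).choose_spec
  have hQ2 : ∀ x ∈ sector k r, 2 * (1 / (k * r ^ k)) < (sectorTime k β x).re →
      Q (sectorTime k β x) = x := by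
    intro x hx hW
    have := hQ1 _ hW
    exact h.time_inj this.1 hx this.2 (Or.inl (by rw [this.2]; linarith))
  refine ⟨Q, ?_, hQ1, hQ2⟩
  have := (isOpen_image_and_differentiableOn_leftInverse hso
    (h.differentiableOn_time.mono fun x hx => hx.1) (fun x hx => h.deriv_time_ne_zero hx.1)
    (fun x hx => hQ2 x hx.1 hx.2)).2
  refine this.mono fun W hW => ?_
  exact ⟨Q W, ⟨(hQ1 W hW).1, by rw [(hQ1 W hW).2]; exact hW⟩, (hQ1 W hW).2⟩

end SmallRadius

end AntiParabolic

/-! ### Half shifts and the region far to the right -/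

namespace AntiParabolic

open Complex Set Filter

/-- `φ` is an antiholomorphic map of the disc of radius `r`, close to complex conjugation, which in
the coordinate `sectorTime` is the composition of conjugation and the translation by `σ / 2`, up to
`O(‖x‖ ^ (k + 1))`. The condition on the arguments says that no branch cut is crossed. -/
structure IsHalfShift (k : ℕ) (β C r σ : ℝ) (φ : ℂ → ℂ) : Prop where
  differentiableOn : DifferentiableOn ℂ (fun x => φ (conj x)) (Metric.ball 0 r)
  close : ∀ x, ‖x‖ < r → ‖φ x - conj x‖ ≤ ‖x‖ ^ (k + 1)
  estimate : ∀ x ∈ sector k r, φ x ∈ sector k r → |arg x + arg (φ x)| < Real.pi →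
    ‖sectorTime k β (φ x) - conj (sectorTime k β x) - σ / 2‖ ≤ C * ‖x‖ ^ (k + 1)

/-- Points far to the right in the coordinate. -/
def deep (k : ℕ) (β r : ℝ) : Set ℂ :=
  {x | x ∈ sector k r ∧ 2 * 4 ^ k * (1 / (k * r ^ k)) < (sectorTime k β x).re}

theorem IsHalfShift.mono {k : ℕ} {β C r r' σ : ℝ} {φ : ℂ → ℂ} (h : IsHalfShift k β C r σ φ)
    (hr : r' ≤ r) : IsHalfShift k β C r' σ φ :=
  ⟨h.differentiableOn.mono (Metric.ball_subset_ball hr), fun x hx => h.close x (hx.trans_le hr),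
    fun x hx hy => h.estimate x (sector_mono hr hx) (sector_mono hr hy)⟩

theorem IsHalfShift.norm_le {k : ℕ} {β C r σ : ℝ} {φ : ℂ → ℂ} (hφ : IsHalfShift k β C r σ φ) {x : ℂ}
    (hx : ‖x‖ < r) : ‖φ x‖ ≤ ‖x‖ * (1 + ‖x‖ ^ k) := by
  have h1 := hφ.close x hx
  have h2 := norm_sub_norm_le (φ x) (conj x)
  rw [norm_conj] at h2
  rw [pow_succ] at h1
  linarith

theorem abs_arg_one_add_le {η : ℂ} (h : ‖η‖ ≤ 1 / 2) : |arg (1 + η)| ≤ 3 / 2 * ‖η‖ := by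
  rw [← log_im]
  exact (abs_im_le_norm _).trans (norm_log_one_add_half_le_self h)

theorem arg_mul_one_add {z η : ℂ} (hz : z ≠ 0) (h : ‖η‖ ≤ 1 / 2)
    (harg : |arg z| + 3 / 2 * ‖η‖ < Real.pi) : arg (z * (1 + η)) = arg z + arg (1 + η) := by
  have h1 : 1 + η ≠ 0 := fun h0 => by
    have : ‖η‖ = 1 := by rw [show η = -1 by linear_combination h0]; simp
    linarith
  rw [arg_mul_eq_add_arg_iff hz h1]
  have h2 := abs_le.1 (abs_arg_one_add_le h)
  have h3 := abs_le.1 (le_refl |arg z|)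
  constructor <;> linarith [h2.1, h2.2, h3.1, h3.2]

namespace SmallRadius

variable {k : ℕ} {β Λ r : ℝ} (h : SmallRadius k β Λ r) {x : ℂ}

include h

theorem pow_le (hΛ : 100 ≤ Λ) (hx : ‖x‖ < r) : ‖x‖ ^ k ≤ 1 / 100 := by
  have h1 := h.mul_pow_le hΛ ⟨norm_nonneg x, hx⟩
  have hk1 : (1 : ℝ) ≤ k := by exact_mod_cast h.one_le
  have := pow_nonneg (norm_nonneg x) k
  nlinarith

theorem pow_succ_le (hΛ : 100 ≤ Λ) (hx : ‖x‖ < r) : Λ * ‖x‖ ^ (k + 1) ≤ 1 := by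
  have hk1 : (1 : ℝ) ≤ k := by exact_mod_cast h.one_le
  have hrk : 0 < r ^ k := pow_pos h.pos k
  have h1 := h.le_one_div
  rw [le_div_iff₀ (by positivity)] at h1
  have h2 : ‖x‖ ≤ 1 := by
    have := h.pow_le hΛ hx
    by_contra! hc
    have := one_le_pow₀ hc.le (n := k)
    linarith
  have h3 : ‖x‖ ^ k ≤ r ^ k := by gcongr
  have h4 := pow_nonneg (norm_nonneg x) k
  calc Λ * ‖x‖ ^ (k + 1) = Λ * ‖x‖ ^ k * ‖x‖ := by ring
    _ ≤ Λ * ‖x‖ ^ k * 1 := by gcongr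
    _ ≤ Λ * (k * r ^ k) := by
      rw [mul_one]
      refine mul_le_mul_of_nonneg_left ?_ (by linarith)
      nlinarith
    _ ≤ 1 := h1

/-- Writing `‖x‖^(k+1) = (‖x‖^k)^(1 + 1/k)`, with `‖x‖^k` at most a constant over the size of the
coordinate, turns the error of a half shift into a power of the real part with exponent below `-1`,
hence summable along orbits. -/
theorem pow_succ_le_rpow (hΛ : 100 ≤ Λ) (hx : x ∈ sector k r) : ‖x‖ ^ (k + 1) ≤
    2 ^ (1 + 1 / (k : ℝ)) * (1 + |(sectorTime k β x).re|) ^ (-(1 + 1 / (k : ℝ))) := by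
  have hk1 : (1 : ℝ) ≤ k := by exact_mod_cast h.one_le
  have hx0 := norm_pos_iff.2 hx.1
  have hxk : 0 < ‖x‖ ^ k := pow_pos hx0 k
  have h1 := (abs_re_le_norm _).trans (h.norm_time_le hx)
  have h2 := (hΛ.trans h.le_one_div).trans (h.le_principal hx)
  have h3 : 1 + |(sectorTime k β x).re| ≤ 2 * (1 / (k * ‖x‖ ^ k)) := by linarith
  have h4 : 1 / (k * ‖x‖ ^ k) ≤ 1 / ‖x‖ ^ k := by
    apply one_div_le_one_div_of_le hxk
    exact le_mul_of_one_le_left hxk.le hk1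
  have h5 : (1 + |(sectorTime k β x).re|) * ‖x‖ ^ k ≤ 2 := by
    have := h3.trans (mul_le_mul_of_nonneg_left h4 (by norm_num))
    rwa [mul_one_div, le_div_iff₀ hxk] at this
  have hpos : 0 < 1 + |(sectorTime k β x).re| := by positivity
  have h6 : ‖x‖ ^ k ≤ 2 / (1 + |(sectorTime k β x).re|) := by
    rw [le_div_iff₀ hpos]; linarith
  have h7 : ‖x‖ ^ (k + 1) = (‖x‖ ^ k) ^ (1 + 1 / (k : ℝ)) := by
    rw [← Real.rpow_natCast, ← Real.rpow_natCast, ← Real.rpow_mul hx0.le]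
    congr 1
    push_cast
    field_simp
  rw [h7, Real.rpow_neg hpos.le, ← div_eq_mul_inv, ← Real.div_rpow (by norm_num) hpos.le]
  exact Real.rpow_le_rpow hxk.le h6 (by positivity)

/-- The factor `4 ^ k` in the depth is there for this: for `‖x‖ ≥ r / 4` the coordinate has norm at
most `1.01 * 4^k / (k r^k)`. The room between `r / 4` and `r` keeps the images in the disc. -/
theorem norm_lt_of_mem_deep (hx : x ∈ deep k β r) : ‖x‖ < r / 4 := by
  have hk0 := h.cast_pos
  have hr := h.pos
  have hx0 := norm_pos_iff.2 hx.1.1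
  have h1 := ((le_abs_self _).trans (abs_re_le_norm _)).trans (h.norm_time_le hx.1)
  have h2 := hx.2.trans_le h1
  by_contra! hc
  have h3 : (r / 4) ^ k ≤ ‖x‖ ^ k := by gcongr
  rw [div_pow] at h3
  have h4 : 1 / (k * ‖x‖ ^ k) ≤ 4 ^ k * (1 / (k * r ^ k)) := by
    rw [show 4 ^ k * (1 / (k * r ^ k)) = 1 / (k * (r ^ k / 4 ^ k)) by field_simp]
    gcongr
  have : 0 < 4 ^ k * (1 / (k * r ^ k)) := by positivity
  linarith

theorem depth_pos : 0 < 2 * 4 ^ k * (1 / (k * r ^ k)) := by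
  have hk0 := h.cast_pos
  have hr := h.pos
  positivity

theorem two_mul_le_depth : 2 * (1 / (k * r ^ k)) ≤ 2 * 4 ^ k * (1 / (k * r ^ k)) := by
  have hk0 := h.cast_pos
  have hr := h.pos
  have : (1 : ℝ) ≤ 4 ^ k := one_le_pow₀ (by norm_num)
  have h2 : 0 < 1 / (k * r ^ k) := by positivity
  nlinarith

theorem isOpen_deep : IsOpen (deep k β r) := by
  have h1 : ContinuousOn (fun x => (sectorTime k β x).re) (sector k r) :=
    continuous_re.comp_continuousOn h.differentiableOn_time.continuousOn
  exact h1.isOpen_inter_preimage (isOpen_sector h.one_le r) isOpen_Ioi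

end SmallRadius

namespace IsHalfShift

variable {k : ℕ} {β C Λ r σ : ℝ} {φ : ℂ → ℂ} (hφ : IsHalfShift k β C r σ φ)
  (h : SmallRadius k β Λ r) {x : ℂ}

include hφ h

theorem norm_le' (hΛ : 100 ≤ Λ) (hx : ‖x‖ < r) : ‖φ x‖ ≤ 101 / 100 * ‖x‖ := by
  have h1 := hφ.norm_le hx
  have h2 := h.pow_le hΛ hx
  nlinarith [norm_nonneg x]

theorem le_norm' (hΛ : 100 ≤ Λ) (hx : ‖x‖ < r) : 99 / 100 * ‖x‖ ≤ ‖φ x‖ := by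
  have h1 := hφ.close x hx
  have h2 := norm_sub_norm_le (conj x) (φ x)
  rw [norm_conj, norm_sub_rev] at h2
  rw [pow_succ] at h1
  have h3 := h.pow_le hΛ hx
  nlinarith [norm_nonneg x]

/-- The ratio is at most `(1 + ‖x‖^k)^(k+1) ≤ exp ((k+1) ‖x‖^k)`, and `k ‖x‖^k ≤ 1/100`. -/
theorem norm_pow_succ_le (hΛ : 100 ≤ Λ) (hx : ‖x‖ < r) : ‖φ x‖ ^ (k + 1) ≤ 2 * ‖x‖ ^ (k + 1) := by
  have h1 := hφ.norm_le hx
  have h2 := h.mul_pow_le hΛ ⟨norm_nonneg x, hx⟩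
  have hk1 : (1 : ℝ) ≤ k := by exact_mod_cast h.one_le
  have h3 := pow_nonneg (norm_nonneg x) k
  calc ‖φ x‖ ^ (k + 1) ≤ (‖x‖ * (1 + ‖x‖ ^ k)) ^ (k + 1) := by gcongr
    _ = (1 + ‖x‖ ^ k) ^ (k + 1) * ‖x‖ ^ (k + 1) := by rw [mul_pow]; ring
    _ ≤ 2 * ‖x‖ ^ (k + 1) := by
      gcongr
      calc (1 + ‖x‖ ^ k) ^ (k + 1) ≤ Real.exp (‖x‖ ^ k) ^ (k + 1) := by
            gcongr
            linarith [Real.add_one_le_exp (‖x‖ ^ k)]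
        _ = Real.exp ((k + 1) * ‖x‖ ^ k) := by rw [← Real.exp_nat_mul]; push_cast; rfl
        _ ≤ Real.exp (Real.log 2) := by
            gcongr
            have := Real.log_two_gt_d9
            nlinarith
        _ = 2 := Real.exp_log (by norm_num)

/-- If `φ x` is away from the branch cut, the branch cut is not crossed from `x` to `φ x`. -/
theorem abs_arg_add_arg_lt (hΛ : 200 ≤ Λ) (hx : x ∈ sector k r) (hy : φ x ∈ sector k r)
    (hgood : -50 ≤ (sectorTime k β (φ x)).re ∨ 4 + |β| * Real.pi < |(sectorTime k β (φ x)).im|) :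
    |arg x + arg (φ x)| < Real.pi := by
  have hx0 := norm_pos_iff.2 hx.1
  set y := φ x with hyd
  have hy0 := norm_pos_iff.2 hy.1
  have hk1 : (1 : ℝ) ≤ k := by exact_mod_cast h.one_le
  set η : ℂ := conj x / y - 1 with hη
  have hcx : conj x = y * (1 + η) := by
    rw [hη]; have := hy.1; field_simp; ring
  have hle := hφ.le_norm' h (by linarith) hx.2.1
  have hηn : ‖η‖ ≤ 102 / 100 * ‖x‖ ^ k := by
    have : η = (conj x - y) / y := by rw [hη]; have := hy.1; field_simp
    rw [this, norm_div, norm_sub_rev, div_le_iff₀ hy0]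
    have h1 := hφ.close x hx.2.1
    rw [pow_succ] at h1
    have := pow_nonneg (norm_nonneg x) k
    nlinarith
  have hpow := h.pow_le (by linarith) hx.2.1
  have hη2 : ‖η‖ ≤ 1 / 2 := by linarith
  have hπ := Real.pi_gt_three
  by_cases hc : |arg y| + 3 / 2 * ‖η‖ < Real.pi
  · have h1 := arg_mul_one_add hy.1 hη2 hc
    rw [← hcx, arg_conj, if_neg (slitPlane_arg_ne_pi (mem_slitPlane_of_mem_sector h.one_le hx))] at h1
    have h2 := abs_arg_one_add_le hη2
    rw [show arg x + arg y = -arg (1 + η) by linarith, abs_neg]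
    linarith
  · exfalso
    rw [not_lt] at hc
    have hyk := hy.2.2
    -- For `k ≥ 2` the sector lies in `|arg| < π/2`, far from the cut. For `k = 1` a point `y` near
    -- the cut has principal part close to the negative axis and of size at least 200, so its
    -- coordinate has real part below `-50` and imaginary part at most `2 + |β| π`.
    obtain hk2 | hk2 : k = 1 ∨ 2 ≤ k := by have := h.one_le; omega
    · subst hk2
      simp only [pow_one, Nat.cast_one, div_one] at *
      have hpos : 0 < 1 / ‖y‖ := by positivity
      have hL := (hΛ.trans h.le_one_div).trans (h.le_principal hy)
      have hre := h.principal_re hy.1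
      have him := h.principal_im hy.1
      simp only [pow_one, Nat.cast_one, one_mul] at hL hre him
      have hcos : Real.cos (arg y) ≤ -(1 / 2) := by
        rw [← Real.cos_abs]
        have h2 : Real.cos |arg y| ≤ Real.cos (2 * Real.pi / 3) :=
          Real.cos_le_cos_of_nonneg_of_le_pi (by positivity) hyk.le (by linarith)
        have h4 : Real.cos (2 * Real.pi / 3) = -(1 / 2) := by
          rw [show 2 * Real.pi / 3 = Real.pi - Real.pi / 3 by ring, Real.cos_pi_sub,
            Real.cos_pi_div_three]
        linarith
      have hsin : |Real.sin (arg y)| ≤ 3 / 2 * ‖η‖ := by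
        rw [Real.abs_sin_eq_sin_abs_of_abs_le_pi hyk.le, ← Real.sin_pi_sub]
        refine (Real.sin_le (by linarith)).trans (by linarith)
      rcases hgood with hg | hg
      · have h5 := (abs_re_le_norm _).trans (h.norm_time_sub_le hy)
        simp only [sub_re, pow_one, Nat.cast_one, one_mul] at h5
        rw [hre] at h5
        have h6 := (abs_le.1 h5).2
        nlinarith
      · have h5 := abs_im_time_sub_le 1 β y
        simp only [pow_one, Nat.cast_one, one_mul] at h5
        have h6 := abs_sub_abs_le_abs_sub (sectorTime 1 β y).im (1 / y).im
        have h7 : |(1 / y).im| ≤ 2 := by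
          rw [him, abs_neg, abs_mul, abs_of_pos hpos, one_div_mul_eq_div, div_le_iff₀ hy0]
          nlinarith
        linarith
    · have hk2' : (2 : ℝ) ≤ k := by exact_mod_cast hk2
      have : Real.pi / k ≤ Real.pi / 2 := by gcongr
      linarith

theorem estimate_of_good (hΛ : 200 ≤ Λ) (hx : x ∈ sector k r) (hy : φ x ∈ sector k r)
    (hgood : -50 ≤ (sectorTime k β (φ x)).re ∨ 4 + |β| * Real.pi < |(sectorTime k β (φ x)).im|) :
    ‖sectorTime k β (φ x) - conj (sectorTime k β x) - σ / 2‖ ≤ C * ‖x‖ ^ (k + 1) :=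
  hφ.estimate x hx hy (hφ.abs_arg_add_arg_lt h hΛ hx hy hgood)

/-- In the deep region `|k arg x| ≤ 3π/4`, which leaves an angle `π/(4k)` before the edge of the
sector. The map turns `conj x` by at most `3/2 ‖x‖^k`, which is smaller because `k ‖x‖^k ≤ 1/100`.
-/
theorem estimate_of_mem_deep (hΛ : 200 ≤ Λ) (hx : x ∈ deep k β r) : φ x ∈ sector k r ∧
    ‖sectorTime k β (φ x) - conj (sectorTime k β x) - σ / 2‖ ≤ C * ‖x‖ ^ (k + 1) := by
  have hx4 := h.norm_lt_of_mem_deep hx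
  have hx0 := norm_pos_iff.2 hx.1.1
  have hk1 : (1 : ℝ) ≤ k := by exact_mod_cast h.one_le
  have hre : 0 ≤ (sectorTime k β x).re := (h.depth_pos.trans hx.2).le
  have harg := h.abs_mul_arg_le hx.1 hre
  rw [abs_mul, Nat.abs_cast] at harg
  set η : ℂ := φ x / conj x - 1 with hη
  have hcx0 : conj x ≠ 0 := by simpa using hx.1.1
  have hφx : φ x = conj x * (1 + η) := by rw [hη]; field_simp; ring
  have hηn : ‖η‖ ≤ ‖x‖ ^ k := by
    have : η = (φ x - conj x) / conj x := by rw [hη]; field_simp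
    rw [this, norm_div, norm_conj, div_le_iff₀ hx0, ← pow_succ]
    exact hφ.close x hx.1.2.1
  have hkx := h.mul_pow_le (by linarith) ⟨norm_nonneg x, hx.1.2.1⟩
  have hpow := h.pow_le (by linarith) hx.1.2.1
  have hπ := Real.pi_gt_three
  have hargc : arg (conj x) = -arg x := by
    rw [arg_conj, if_neg (slitPlane_arg_ne_pi (mem_slitPlane_of_mem_sector h.one_le hx.1))]
  have hargs : |arg x| + 3 / 2 * ‖η‖ < Real.pi / k := by
    rw [lt_div_iff₀ h.cast_pos]
    nlinarith
  have hadd := arg_mul_one_add (η := η) hcx0 (by linarith)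
    (by rw [hargc, abs_neg]; exact hargs.trans_le (pi_div_le h.one_le))
  have hα := abs_arg_one_add_le (η := η) (by linarith)
  rw [← hφx, hargc] at hadd
  have hsec : φ x ∈ sector k r := by
    have h1 := hφ.norm_le' h (by linarith) hx.1.2.1
    have h2 := hφ.le_norm' h (by linarith) hx.1.2.1
    refine ⟨norm_pos_iff.1 (by linarith), by linarith [h.pos], ?_⟩
    rw [hadd]
    refine (abs_add_le _ _).trans_lt ?_
    rw [abs_neg]
    linarith
  refine ⟨hsec, hφ.estimate x hx.1 hsec ?_⟩
  rw [hadd, add_neg_cancel_left]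
  linarith

theorem near_of_mem_deep (hΛ : 200 ≤ Λ) (hC : 0 ≤ C) (hCΛ : 1000 * C ≤ Λ) (hx : x ∈ deep k β r) :
    φ x ∈ sector k r ∧
    ‖sectorTime k β (φ x) - conj (sectorTime k β x) - σ / 2‖ ≤ 1 / 1000 := by
  obtain ⟨h1, h2⟩ := hφ.estimate_of_mem_deep h hΛ hx
  refine ⟨h1, h2.trans ?_⟩
  have h3 := h.pow_succ_le (by linarith) hx.1.2.1
  have := pow_nonneg (norm_nonneg x) (k + 1)
  nlinarith

theorem re_near_of_mem_deep (hΛ : 200 ≤ Λ) (hC : 0 ≤ C) (hCΛ : 1000 * C ≤ Λ) (hx : x ∈ deep k β r) :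
    |(sectorTime k β (φ x)).re - (sectorTime k β x).re - σ / 2| ≤ 1 / 1000 := by
  have h2 := (abs_re_le_norm _).trans (hφ.near_of_mem_deep h hΛ hC hCΛ hx).2
  simpa using h2

theorem mem_deep (hσ : σ = 1) (hΛ : 200 ≤ Λ) (hC : 0 ≤ C) (hCΛ : 1000 * C ≤ Λ)
    (hx : x ∈ deep k β r) : φ x ∈ deep k β r := by
  have h1 := abs_le.1 (hφ.re_near_of_mem_deep h hΛ hC hCΛ hx)
  refine ⟨(hφ.near_of_mem_deep h hΛ hC hCΛ hx).1, ?_⟩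
  have := hx.2
  linarith [h1.1]

end IsHalfShift

end AntiParabolic

/-! ### The basin of a pair of half shifts -/

namespace AntiParabolic

open Complex Set Filter

/-- Two half shifts, injective on the disc of radius `r`, together with a bounded potential `Ψ`
controlling the errors along the orbits; the coordinate is large compared with all constants. -/
structure ParabolicPair (k : ℕ) (β C Λ r : ℝ) (φ₁ φ₂ : ℂ → ℂ) : Prop where
  small : SmallRadius k β Λ r
  nonneg : 0 ≤ C
  fst : IsHalfShift k β C r 1 φ₁
  snd : IsHalfShift k β C r 1 φ₂
  injOn_fst : InjOn φ₁ (Metric.ball 0 r)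
  injOn_snd : InjOn φ₂ (Metric.ball 0 r)
  potential : ∃ (Ψ : ℝ → ℝ) (B : ℝ), (∀ t, 0 ≤ Ψ t ∧ Ψ t ≤ B) ∧
    (∀ t t', t + 1 / 2 ≤ t' → 3 * C * (2 ^ (1 + 1 / (k : ℝ)) * (1 + |t|) ^ (-(1 + 1 / (k : ℝ))))
      ≤ Ψ t' - Ψ t) ∧
    200 + 1000 * C + 10 * (|β| * Real.pi) + 2 * B ≤ Λ

/-- One step of `φ₂ ∘ φ₁` inside the sector. -/
def SectorStep (k : ℕ) (r : ℝ) (φ₁ φ₂ : ℂ → ℂ) (x x' : ℂ) : Prop :=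
  x ∈ sector k r ∧ φ₁ x ∈ sector k r ∧ x' ∈ sector k r ∧ x' = φ₂ (φ₁ x)

/-- The points whose orbit reaches the deep region. -/
def basin (k : ℕ) (β r : ℝ) (φ₁ φ₂ : ℂ → ℂ) : Set ℂ :=
  {x | ∃ w ∈ deep k β r, Relation.ReflTransGen (SectorStep k r φ₁ φ₂) x w}

/-- Backward induction along orbits: what holds far to the right spreads to the basin through the
functional equation. -/
theorem basin_induction {k : ℕ} {β r : ℝ} {φ₁ φ₂ : ℂ → ℂ} {p : ℂ → Prop}
    (h0 : ∀ x ∈ deep k β r, p x)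
    (h1 : ∀ x x', SectorStep k r φ₁ φ₂ x x' → x' ∈ basin k β r φ₁ φ₂ → p x' → p x)
    {x : ℂ} (hx : x ∈ basin k β r φ₁ φ₂) : p x := by
  obtain ⟨w, hw, hxw⟩ := hx
  induction hxw using Relation.ReflTransGen.head_induction_on with
  | refl => exact h0 w hw
  | head hab hbc ih => exact h1 _ _ hab ⟨w, hw, hbc⟩ ih

theorem mem_basin_of_step {k : ℕ} {β r : ℝ} {φ₁ φ₂ : ℂ → ℂ} {x x' : ℂ}
    (h : SectorStep k r φ₁ φ₂ x x') (h' : x' ∈ basin k β r φ₁ φ₂) : x ∈ basin k β r φ₁ φ₂ := by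
  obtain ⟨w, hw, hxw⟩ := h'
  exact ⟨w, hw, hxw.head h⟩

theorem deep_subset_basin {k : ℕ} {β r : ℝ} {φ₁ φ₂ : ℂ → ℂ} :
    deep k β r ⊆ basin k β r φ₁ φ₂ := fun x hx => ⟨x, hx, .refl⟩

theorem basin_subset_sector {k : ℕ} {β r : ℝ} {φ₁ φ₂ : ℂ → ℂ} :
    basin k β r φ₁ φ₂ ⊆ sector k r := fun _ hx =>
  basin_induction (p := fun x => x ∈ sector k r) (fun _ hx => hx.1) (fun _ _ h _ _ => h.1) hx

theorem exists_iterate_mem_deep {k : ℕ} {β r : ℝ} {φ₁ φ₂ : ℂ → ℂ} {x : ℂ}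
    (hx : x ∈ basin k β r φ₁ φ₂) :
    ∃ n, (fun z => φ₂ (φ₁ z))^[n] x ∈ deep k β r := by
  refine basin_induction (p := fun x => ∃ n, (fun z => φ₂ (φ₁ z))^[n] x ∈ deep k β r) ?_ ?_ hx
  · exact fun x hx => ⟨0, hx⟩
  · rintro x _ ⟨-, -, -, rfl⟩ - ⟨n, hn⟩
    exact ⟨n + 1, hn⟩

theorem IsHalfShift.differentiableAt_conj {k : ℕ} {β C r σ : ℝ} {φ : ℂ → ℂ}
    (h : IsHalfShift k β C r σ φ) {x : ℂ} (hx : ‖x‖ < r) :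
    DifferentiableAt ℂ (fun z => φ (conj z)) (conj x) :=
  h.differentiableOn.differentiableAt (Metric.isOpen_ball.mem_nhds (by simpa using hx))

theorem IsHalfShift.continuousAt {k : ℕ} {β C r σ : ℝ} {φ : ℂ → ℂ}
    (h : IsHalfShift k β C r σ φ) {x : ℂ} (hx : ‖x‖ < r) : ContinuousAt φ x := by
  have h1 := (h.differentiableAt_conj hx).continuousAt
  have h2 : ContinuousAt (fun z => φ (conj (conj z))) x :=
    ContinuousAt.comp (f := fun z => conj z) (g := fun z => φ (conj z)) h1
      continuous_conj.continuousAt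
  simpa using h2

theorem IsHalfShift.differentiableAt_comp {k : ℕ} {β C r σ τ : ℝ} {φ₁ φ₂ : ℂ → ℂ}
    (h₁ : IsHalfShift k β C r σ φ₁) (h₂ : IsHalfShift k β C r τ φ₂) {x : ℂ} (hx : ‖x‖ < r)
    (hy : ‖φ₁ x‖ < r) : DifferentiableAt ℂ (fun z => φ₂ (φ₁ z)) x := by
  have a : DifferentiableAt ℂ (fun z => conj (φ₁ z)) x := by
    have := (h₁.differentiableAt_conj hx).star_star
    simpa [Function.comp_def] using this
  have b := h₂.differentiableAt_conj hy
  have := DifferentiableAt.comp (f := fun z => conj (φ₁ z)) (g := fun z => φ₂ (conj z)) x b a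
  simpa [Function.comp_def] using this

namespace ParabolicPair

variable {k : ℕ} {β C Λ r : ℝ} {φ₁ φ₂ : ℂ → ℂ} (h : ParabolicPair k β C Λ r φ₁ φ₂)

include h

theorem symm : ParabolicPair k β C Λ r φ₂ φ₁ :=
  ⟨h.small, h.nonneg, h.snd, h.fst, h.injOn_snd, h.injOn_fst, h.potential⟩

theorem bounds : 200 ≤ Λ ∧ 1000 * C ≤ Λ := by
  obtain ⟨Ψ, B, hΨ, -, hΛ⟩ := h.potential
  have := h.nonneg
  have := hΨ 0
  have : 0 ≤ |β| * Real.pi := by positivity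
  constructor <;> linarith

/-- The increment of the coordinate along a step ending away from the branch cut. -/
theorem norm_step_sub_le {x x' : ℂ} (hs : SectorStep k r φ₁ φ₂ x x')
    (hgood : 0 ≤ (sectorTime k β x').re ∨ 5 + |β| * Real.pi < |(sectorTime k β x').im|) :
    ‖sectorTime k β x' - sectorTime k β x - 1‖ ≤ 3 * C * ‖x‖ ^ (k + 1) := by
  obtain ⟨hx, hy, hx', he⟩ := hs
  obtain ⟨hΛ, hCΛ⟩ := h.bounds
  have hC := h.nonneg
  rw [he] at hgood hx' ⊢
  set y := φ₁ x
  have e2 := h.snd.estimate_of_good h.small hΛ hy hx' (hgood.imp (by intro; linarith) (by intro; linarith))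
  have hy1 := h.fst.norm_pow_succ_le h.small (by linarith) hx.2.1
  have hsm := h.small.pow_succ_le (by linarith) hx.2.1
  have hxk := pow_nonneg (norm_nonneg x) (k + 1)
  have e2' : ‖sectorTime k β (φ₂ y) - conj (sectorTime k β y) - (1 : ℝ) / 2‖
      ≤ 2 * C * ‖x‖ ^ (k + 1) := by
    refine e2.trans ?_
    nlinarith
  have e3 : 2 * C * ‖x‖ ^ (k + 1) ≤ 1 / 100 := by nlinarith
  -- The second half step changes the real part by about 1/2 and the absolute imaginary part by at
  -- most 1/100. So the position away from the cut passes back to the intermediate point with weaker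
  -- thresholds, and the first half step can be estimated too.
  have ygood : -50 ≤ (sectorTime k β y).re ∨ 4 + |β| * Real.pi < |(sectorTime k β y).im| := by
    have hre := abs_le.1 ((abs_re_le_norm _).trans (e2'.trans e3))
    have him := (abs_im_le_norm _).trans (e2'.trans e3)
    simp only [sub_re, conj_re, sub_im, conj_im, div_ofNat_re, div_ofNat_im, ofReal_re, ofReal_im,
      sub_neg_eq_add, zero_div, sub_zero] at hre him
    rcases hgood with hg | hg
    · left; linarith [hre.2]
    · right
      have := abs_sub_abs_le_abs_sub (sectorTime k β (φ₂ y)).im (-(sectorTime k β y).im)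
      rw [abs_neg, sub_neg_eq_add] at this
      linarith
  have e1 := h.fst.estimate_of_good h.small hΛ hx hy ygood
  have hsum : sectorTime k β (φ₂ y) - sectorTime k β x - 1
      = (sectorTime k β (φ₂ y) - conj (sectorTime k β y) - (1 : ℝ) / 2)
        + conj (sectorTime k β y - conj (sectorTime k β x) - (1 : ℝ) / 2) := by
    have c2 : conj (2 : ℂ) = 2 := map_ofNat _ 2
    simp only [map_sub, map_div₀, conj_conj, ofReal_one, map_one, c2]
    ring
  rw [hsum]
  refine (norm_add_le _ _).trans ?_
  rw [norm_conj]
  linarith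

theorem re_step_ge {x x' : ℂ} (hs : SectorStep k r φ₁ φ₂ x x')
    (hgood : 0 ≤ (sectorTime k β x').re ∨ 5 + |β| * Real.pi < |(sectorTime k β x').im|) :
    |(sectorTime k β x').re - (sectorTime k β x).re - 1| ≤ 1 / 100 := by
  have h1 := (abs_re_le_norm _).trans (h.norm_step_sub_le hs hgood)
  obtain ⟨hΛ, hCΛ⟩ := h.bounds
  have hsm := h.small.pow_succ_le (by linarith) hs.1.2.1
  have hxk := pow_nonneg (norm_nonneg x) (k + 1)
  simp only [sub_re, one_re] at h1
  refine h1.trans ?_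
  nlinarith

/-- Points of the basin stay away from the branch cut. -/
theorem core_of_mem_basin {x : ℂ} (hx : x ∈ basin k β r φ₁ φ₂) :
    0 ≤ (sectorTime k β x).re ∨ 5 + |β| * Real.pi < |(sectorTime k β x).im| := by
  obtain ⟨Ψ, B, hΨ, hinc, hΛB⟩ := h.potential
  obtain ⟨hΛ, hCΛ⟩ := h.bounds
  have hC := h.nonneg
  have hβ : 0 ≤ |β| * Real.pi := by positivity
  -- The invariant is strengthened by the potential: a backward step lowers `Ψ` by at least the
  -- possible loss of imaginary part, so the margin survives any number of steps.
  suffices 0 ≤ (sectorTime k β x).re ∨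
      5 + |β| * Real.pi + Ψ (sectorTime k β x).re < |(sectorTime k β x).im| from
    this.imp_right fun h5 => by linarith [(hΨ (sectorTime k β x).re).1]
  refine basin_induction (p := fun x => 0 ≤ (sectorTime k β x).re ∨
      5 + |β| * Real.pi + Ψ (sectorTime k β x).re < |(sectorTime k β x).im|) ?_ ?_ hx
  · intro x hx
    exact Or.inl (h.small.depth_pos.trans hx.2).le
  · intro x x' hs _ ih
    by_cases hre : 0 ≤ (sectorTime k β x).re
    · exact Or.inl hre
    right
    have hgood : 0 ≤ (sectorTime k β x').re ∨ 5 + |β| * Real.pi < |(sectorTime k β x').im| :=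
      ih.imp_right fun h5 => by linarith [(hΨ (sectorTime k β x').re).1]
    have hst := h.norm_step_sub_le hs hgood
    have hstre := abs_le.1 (h.re_step_ge hs hgood)
    have hpot := hinc (sectorTime k β x).re (sectorTime k β x').re (by linarith [hstre.1])
    have hrp := h.small.pow_succ_le_rpow (by linarith) hs.1
    have him := (abs_im_le_norm _).trans hst
    simp only [sub_im, one_im, sub_zero] at him
    have h3 : 3 * C * ‖x‖ ^ (k + 1) ≤ Ψ (sectorTime k β x').re - Ψ (sectorTime k β x).re :=
      le_trans (mul_le_mul_of_nonneg_left hrp (by positivity)) hpot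
    have h4 := abs_sub_abs_le_abs_sub (sectorTime k β x').im (sectorTime k β x).im
    rcases ih with ih | ih
    -- Entry into the left half-plane: the real part of `x'` lies between 0 and 1.01 while its
    -- coordinate has norm at least `0.99 Λ`, so its imaginary part is huge. The term `2 B` in the
    -- bound on `Λ` pays for the potential.
    · have h5 := h.small.le_norm_time hs.2.2.1
      have h6 := h.small.le_one_div.trans (h.small.le_principal hs.2.2.1)
      have h7 := norm_le_abs_re_add_abs_im (sectorTime k β x')
      rw [abs_of_nonneg ih] at h7
      have h8 := (hΨ (sectorTime k β x').re).2
      linarith [hstre.2]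
    · linarith

theorem injOn_time_basin : InjOn (sectorTime k β) (basin k β r φ₁ φ₂) := by
  intro x hx y hy hxy
  refine h.small.time_inj (basin_subset_sector hx) (basin_subset_sector hy) hxy ?_
  exact (h.core_of_mem_basin hx).imp_right fun h5 => by linarith

theorem step_of_mem_deep {x : ℂ} (hx : x ∈ deep k β r) : φ₁ x ∈ deep k β r ∧
    φ₂ (φ₁ x) ∈ deep k β r ∧ SectorStep k r φ₁ φ₂ x (φ₂ (φ₁ x)) := by
  obtain ⟨hΛ, hCΛ⟩ := h.bounds
  have h1 := h.fst.mem_deep h.small rfl hΛ h.nonneg hCΛ hx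
  have h2 := h.snd.mem_deep h.small rfl hΛ h.nonneg hCΛ h1
  exact ⟨h1, h2, hx.1, h1.1, h2.1, rfl⟩

/-- The intermediate points of an orbit of `φ₂ ∘ φ₁` form an orbit of `φ₁ ∘ φ₂`, and all of them are
required to stay in the sector. -/
theorem maps_basin {x : ℂ} (hx : x ∈ basin k β r φ₁ φ₂) : φ₁ x ∈ basin k β r φ₂ φ₁ := by
  refine basin_induction (p := fun x => φ₁ x ∈ basin k β r φ₂ φ₁) ?_ ?_ hx
  · intro x hx
    exact deep_subset_basin (h.step_of_mem_deep hx).1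
  · rintro x _ ⟨h1, h2, h3, rfl⟩ _ ih
    exact mem_basin_of_step ⟨h2, h3, basin_subset_sector ih, rfl⟩ ih

theorem maps_basin_self {x : ℂ} (hx : x ∈ basin k β r φ₁ φ₂) : φ₂ (φ₁ x) ∈ basin k β r φ₁ φ₂ :=
  h.symm.maps_basin (h.maps_basin hx)

theorem differentiableAt_of_step {x x' : ℂ} (hs : SectorStep k r φ₁ φ₂ x x') :
    DifferentiableAt ℂ (fun z => φ₂ (φ₁ z)) x :=
  h.fst.differentiableAt_comp h.snd hs.1.2.1 hs.2.1.2.1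

theorem isOpen_basin : IsOpen (basin k β r φ₁ φ₂) := by
  rw [isOpen_iff_mem_nhds]
  intro x hx
  refine basin_induction (p := fun x => basin k β r φ₁ φ₂ ∈ 𝓝 x) ?_ ?_ hx
  · intro x hx
    exact mem_of_superset (h.small.isOpen_deep.mem_nhds hx) deep_subset_basin
  · rintro x x' hs _ ih
    have hso := isOpen_sector h.small.one_le r
    have c1 := h.fst.continuousAt hs.1.2.1
    have c2 := (h.differentiableAt_of_step hs).continuousAt
    rw [hs.2.2.2] at ih
    filter_upwards [hso.mem_nhds hs.1, c1 (hso.mem_nhds hs.2.1), c2 ih] with y h1 h2 h3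
    exact mem_basin_of_step ⟨h1, h2, basin_subset_sector h3, rfl⟩ h3

theorem iterate_mem_basin {x : ℂ} (hx : x ∈ basin k β r φ₁ φ₂) (n : ℕ) :
    (fun z => φ₂ (φ₁ z))^[n] x ∈ basin k β r φ₁ φ₂ := by
  induction n with
  | zero => exact hx
  | succ n ih =>
    rw [Function.iterate_succ_apply']
    exact h.maps_basin_self ih

theorem iterate_mem_deep {x : ℂ} (hx : x ∈ deep k β r) (n : ℕ) :
    (fun z => φ₂ (φ₁ z))^[n] x ∈ deep k β r ∧
    (sectorTime k β x).re + n / 2 ≤ (sectorTime k β ((fun z => φ₂ (φ₁ z))^[n] x)).re := by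
  induction n with
  | zero => exact ⟨hx, by simp⟩
  | succ n ih =>
    rw [Function.iterate_succ_apply']
    obtain ⟨-, h2, h3⟩ := h.step_of_mem_deep ih.1
    refine ⟨h2, ?_⟩
    have := abs_le.1 (h.re_step_ge h3 (Or.inl (h.small.depth_pos.trans h2.2).le))
    push_cast
    linarith [ih.2, this.1]

theorem injOn_iterate (n : ℕ) : InjOn (fun z => φ₂ (φ₁ z))^[n] (basin k β r φ₁ φ₂) := by
  induction n with
  | zero => exact injOn_id _
  | succ n ih =>
    intro x hx y hy hxy
    rw [Function.iterate_succ_apply, Function.iterate_succ_apply] at hxy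
    have h1 := ih (h.maps_basin_self hx) (h.maps_basin_self hy) hxy
    have hb : ∀ {z}, z ∈ sector k r → z ∈ Metric.ball (0 : ℂ) r := fun hz => by simpa using hz.2.1
    have h2 := h.injOn_snd (hb (basin_subset_sector (h.maps_basin hx)))
      (hb (basin_subset_sector (h.maps_basin hy))) h1
    exact h.injOn_fst (hb (basin_subset_sector hx)) (hb (basin_subset_sector hy)) h2

end ParabolicPair

end AntiParabolic

/-! ### Construction and uniqueness of the Fatou coordinate -/

namespace AntiParabolic

open Complex Set Filter

/-- The Fatou coordinate, normalized by `Φ x = sectorTime x + O(1)` along orbits. -/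
noncomputable def fatou (k : ℕ) (β : ℝ) (φ₁ φ₂ : ℂ → ℂ) (x : ℂ) : ℂ :=
  limUnder atTop fun n : ℕ => sectorTime k β ((fun z => φ₂ (φ₁ z))^[n] x) - n

namespace ParabolicPair

variable {k : ℕ} {β C Λ r : ℝ} {φ₁ φ₂ : ℂ → ℂ} (h : ParabolicPair k β C Λ r φ₁ φ₂)

include h

/-- The Weierstrass test applied to the telescoping sum of the errors. After `n` steps the real part
has grown by at least `n / 2`, and this spacing is the one for which the potential bounds the sum of
the majorants. -/
theorem fatou_deep : ∃ B : ℝ, 0 ≤ B ∧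
    TendstoUniformlyOn (fun (n : ℕ) x => sectorTime k β ((fun z => φ₂ (φ₁ z))^[n] x) - n)
      (fatou k β φ₁ φ₂) atTop (deep k β r) ∧
    ∀ x ∈ deep k β r, ‖fatou k β φ₁ φ₂ x - sectorTime k β x‖ ≤ B := by
  obtain ⟨Ψ, B, hΨ, hinc, hΛB⟩ := h.potential
  obtain ⟨hΛ, hCΛ⟩ := h.bounds
  have hC := h.nonneg
  set g : ℂ → ℂ := fun z => φ₂ (φ₁ z) with hg
  set a : ℝ := 1 + 1 / (k : ℝ) with ha
  set u : ℕ → ℝ := fun n => 3 * C * (2 ^ a * (1 + |(n : ℝ) / 2|) ^ (-a)) with hu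
  have ha0 : 0 ≤ a := by positivity
  have hu0 : ∀ n, 0 ≤ u n := fun n => by positivity
  have husum : ∀ n, ∑ i ∈ Finset.range n, u i ≤ B := by
    intro n
    have h1 : ∑ i ∈ Finset.range n, u i
        ≤ ∑ i ∈ Finset.range n, (Ψ (((i + 1 : ℕ) : ℝ) / 2) - Ψ ((i : ℝ) / 2)) := by
      refine Finset.sum_le_sum fun i _ => hinc _ _ ?_
      push_cast; linarith
    rw [Finset.sum_range_sub (fun i : ℕ => Ψ ((i : ℝ) / 2))] at h1
    linarith [(hΨ ((n : ℝ) / 2)).2, (hΨ (((0 : ℕ) : ℝ) / 2)).1]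
  have hus : Summable u := summable_of_sum_range_le hu0 husum
  set f : ℕ → ℂ → ℂ := fun n x => sectorTime k β (g^[n + 1] x) - sectorTime k β (g^[n] x) - 1 with hf
  have hfu : ∀ n, ∀ x ∈ deep k β r, ‖f n x‖ ≤ u n := by
    intro n x hx
    obtain ⟨h1, h2⟩ := h.iterate_mem_deep hx n
    obtain ⟨-, h3, h4⟩ := h.step_of_mem_deep h1
    have h5 := h.norm_step_sub_le h4 (Or.inl (h.small.depth_pos.trans h3.2).le)
    have h6 := h.small.pow_succ_le_rpow (by linarith) h1.1
    simp only [hf, Function.iterate_succ_apply']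
    refine h5.trans ?_
    refine mul_le_mul_of_nonneg_left (h6.trans ?_) (by positivity)
    refine mul_le_mul_of_nonneg_left ?_ (by positivity)
    refine Real.rpow_le_rpow_of_nonpos (by positivity) ?_ (by linarith)
    have h7 := h.small.depth_pos.trans hx.2
    have h8 : (0 : ℝ) ≤ n / 2 := by positivity
    rw [abs_of_nonneg h8, abs_of_nonneg (by linarith)]
    linarith
  have htel : ∀ n x, sectorTime k β (g^[n] x) - n
      = (∑ i ∈ Finset.range n, f i x) + sectorTime k β x := by
    intro n x
    induction n with
    | zero => simp
    | succ n ih =>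
      rw [Finset.sum_range_succ]
      push_cast
      linear_combination ih + (hf ▸ rfl : f n x = sectorTime k β (g^[n + 1] x) - sectorTime k β (g^[n] x) - 1).symm
  have hunif := tendstoUniformlyOn_tsum_nat hus hfu
  have hunif2 : TendstoUniformlyOn (fun (n : ℕ) x => sectorTime k β (g^[n] x) - n)
      (fun x => (∑' n, f n x) + sectorTime k β x) atTop (deep k β r) := by
    rw [Metric.tendstoUniformlyOn_iff] at hunif ⊢
    intro ε hε
    filter_upwards [hunif ε hε] with n hn x hx
    rw [htel n x, dist_add_right]
    exact hn x hx
  have heq : ∀ x ∈ deep k β r, fatou k β φ₁ φ₂ x = (∑' n, f n x) + sectorTime k β x :=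
    fun x hx => (hunif2.tendsto_at hx).limUnder_eq
  refine ⟨B, (hΨ 0).1.trans (hΨ 0).2, hunif2.congr_right fun x hx => (heq x hx).symm, ?_⟩
  intro x hx
  rw [heq x hx, add_sub_cancel_right]
  refine le_of_tendsto (hunif.tendsto_at hx).norm (Eventually.of_forall fun n => ?_)
  exact (norm_sum_le _ _).trans ((Finset.sum_le_sum fun i _ => hfu i x hx).trans (husum n))

theorem tendsto_fatou {x : ℂ} (hx : x ∈ basin k β r φ₁ φ₂) :
    Tendsto (fun n : ℕ => sectorTime k β ((fun z => φ₂ (φ₁ z))^[n] x) - n) atTop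
      (𝓝 (fatou k β φ₁ φ₂ x)) := by
  suffices ∃ L, Tendsto (fun n : ℕ => sectorTime k β ((fun z => φ₂ (φ₁ z))^[n] x) - n) atTop
      (𝓝 L) from tendsto_nhds_limUnder this
  refine basin_induction (p := fun x => ∃ L, Tendsto (fun n : ℕ =>
    sectorTime k β ((fun z => φ₂ (φ₁ z))^[n] x) - n) atTop (𝓝 L)) ?_ ?_ hx
  · intro x hx
    obtain ⟨B, -, h1, -⟩ := h.fatou_deep
    exact ⟨_, h1.tendsto_at hx⟩
  · rintro x _ ⟨-, -, -, rfl⟩ - ⟨L, hL⟩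
    refine ⟨L - 1, (tendsto_add_atTop_iff_nat 1).1 ((hL.sub_const 1).congr fun n => ?_)⟩
    rw [Function.iterate_succ_apply]
    push_cast; ring

theorem fatou_step {x : ℂ} (hx : x ∈ basin k β r φ₁ φ₂) :
    fatou k β φ₁ φ₂ (φ₂ (φ₁ x)) = fatou k β φ₁ φ₂ x + 1 := by
  have h1 := h.tendsto_fatou (h.maps_basin_self hx)
  have h2 := ((tendsto_add_atTop_iff_nat 1).2 (h.tendsto_fatou hx)).add_const 1
  refine tendsto_nhds_unique h1 (h2.congr fun n => ?_)
  rw [Function.iterate_succ_apply]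
  push_cast; ring

theorem fatou_iterate {x : ℂ} (hx : x ∈ basin k β r φ₁ φ₂) (n : ℕ) :
    fatou k β φ₁ φ₂ ((fun z => φ₂ (φ₁ z))^[n] x) = fatou k β φ₁ φ₂ x + n := by
  induction n with
  | zero => simp
  | succ n ih =>
    rw [Function.iterate_succ_apply', h.fatou_step (h.iterate_mem_basin hx n), ih]
    push_cast; ring

theorem differentiableOn_iterate_deep (n : ℕ) :
    DifferentiableOn ℂ (fun z => φ₂ (φ₁ z))^[n] (deep k β r) := by
  induction n with
  | zero => exact differentiableOn_id
  | succ n ih =>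
    rw [Function.iterate_succ']
    intro x hx
    have h1 := h.step_of_mem_deep (h.iterate_mem_deep hx n).1
    exact (h.differentiableAt_of_step h1.2.2).comp_differentiableWithinAt x (ih x hx)

/-- Uniform limits of holomorphic maps are holomorphic, which settles the deep region. Elsewhere
`fatou x = fatou (φ₂ (φ₁ x)) - 1` holds on a neighbourhood, the basin being open. -/
theorem differentiableOn_fatou :
    DifferentiableOn ℂ (fatou k β φ₁ φ₂) (basin k β r φ₁ φ₂) := by
  intro x hx
  refine DifferentiableAt.differentiableWithinAt ?_
  refine basin_induction (p := fun x => DifferentiableAt ℂ (fatou k β φ₁ φ₂) x) ?_ ?_ hx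
  · intro x hx
    obtain ⟨B, -, h1, -⟩ := h.fatou_deep
    refine (h1.tendstoLocallyUniformlyOn.differentiableOn (Eventually.of_forall fun n => ?_)
      h.small.isOpen_deep).differentiableAt (h.small.isOpen_deep.mem_nhds hx)
    refine (h.small.differentiableOn_time.comp (h.differentiableOn_iterate_deep n) ?_).sub_const _
    exact fun y hy => (h.iterate_mem_deep hy n).1.1
  · rintro x x' hs hx' ih
    have h1 := h.differentiableAt_of_step hs
    rw [hs.2.2.2] at ih
    have hev : fatou k β φ₁ φ₂ =ᶠ[𝓝 x] fun y => fatou k β φ₁ φ₂ (φ₂ (φ₁ y)) - 1 := by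
      filter_upwards [h.isOpen_basin.mem_nhds (mem_basin_of_step hs hx')] with y hy
      rw [h.fatou_step hy]; ring
    refine DifferentiableAt.congr_of_eventuallyEq ?_ hev
    exact (DifferentiableAt.comp (f := fun y => φ₂ (φ₁ y)) x ih h1).sub_const 1

/-- `φ₁` carries the orbit of `x` under `φ₂ ∘ φ₁` to the orbit of `φ₁ x` under `φ₁ ∘ φ₂`. Along it
the error of the half shift tends to 0, so the relation becomes exact in the limit. -/
theorem fatou_conj {x : ℂ} (hx : x ∈ basin k β r φ₁ φ₂) :
    fatou k β φ₂ φ₁ (φ₁ x) = conj (fatou k β φ₁ φ₂ x) + 1 / 2 := by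
  refine basin_induction
    (p := fun x => fatou k β φ₂ φ₁ (φ₁ x) = conj (fatou k β φ₁ φ₂ x) + 1 / 2) ?_ ?_ hx
  · intro x hx
    obtain ⟨hΛ, hCΛ⟩ := h.bounds
    have hC := h.nonneg
    have t1 := h.tendsto_fatou (deep_subset_basin hx)
    have t2 := h.symm.tendsto_fatou (h.maps_basin (deep_subset_basin hx))
    have hsemi : ∀ n : ℕ, (fun z => φ₁ (φ₂ z))^[n] (φ₁ x) = φ₁ ((fun z => φ₂ (φ₁ z))^[n] x) := by
      intro n
      have : Function.Semiconj φ₁ (fun z => φ₂ (φ₁ z)) (fun z => φ₁ (φ₂ z)) := fun z => rfl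
      exact ((this.iterate_right n).eq x).symm
    set a : ℝ := 1 + 1 / (k : ℝ) with ha
    have t3 : Tendsto (fun n : ℕ => sectorTime k β (φ₁ ((fun z => φ₂ (φ₁ z))^[n] x))
        - conj (sectorTime k β ((fun z => φ₂ (φ₁ z))^[n] x)) - (1 : ℝ) / 2) atTop (𝓝 0) := by
      have hb : Tendsto (fun n : ℕ => C * (2 ^ a * ((1 + (n : ℝ) / 2) ^ (-a)))) atTop (𝓝 0) := by
        have c1 : Tendsto (fun n : ℕ => 1 + (n : ℝ) / 2) atTop atTop :=
          tendsto_atTop_add_const_left _ _ (tendsto_natCast_atTop_atTop.atTop_div_const (by norm_num))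
        have c2 := (tendsto_rpow_neg_atTop (y := a) (by positivity)).comp c1
        have c3 := (c2.const_mul (2 ^ a)).const_mul C
        simpa using c3
      refine squeeze_zero_norm (fun n => ?_) hb
      obtain ⟨d1, d2⟩ := h.iterate_mem_deep hx n
      refine (h.fst.estimate_of_mem_deep h.small hΛ d1).2.trans ?_
      refine mul_le_mul_of_nonneg_left ((h.small.pow_succ_le_rpow (by linarith) d1.1).trans ?_) hC
      refine mul_le_mul_of_nonneg_left ?_ (by positivity)
      have h7 := h.small.depth_pos.trans hx.2
      have h8 : (0 : ℝ) ≤ n / 2 := by positivity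
      refine Real.rpow_le_rpow_of_nonpos (by positivity) ?_ (by rw [neg_nonpos]; positivity)
      rw [abs_of_nonneg (by linarith)]
      linarith
    have t4 := (continuous_conj.tendsto _).comp t1
    have t5 := (t4.add t3).add_const (1 / 2 : ℂ)
    rw [add_zero] at t5
    refine tendsto_nhds_unique t2 (t5.congr fun n => ?_)
    rw [hsemi n]
    simp only [Function.comp_apply, map_sub, map_natCast, ofReal_one]
    ring
  · rintro x x' hs hx' ih
    have hx := mem_basin_of_step hs hx'
    have e1 := h.symm.fatou_step (h.maps_basin hx)
    rw [hs.2.2.2, h.fatou_step hx, map_add, map_one] at ih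
    linear_combination ih - e1

/-- The Fatou coordinate read in the coordinate of the sector, on a half-plane: it differs from the
identity by a bounded map with small Lipschitz constant. -/
theorem exists_fatou_chart : ∃ (M K : ℝ) (Q : ℂ → ℂ), 0 ≤ K ∧
    DifferentiableOn ℂ Q {W | M < W.re} ∧
    (∀ W : ℂ, M < W.re → Q W ∈ deep k β r ∧ sectorTime k β (Q W) = W) ∧
    (∀ x ∈ deep k β r, M < (sectorTime k β x).re → Q (sectorTime k β x) = x) ∧
    (∀ W : ℂ, M < W.re → ‖fatou k β φ₁ φ₂ (Q W) - W‖ ≤ K) ∧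
    ∀ V W : ℂ, M < V.re → M < W.re →
      ‖fatou k β φ₁ φ₂ (Q V) - fatou k β φ₁ φ₂ (Q W) - (V - W)‖ ≤ 1 / 2 * ‖V - W‖ := by
  obtain ⟨B, hB, -, hbd⟩ := h.fatou_deep
  obtain ⟨Q, hQd, hQ1, hQ2⟩ := h.small.exists_time_inverse
  set D := 2 * 4 ^ k * (1 / (k * r ^ k)) with hD
  have hle := h.small.two_mul_le_depth
  have hQdeep : ∀ W : ℂ, D < W.re → Q W ∈ deep k β r := by
    intro W hW
    obtain ⟨h1, h2⟩ := hQ1 W (hle.trans_lt hW)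
    exact ⟨h1, by rw [h2]; exact hW⟩
  have hdist : ∀ W : ℂ, D < W.re → ‖fatou k β φ₁ φ₂ (Q W) - W‖ ≤ B := by
    intro W hW
    have := hbd _ (hQdeep W hW)
    rwa [(hQ1 W (hle.trans_lt hW)).2] at this
  -- Moving the half-plane by `2 B + 1` turns the bound `B` on `fatou ∘ Q - id` into the Lipschitz
  -- constant `B / (2 B + 1) ≤ 1/2`, by the Cauchy estimate.
  have hd : (0 : ℝ) < 2 * B + 1 := by linarith
  have hgt : ∀ W : ℂ, D + (2 * B + 1) < W.re → D < W.re := fun W hW => by linarith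
  refine ⟨D + (2 * B + 1), B, Q, hB, hQd.mono fun W hW => hle.trans_lt (hgt W hW), ?_, ?_,
    fun W hW => hdist W (hgt W hW), ?_⟩
  · exact fun W hW => ⟨hQdeep W (hgt W hW), (hQ1 W (hle.trans_lt (hgt W hW))).2⟩
  · exact fun x hx _ => hQ2 x hx.1 (hle.trans_lt hx.2)
  · intro V W hV hW
    have hu : DifferentiableOn ℂ (fun W => fatou k β φ₁ φ₂ (Q W) - W) {W | D < W.re} := by
      refine DifferentiableOn.sub ?_ differentiableOn_id
      refine h.differentiableOn_fatou.comp (hQd.mono fun W hW => hle.trans_lt hW) ?_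
      exact fun W hW => deep_subset_basin (hQdeep W hW)
    have := norm_sub_le_of_bounded_halfPlane hd hu hdist hV hW
    rw [show fatou k β φ₁ φ₂ (Q V) - fatou k β φ₁ φ₂ (Q W) - (V - W)
      = fatou k β φ₁ φ₂ (Q V) - V - (fatou k β φ₁ φ₂ (Q W) - W) by ring]
    refine this.trans (mul_le_mul_of_nonneg_right ?_ (norm_nonneg _))
    rw [div_le_iff₀ hd]; linarith

theorem exists_iterate_re_gt (T : ℝ) {x : ℂ} (hx : x ∈ basin k β r φ₁ φ₂) :
    ∃ N : ℕ, ∀ n, N ≤ n → (fun z => φ₂ (φ₁ z))^[n] x ∈ deep k β r ∧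
      T < (sectorTime k β ((fun z => φ₂ (φ₁ z))^[n] x)).re := by
  obtain ⟨m, hm⟩ := exists_iterate_mem_deep hx
  obtain ⟨p, hp⟩ := exists_nat_gt (2 * T)
  refine ⟨m + p, fun n hn => ?_⟩
  obtain ⟨q, rfl⟩ : ∃ q, n = q + m := ⟨n - m, by omega⟩
  rw [Function.iterate_add_apply]
  obtain ⟨h1, h2⟩ := h.iterate_mem_deep hm q
  refine ⟨h1, ?_⟩
  have h3 := h.small.depth_pos.trans hm.2
  have h4 : (p : ℝ) ≤ q := by exact_mod_cast (by omega : p ≤ q)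
  linarith

/-- A common iterate brings both points to the half-plane where the coordinate is a small Lipschitz
perturbation of the identity; the iterates of `φ₂ ∘ φ₁` are themselves injective. -/
theorem injOn_fatou : InjOn (fatou k β φ₁ φ₂) (basin k β r φ₁ φ₂) := by
  intro x hx y hy hxy
  obtain ⟨M, K, Q, -, -, hQ1, hQ2, -, hlip⟩ := h.exists_fatou_chart
  obtain ⟨N₁, hN₁⟩ := h.exists_iterate_re_gt M hx
  obtain ⟨N₂, hN₂⟩ := h.exists_iterate_re_gt M hy
  obtain ⟨a1, a2⟩ := hN₁ (N₁ + N₂) (by omega)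
  obtain ⟨b1, b2⟩ := hN₂ (N₁ + N₂) (by omega)
  refine h.injOn_iterate (N₁ + N₂) hx hy ?_
  have e := hlip _ _ a2 b2
  rw [hQ2 _ a1 a2, hQ2 _ b1 b2, h.fatou_iterate hx, h.fatou_iterate hy, hxy, sub_self, zero_sub,
    norm_neg] at e
  have e0 : ‖sectorTime k β ((fun z => φ₂ (φ₁ z))^[N₁ + N₂] x)
    - sectorTime k β ((fun z => φ₂ (φ₁ z))^[N₁ + N₂] y)‖ ≤ 0 := by linarith
  have e1 := sub_eq_zero.1 (norm_le_zero_iff.1 e0)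
  rw [← hQ2 _ a1 a2, ← hQ2 _ b1 b2, e1]

/-- A holomorphic right inverse of the Fatou coordinate on a half-plane. -/
theorem exists_fatou_inverse : ∃ (M : ℝ) (R : ℂ → ℂ), DifferentiableOn ℂ R {w | M < w.re} ∧
    ∀ w : ℂ, M < w.re → R w ∈ deep k β r ∧ fatou k β φ₁ φ₂ (R w) = w := by
  obtain ⟨M, K, Q, hK, hQd, hQ1, hQ2, hdist, hlip⟩ := h.exists_fatou_chart
  set H : ℂ → ℂ := fun W => fatou k β φ₁ φ₂ (Q W) with hH
  have hopen : IsOpen {W : ℂ | M < W.re} := isOpen_lt continuous_const continuous_re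
  have hHd : DifferentiableOn ℂ H {W | M < W.re} :=
    h.differentiableOn_fatou.comp hQd fun W hW => deep_subset_basin (hQ1 W hW).1
  have hHinj : InjOn H {W | M < W.re} := by
    intro V hV W hW hVW
    have := hlip V W hV hW
    rw [show fatou k β φ₁ φ₂ (Q V) = fatou k β φ₁ φ₂ (Q W) from hVW, sub_self, zero_sub,
      norm_neg] at this
    exact sub_eq_zero.1 (norm_le_zero_iff.1 (by linarith))
  have hHder : ∀ W ∈ {W : ℂ | M < W.re}, deriv H W ≠ 0 := by
    intro W hW h0
    -- If the derivative vanished, `H - id` would have derivative `-1`, against its Lipschitz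
    -- constant 1/2.
    have h1 : HasDerivAt H 0 W := h0 ▸ (hHd.differentiableAt (hopen.mem_nhds hW)).hasDerivAt
    have h2 := h1.sub (hasDerivAt_id W)
    have h3 : ‖(0 : ℂ) - 1‖ ≤ 1 / 2 := by
      refine h2.hasFDerivAt.le_of_lip' (C := 1 / 2) (by norm_num) ?_ |>.trans' ?_
      · filter_upwards [hopen.mem_nhds hW] with V hV
        have := hlip V W hV hW
        simp only [Pi.sub_apply, id]
        rwa [show H V - V - (H W - W) = H V - H W - (V - W) by ring]
      · simp
    norm_num at h3
  have hsurj : ∀ w : ℂ, M + 2 * K < w.re → ∃ W : ℂ, M < W.re ∧ H W = w := by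
    intro w hw
    have hball : ∀ z ∈ Metric.closedBall w (2 * K), M < z.re := by
      intro z hz
      have h1 := (abs_re_le_norm (z - w)).trans (mem_closedBall_iff_norm.1 hz)
      have := (abs_le.1 h1).1
      rw [sub_re] at this
      linarith
    obtain ⟨W, hW, hWw⟩ := exists_eq_of_lipschitz_sub (H := H) (x₀ := w) (w := w) (ε := 2 * K)
      (by linarith) (fun x hx y hy => hlip x y (hball x hx) (hball y hy))
      ((hdist w (by linarith)).trans (by linarith))
    exact ⟨W, hball W hW, hWw⟩
  have hleft : ∀ W ∈ {W : ℂ | M < W.re}, Function.invFunOn H {W | M < W.re} (H W) = W :=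
    fun W hW => hHinj.leftInvOn_invFunOn hW
  obtain ⟨-, hG⟩ := isOpen_image_and_differentiableOn_leftInverse hopen hHd hHder hleft
  refine ⟨M + 2 * K, fun w => Q (Function.invFunOn H {W | M < W.re} w), ?_, ?_⟩
  · refine hQd.comp (hG.mono ?_) ?_
    · intro w hw
      obtain ⟨W, h1, h2⟩ := hsurj w hw
      exact ⟨W, h1, h2⟩
    · intro w hw
      obtain ⟨W, h1, rfl⟩ := hsurj w hw
      rw [hleft W h1]
      exact h1
  · intro w hw
    obtain ⟨W, h1, rfl⟩ := hsurj w hw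
    beta_reduce
    rw [hleft W h1]
    exact ⟨(hQ1 W h1).1, rfl⟩

/-- Uniqueness of Fatou coordinates up to translation. -/
theorem eq_fatou_add_const {T : ℂ → ℂ} (hT : DifferentiableOn ℂ T (basin k β r φ₁ φ₂))
    (hinj : InjOn T (basin k β r φ₁ φ₂))
    (hstep : ∀ x ∈ basin k β r φ₁ φ₂, T (φ₂ (φ₁ x)) = T x + 1) :
    ∃ c : ℂ, ∀ x ∈ basin k β r φ₁ φ₂, T x = fatou k β φ₁ φ₂ x + c := by
  obtain ⟨M, R, hRd, hR⟩ := h.exists_fatou_inverse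
  have hRb : ∀ w : ℂ, M < w.re → R w ∈ basin k β r φ₁ φ₂ := fun w hw => deep_subset_basin (hR w hw).1
  obtain ⟨c, hc⟩ := eq_add_const_of_injOn_halfPlane (M := M) (H := fun w => T (R w))
    (hT.comp hRd hRb) (by
      intro v hv w hw hvw
      have := hinj (hRb v hv) (hRb w hw) hvw
      rw [← (hR v hv).2, ← (hR w hw).2, this]) (by
      intro w hw
      have hw1 : M < (w + 1).re := by rw [add_re, one_re]; linarith
      -- Both points lie in the basin and have Fatou coordinate `w + 1`.
      have : R (w + 1) = φ₂ (φ₁ (R w)) := by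
        refine h.injOn_fatou (hRb _ hw1) (h.maps_basin_self (hRb w hw)) ?_
        rw [(hR _ hw1).2, h.fatou_step (hRb w hw), (hR w hw).2]
      simp only [this]
      exact hstep _ (hRb w hw))
  refine ⟨c, fun x hx => ?_⟩
  have hTn : ∀ n : ℕ, T ((fun z => φ₂ (φ₁ z))^[n] x) = T x + n := by
    intro n
    induction n with
    | zero => simp
    | succ n ih =>
      rw [Function.iterate_succ_apply', hstep _ (h.iterate_mem_basin hx n), ih]
      push_cast; ring
  obtain ⟨n, hn⟩ := exists_nat_gt (M - (fatou k β φ₁ φ₂ x).re)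
  have hre : M < (fatou k β φ₁ φ₂ x + n).re := by rw [add_re, natCast_re]; linarith
  have hRx : R (fatou k β φ₁ φ₂ x + n) = (fun z => φ₂ (φ₁ z))^[n] x := by
    refine h.injOn_fatou (hRb _ hre) (h.iterate_mem_basin hx n) ?_
    rw [(hR _ hre).2, h.fatou_iterate hx]
  have := hc _ hre
  rw [hRx, hTn] at this
  linear_combination this

theorem nonempty_deep : (deep k β r).Nonempty := by
  obtain ⟨M, K, Q, -, -, hQ1, -⟩ := h.exists_fatou_chart
  refine ⟨Q ((M + 1 : ℝ) : ℂ), (hQ1 _ ?_).1⟩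
  rw [ofReal_re]; linarith

/-- Fatou coordinates of the two maps of a pair differ by conjugate constants from the
normalized ones. -/
theorem eq_fatou_add_const_conj {T₁ T₂ : ℂ → ℂ}
    (hT₁ : DifferentiableOn ℂ T₁ (basin k β r φ₁ φ₂)) (hT₂ : DifferentiableOn ℂ T₂ (basin k β r φ₂ φ₁))
    (hinj₁ : InjOn T₁ (basin k β r φ₁ φ₂)) (hinj₂ : InjOn T₂ (basin k β r φ₂ φ₁))
    (h₁₂ : ∀ x ∈ basin k β r φ₁ φ₂, T₂ (φ₁ x) = conj (T₁ x) + 1 / 2)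
    (h₂₁ : ∀ x ∈ basin k β r φ₂ φ₁, T₁ (φ₂ x) = conj (T₂ x) + 1 / 2) :
    ∃ c : ℂ, (∀ x ∈ basin k β r φ₁ φ₂, T₁ x = fatou k β φ₁ φ₂ x + c) ∧
      ∀ x ∈ basin k β r φ₂ φ₁, T₂ x = fatou k β φ₂ φ₁ x + conj c := by
  have c2 : conj (2 : ℂ) = 2 := map_ofNat _ 2
  obtain ⟨c, hc⟩ := h.eq_fatou_add_const hT₁ hinj₁ (by
    intro x hx
    rw [h₂₁ _ (h.maps_basin hx), h₁₂ x hx]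
    simp only [map_add, conj_conj, map_div₀, map_one, c2]
    ring)
  obtain ⟨d, hd⟩ := h.symm.eq_fatou_add_const hT₂ hinj₂ (by
    intro x hx
    rw [h₁₂ _ (h.symm.maps_basin hx), h₂₁ x hx]
    simp only [map_add, conj_conj, map_div₀, map_one, c2]
    ring)
  obtain ⟨x, hx⟩ := h.nonempty_deep
  have hxb := deep_subset_basin (φ₁ := φ₁) (φ₂ := φ₂) hx
  have e := h₁₂ x hxb
  rw [hd _ (h.maps_basin hxb), hc x hxb, h.fatou_conj hxb, map_add] at e
  have : d = conj c := by linear_combination e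
  exact ⟨c, hc, this ▸ hd⟩

end ParabolicPair

end AntiParabolic

/-! ### Vertical lines, their images and fundamental strips -/

namespace AntiParabolic

open Complex Set Filter

/-- A map of a half-plane close to a horizontal translation sends every vertical line to a curve
crossing all horizontal lines, and preserves the order on the horizontal lines. -/
theorem exists_vertical_line_point {M X c : ℝ} {Γ : ℂ → ℂ} (hΓ : DifferentiableOn ℂ Γ {W | M < W.re})
    (hc : ∀ W : ℂ, M < W.re → ‖Γ W - W - c‖ ≤ 1 / 4) (hX : M + 1 < X) {U : ℂ} (hU : M + 1 < U.re) :
    ∃ V : ℂ, V.re = X ∧ (Γ V).im = (Γ U).im ∧ (U.re ≤ X → (Γ U).re ≤ (Γ V).re) ∧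
      (X ≤ U.re → (Γ V).re ≤ (Γ U).re) := by
  set l : ℝ → ℂ := fun y => (X : ℂ) + y * I with hl
  have hlre : ∀ y, (l y).re = X := fun y => by simp [hl]
  have hlim : ∀ y, (l y).im = y := fun y => by simp [hl]
  have hlc : Continuous l := by fun_prop
  have hcont : Continuous fun y => (Γ (l y)).im := by
    refine continuous_im.comp (hΓ.continuousOn.comp_continuous hlc fun y => ?_)
    change M < (l y).re
    rw [hlre]; linarith
  have him : ∀ y, |(Γ (l y)).im - y| ≤ 1 / 4 := by
    intro y
    have := (abs_im_le_norm _).trans (hc (l y) (by rw [hlre]; linarith))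
    simpa [hlim] using this
  set s := (Γ U).im with hs
  obtain ⟨y, -, hy⟩ : s ∈ (fun y => (Γ (l y)).im) '' Icc (s - 1) (s + 1) := by
    refine intermediate_value_Icc (by linarith) hcont.continuousOn ⟨?_, ?_⟩
    · linarith [(abs_le.1 (him (s - 1))).2]
    · linarith [(abs_le.1 (him (s + 1))).1]
  have hlip : ‖(Γ (l y) - l y - c) - (Γ U - U - c)‖ ≤ 1 / 4 / 1 * ‖l y - U‖ :=
    norm_sub_le_of_bounded_halfPlane one_pos ((hΓ.sub differentiableOn_id).sub_const _) hc
      (by rw [hlre]; linarith) hU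
  -- The two images have equal imaginary parts, so the Lipschitz bound controls both terms. The
  -- difference of the real parts of the images therefore cannot have a sign opposite to `X - U.re`.
  have hsq : ((Γ (l y)).re - (Γ U).re - (X - U.re)) ^ 2 + (y - U.im) ^ 2
      ≤ 1 / 16 * ((X - U.re) ^ 2 + (y - U.im) ^ 2) := by
    have h1 := pow_le_pow_left₀ (norm_nonneg _) hlip 2
    rw [mul_pow, ← normSq_eq_norm_sq, ← normSq_eq_norm_sq, normSq_apply, normSq_apply] at h1
    simp only [sub_re, sub_im, hlre, hlim, ofReal_re, ofReal_im] at h1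
    have hy' : (Γ (l y)).im = (Γ U).im := hy
    rw [hy'] at h1
    nlinarith
  refine ⟨l y, hlre y, hy, fun h => ?_, fun h => ?_⟩
  · by_contra! hlt
    nlinarith [sq_nonneg (y - U.im)]
  · by_contra! hlt
    nlinarith [sq_nonneg (y - U.im)]

namespace IsHalfShift

variable {k : ℕ} {β C Λ r σ : ℝ} {χ₁ χ₂ : ℂ → ℂ}

/-- The two conjugations cancel, and the errors and translations add. The margin 2 keeps the points
deep when `σ = -1` moves them to the left. -/
theorem comp_near (h₁ : IsHalfShift k β C r σ χ₁) (h₂ : IsHalfShift k β C r σ χ₂)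
    (h : SmallRadius k β Λ r) (hσ : |σ| ≤ 1) (hΛ : 200 ≤ Λ) (hC : 0 ≤ C) (hCΛ : 1000 * C ≤ Λ) {x : ℂ}
    (hx : x ∈ sector k r)
    (hre : 2 * 4 ^ k * (1 / (k * r ^ k)) + 2 < (sectorTime k β x).re) :
    χ₁ x ∈ deep k β r ∧ χ₂ (χ₁ x) ∈ deep k β r ∧
      ‖sectorTime k β (χ₂ (χ₁ x)) - sectorTime k β x - σ‖ ≤ 1 / 100 := by
  have hσ' := abs_le.1 hσ
  have hxd : x ∈ deep k β r := ⟨hx, by linarith⟩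
  obtain ⟨a1, a2⟩ := h₁.near_of_mem_deep h hΛ hC hCΛ hxd
  have a3 := abs_le.1 (h₁.re_near_of_mem_deep h hΛ hC hCΛ hxd)
  have hyd : χ₁ x ∈ deep k β r := ⟨a1, by linarith [a3.1]⟩
  obtain ⟨b1, b2⟩ := h₂.near_of_mem_deep h hΛ hC hCΛ hyd
  have b3 := abs_le.1 (h₂.re_near_of_mem_deep h hΛ hC hCΛ hyd)
  refine ⟨hyd, ⟨b1, by linarith [b3.1, a3.1]⟩, ?_⟩
  have hsum : sectorTime k β (χ₂ (χ₁ x)) - sectorTime k β x - σ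
      = (sectorTime k β (χ₂ (χ₁ x)) - conj (sectorTime k β (χ₁ x)) - σ / 2)
        + conj (sectorTime k β (χ₁ x) - conj (sectorTime k β x) - σ / 2) := by
    have c2 : conj (2 : ℂ) = 2 := map_ofNat _ 2
    simp only [map_sub, map_div₀, conj_conj, conj_ofReal, c2]
    ring
  rw [hsum]
  refine (norm_add_le _ _).trans ?_
  rw [norm_conj]
  linarith

/-- The order statement of `exists_vertical_line_point` read on the sector. -/
theorem exists_line_point (h₁ : IsHalfShift k β C r σ χ₁) (h₂ : IsHalfShift k β C r σ χ₂)
    (h : SmallRadius k β Λ r) (hσ : |σ| ≤ 1) (hΛ : 200 ≤ Λ) (hC : 0 ≤ C) (hCΛ : 1000 * C ≤ Λ)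
    {X : ℝ} (hX : 2 * 4 ^ k * (1 / (k * r ^ k)) + 4 < X) {u : ℂ} (hu : u ∈ sector k r)
    (hure : 2 * 4 ^ k * (1 / (k * r ^ k)) + 4 < (sectorTime k β u).re) :
    ∃ x ∈ sector k r, (sectorTime k β x).re = X ∧
      (sectorTime k β (χ₂ (χ₁ x))).im = (sectorTime k β (χ₂ (χ₁ u))).im ∧
      ((sectorTime k β u).re ≤ X →
        (sectorTime k β (χ₂ (χ₁ u))).re ≤ (sectorTime k β (χ₂ (χ₁ x))).re) ∧
      (X ≤ (sectorTime k β u).re →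
        (sectorTime k β (χ₂ (χ₁ x))).re ≤ (sectorTime k β (χ₂ (χ₁ u))).re) := by
  obtain ⟨Q, hQd, hQ1, hQ2⟩ := h.exists_time_inverse
  have hle := h.two_mul_le_depth
  set D := 2 * 4 ^ k * (1 / (k * r ^ k)) with hD
  have hlt : ∀ W : ℂ, D + 2 < W.re → 2 * (1 / (k * r ^ k)) < W.re := fun W hW => by linarith
  have hnear : ∀ W : ℂ, D + 2 < W.re → χ₁ (Q W) ∈ deep k β r ∧ χ₂ (χ₁ (Q W)) ∈ deep k β r ∧
      ‖sectorTime k β (χ₂ (χ₁ (Q W))) - W - σ‖ ≤ 1 / 100 := by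
    intro W hW
    obtain ⟨c1, c2⟩ := hQ1 W (hlt W hW)
    have := h₁.comp_near h₂ h hσ hΛ hC hCΛ c1 (by rw [c2]; exact hW)
    rwa [c2] at this
  obtain ⟨V, hV, h3, h4, h5⟩ := exists_vertical_line_point (M := D + 2) (X := X) (c := σ)
    (Γ := fun W => sectorTime k β (χ₂ (χ₁ (Q W)))) (U := sectorTime k β u) (by
      intro W hW
      have hQW := (hQ1 W (hlt W hW)).1
      obtain ⟨c1, c2, -⟩ := hnear W hW
      have e1 : DifferentiableAt ℂ Q W := hQd.differentiableAt
        ((isOpen_lt continuous_const continuous_re).mem_nhds (hlt W hW))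
      have e2 := h₁.differentiableAt_comp h₂ hQW.2.1 c1.1.2.1
      have e3 := (h.hasDerivAt_time c2.1).differentiableAt
      have e4 : DifferentiableAt ℂ (fun W => χ₂ (χ₁ (Q W))) W :=
        DifferentiableAt.comp (g := fun z => χ₂ (χ₁ z)) W e2 e1
      exact (DifferentiableAt.comp (f := fun W => χ₂ (χ₁ (Q W))) W e3 e4).differentiableWithinAt)
    (fun W hW => (hnear W hW).2.2.trans (by norm_num)) (by linarith) (by linarith)
  have hVre : 2 * (1 / (k * r ^ k)) < V.re := by rw [hV]; linarith
  rw [hQ2 u hu (by linarith)] at h3 h4 h5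
  refine ⟨Q V, (hQ1 V hVre).1, ?_, h3, h4, h5⟩
  rw [(hQ1 V hVre).2, hV]

end IsHalfShift

namespace ParabolicPair

variable {k : ℕ} {β C Λ r : ℝ} {φ₁ φ₂ ψ₁ ψ₂ : ℂ → ℂ} (h : ParabolicPair k β C Λ r φ₁ φ₂)
  (h₁ : IsHalfShift k β C r (-1) ψ₁) (h₂ : IsHalfShift k β C r (-1) ψ₂)
  (i₁ : ∀ x, ‖x‖ < r → φ₁ (ψ₂ x) = x) (i₂ : ∀ x, ‖x‖ < r → φ₂ (ψ₁ x) = x)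

include h h₁ h₂ i₁ i₂

/-- Every deep orbit crosses each vertical line far to the right. -/
theorem exists_crossing {X : ℝ} (hX : 2 * 4 ^ k * (1 / (k * r ^ k)) + 10 < X) {w : ℂ}
    (hw : w ∈ deep k β r) : ∃ u ∈ sector k r, X - 2 < (sectorTime k β u).re ∧
      (sectorTime k β u).re ≤ X ∧ X ≤ (sectorTime k β (φ₂ (φ₁ u))).re ∧
      (Relation.ReflTransGen (SectorStep k r φ₁ φ₂) w u ∨
        Relation.ReflTransGen (SectorStep k r φ₁ φ₂) u w) := by
  obtain ⟨hΛ, hCΛ⟩ := h.bounds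
  have hC := h.nonneg
  -- Each step gains at least 1/2, so `n` bounds the number of steps needed to cross the line. From
  -- the other side the orbit is followed backward with the inverse maps.
  have hup : ∀ (n : ℕ) (w : ℂ), w ∈ deep k β r → (sectorTime k β w).re ≤ X →
      X - (sectorTime k β w).re ≤ n / 2 → ∃ u ∈ sector k r, X - 2 < (sectorTime k β u).re ∧
      (sectorTime k β u).re ≤ X ∧ X ≤ (sectorTime k β (φ₂ (φ₁ u))).re ∧
      Relation.ReflTransGen (SectorStep k r φ₁ φ₂) w u := by
    intro n
    induction n with
    | zero =>
      intro w hw h1 h2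
      obtain ⟨-, h3, h4⟩ := h.step_of_mem_deep hw
      have := abs_le.1 (h.re_step_ge h4 (Or.inl (h.small.depth_pos.trans h3.2).le))
      rw [Nat.cast_zero, zero_div] at h2
      exact ⟨w, hw.1, by linarith, h1, by linarith [this.1], .refl⟩
    | succ n ih =>
      intro w hw h1 h2
      obtain ⟨-, h3, h4⟩ := h.step_of_mem_deep hw
      have := abs_le.1 (h.re_step_ge h4 (Or.inl (h.small.depth_pos.trans h3.2).le))
      push_cast at h2
      by_cases hc : X ≤ (sectorTime k β (φ₂ (φ₁ w))).re
      · exact ⟨w, hw.1, by linarith [this.2], h1, hc, .refl⟩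
      · obtain ⟨u, hu, a, b, c, d⟩ := ih _ h3 (not_le.1 hc).le (by linarith [this.1])
        exact ⟨u, hu, a, b, c, d.head h4⟩
  have hdown : ∀ (n : ℕ) (w : ℂ), w ∈ deep k β r → X < (sectorTime k β w).re →
      (sectorTime k β w).re - X ≤ n / 2 → ∃ u ∈ sector k r, X - 2 < (sectorTime k β u).re ∧
      (sectorTime k β u).re ≤ X ∧ X ≤ (sectorTime k β (φ₂ (φ₁ u))).re ∧
      Relation.ReflTransGen (SectorStep k r φ₁ φ₂) u w := by
    intro n
    induction n with
    | zero =>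
      intro w hw h1 h2
      rw [Nat.cast_zero, zero_div] at h2
      linarith
    | succ n ih =>
      intro w hw h1 h2
      obtain ⟨a1, a2, a3⟩ := h₁.comp_near h₂ h.small (by norm_num) hΛ hC hCΛ hw.1 (by linarith)
      have a4 := abs_le.1 ((abs_re_le_norm _).trans a3)
      simp only [sub_re, ofReal_neg, ofReal_one, neg_re, one_re] at a4
      have e1 := i₁ _ a1.1.2.1
      have e2 := i₂ w hw.1.2.1
      have hs : SectorStep k r φ₁ φ₂ (ψ₂ (ψ₁ w)) w := ⟨a2.1, by rw [e1]; exact a1.1, hw.1, by rw [e1, e2]⟩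
      push_cast at h2
      by_cases hc : (sectorTime k β (ψ₂ (ψ₁ w))).re ≤ X
      · exact ⟨_, a2.1, by linarith [a4.1], hc, by rw [e1, e2]; exact h1.le, .single hs⟩
      · obtain ⟨u, hu, a, b, c, d⟩ := ih _ a2 (not_le.1 hc) (by linarith [a4.2])
        exact ⟨u, hu, a, b, c, d.tail hs⟩
  obtain ⟨n, hn⟩ := exists_nat_gt (2 * |X - (sectorTime k β w).re|)
  have hab := abs_le.1 (le_refl |X - (sectorTime k β w).re|)
  rcases le_or_gt (sectorTime k β w).re X with hle | hlt
  · obtain ⟨u, hu, a, b, c, d⟩ := hup n w hw hle (by linarith [hab.2])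
    exact ⟨u, hu, a, b, c, Or.inl d⟩
  · obtain ⟨u, hu, a, b, c, d⟩ := hdown n w hw hlt (by linarith [hab.1])
    exact ⟨u, hu, a, b, c, Or.inr d⟩

/-- Every deep orbit meets the strip to the right of a vertical line and to the left of its
image. -/
theorem exists_strip_point_right {X : ℝ} (hX : 2 * 4 ^ k * (1 / (k * r ^ k)) + 10 < X) {w : ℂ}
    (hw : w ∈ deep k β r) : ∃ v ∈ sector k r, X ≤ (sectorTime k β v).re ∧
      (∃ x ∈ sector k r, (sectorTime k β x).re = X ∧
        (sectorTime k β (φ₂ (φ₁ x))).im = (sectorTime k β v).im ∧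
        (sectorTime k β v).re ≤ (sectorTime k β (φ₂ (φ₁ x))).re) ∧
      (Relation.ReflTransGen (SectorStep k r φ₁ φ₂) w v ∨
        Relation.ReflTransGen (SectorStep k r φ₁ φ₂) v w) := by
  obtain ⟨hΛ, hCΛ⟩ := h.bounds
  obtain ⟨u, hu, a, b, c, d⟩ := h.exists_crossing h₁ h₂ i₁ i₂ hX hw
  obtain ⟨-, -, h3⟩ := h.step_of_mem_deep (x := u) ⟨hu, by linarith⟩
  obtain ⟨x, hx, e1, e2, e3, -⟩ := h.fst.exists_line_point h.snd h.small (by norm_num) hΛ h.nonneg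
    hCΛ (X := X) (by linarith) hu (by linarith)
  refine ⟨_, h3.2.2.1, c, ⟨x, hx, e1, e2, e3 b⟩, ?_⟩
  rcases d with d | d
  · exact Or.inl (d.tail h3)
  -- The strip point is the image of `u`. If the orbit runs from `u` to `w`, then either `u = w` and
  -- the strip point is one step ahead, or the first step passes through it.
  · rcases Relation.ReflTransGen.cases_head d with rfl | ⟨v, hv, hvw⟩
    · exact Or.inl (.single h3)
    · rw [hv.2.2.2] at hvw
      exact Or.inr hvw

/-- Every deep orbit meets the strip to the left of a vertical line and to the right of its
image under the inverse. -/
theorem exists_strip_point_left (j₁ : ∀ x, ‖x‖ < r → ψ₂ (φ₁ x) = x)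
    (j₂ : ∀ x, ‖x‖ < r → ψ₁ (φ₂ x) = x) {X : ℝ} (hX : 2 * 4 ^ k * (1 / (k * r ^ k)) + 10 < X) {w : ℂ}
    (hw : w ∈ deep k β r) : ∃ v ∈ sector k r, (sectorTime k β v).re ≤ X ∧
      (∃ x ∈ sector k r, (sectorTime k β x).re = X ∧
        (sectorTime k β (ψ₂ (ψ₁ x))).im = (sectorTime k β v).im ∧
        (sectorTime k β (ψ₂ (ψ₁ x))).re ≤ (sectorTime k β v).re) ∧
      (Relation.ReflTransGen (SectorStep k r φ₁ φ₂) w v ∨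
        Relation.ReflTransGen (SectorStep k r φ₁ φ₂) v w) := by
  obtain ⟨hΛ, hCΛ⟩ := h.bounds
  obtain ⟨u, hu, a, b, c, d⟩ := h.exists_crossing h₁ h₂ i₁ i₂ hX hw
  obtain ⟨-, -, h3⟩ := h.step_of_mem_deep (x := u) ⟨hu, by linarith⟩
  obtain ⟨x, hx, e1, e2, -, e3⟩ := h₁.exists_line_point h₂ h.small (by norm_num) hΛ h.nonneg
    hCΛ (X := X) (by linarith) h3.2.2.1 (by linarith)
  rw [j₂ _ h3.2.1.2.1, j₁ _ hu.2.1] at e2 e3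
  exact ⟨u, hu, b, ⟨x, hx, e1, e2, e3 c⟩, d⟩

end ParabolicPair

end AntiParabolic

/-! ### Expansion of the prenormalized germ in the time coordinate -/

namespace AntiParabolic

open Complex Set Filter Asymptotics

/-- An analytic function that is `o(z ^ n)` is `O(z ^ (n + 1))`. -/
theorem isBigO_pow_succ_of_isLittleO_pow {R : ℂ → ℂ} (hR : AnalyticAt ℂ R 0) {n : ℕ}
    (h : R =o[𝓝 0] fun z : ℂ => z ^ n) : R =O[𝓝 0] fun z : ℂ => z ^ (n + 1) := by
  by_cases h0 : ∀ᶠ z in 𝓝 (0 : ℂ), R z = 0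
  · exact (isBigO_zero _ _).congr' (h0.mono fun z hz => hz.symm) EventuallyEq.rfl
  obtain ⟨m, g, hg, hg0, hRg⟩ := hR.exists_eventuallyEq_pow_smul_nonzero_iff.2 h0
  simp only [sub_zero, smul_eq_mul] at hRg
  have hmn : n + 1 ≤ m := by
    by_contra! hlt
    have h1 : R =o[𝓝 0] fun z : ℂ => z ^ m := by
      refine h.trans_isBigO ?_
      refine IsBigO.of_bound 1 ?_
      filter_upwards [Metric.ball_mem_nhds (0 : ℂ) one_pos] with z hz
      rw [mem_ball_zero_iff] at hz
      rw [norm_pow, norm_pow, one_mul]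
      exact pow_le_pow_of_le_one (norm_nonneg _) hz.le (by omega)
    have h2 := h1.def (show 0 < ‖g 0‖ / 2 by have := norm_pos_iff.2 hg0; positivity)
    have h3 : ∀ᶠ z in 𝓝 (0 : ℂ), ‖g 0‖ / 2 < ‖g z‖ :=
      hg.continuousAt.norm.eventually (lt_mem_nhds (by have := norm_pos_iff.2 hg0; linarith))
    have h4 : ∀ᶠ z in 𝓝[≠] (0 : ℂ), False := by
      filter_upwards [(h2.and (h3.and hRg)).filter_mono nhdsWithin_le_nhds, self_mem_nhdsWithin]
        with z ⟨a, b, c⟩ hz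
      rw [c, norm_mul, norm_pow, mul_comm] at a
      have : 0 < ‖z‖ ^ m := pow_pos (norm_pos_iff.2 hz) m
      exact absurd (le_of_mul_le_mul_right a this) (not_le.2 b)
    exact (NeBot.ne (f := 𝓝[≠] (0 : ℂ)) inferInstance) (eventually_false_iff_eq_bot.1 h4)
  have h5 : (fun z : ℂ => z ^ m * g z) =O[𝓝 0] fun z : ℂ => z ^ (n + 1) * 1 := by
    refine IsBigO.mul ?_ (hg.continuousAt.tendsto.isBigO_one ℂ)
    refine IsBigO.of_bound 1 ?_
    filter_upwards [Metric.ball_mem_nhds (0 : ℂ) one_pos] with z hz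
    rw [mem_ball_zero_iff] at hz
    rw [norm_pow, norm_pow, one_mul]
    exact pow_le_pow_of_le_one (norm_nonneg _) hz.le hmn
  simpa using h5.congr' (hRg.mono fun z hz => hz.symm) EventuallyEq.rfl

theorem isBigO_inv_one_add_pow (k : ℕ) :
    (fun s : ℂ => ((1 + s) ^ k)⁻¹ - (1 - k * s + k * (k + 1) / 2 * s ^ 2)) =O[𝓝 0]
      fun s : ℂ => s ^ 3 := by
  induction k with
  | zero => simpa using isBigO_zero _ _
  | succ k ih =>
    have hinv : (fun s : ℂ => (1 + s)⁻¹) =O[𝓝 0] fun _ => (1 : ℂ) := by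
      have : ContinuousAt (fun s : ℂ => (1 + s)⁻¹) 0 := ContinuousAt.inv₀ (by fun_prop) (by simp)
      exact this.tendsto.isBigO_one ℂ
    have h1 := hinv.mul (ih.sub ((isBigO_refl (fun s : ℂ => s ^ 3) (𝓝 0)).const_mul_left
      ((k + 1) * (k + 2) / 2 : ℂ)))
    simp only [one_mul] at h1
    refine h1.congr' ?_ EventuallyEq.rfl
    have hne : ∀ᶠ s : ℂ in 𝓝 0, 1 + s ≠ 0 :=
      (by fun_prop : ContinuousAt (fun s : ℂ => 1 + s) 0).eventually_ne (by simp)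
    filter_upwards [hne] with s hs
    push_cast
    have e : ((1 + s) ^ (k + 1))⁻¹ = (1 + s)⁻¹ * ((1 + s) ^ k)⁻¹ := by rw [pow_succ', mul_inv]
    rw [e]
    have e2 : (1 + s)⁻¹ * (1 + s) = 1 := inv_mul_cancel₀ hs
    linear_combination (-(1 - (k + 1) * s + (k + 1) * (k + 1 + 1) / 2 * s ^ 2) : ℂ) * e2

theorem isBigO_log_one_add_sub : (fun s : ℂ => log (1 + s) - s) =O[𝓝 0] fun s : ℂ => s ^ 2 := by
  refine IsBigO.of_bound 1 ?_
  filter_upwards [Metric.ball_mem_nhds (0 : ℂ) (show (0 : ℝ) < 1 / 2 by norm_num)] with s hs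
  rw [mem_ball_zero_iff] at hs
  have h1 := norm_log_one_add_sub_self_le (z := s) (by linarith)
  rw [norm_pow, one_mul]
  refine h1.trans ?_
  have : (1 - ‖s‖)⁻¹ ≤ 2 := by
    rw [inv_le_comm₀ (by linarith) (by norm_num)]; linarith
  have h2 := sq_nonneg ‖s‖
  nlinarith

/-- The expansion of the germ read in the coordinate `-1 / (k u^k) + b log u`. -/
theorem exists_germ_estimate {k : ℕ} (hk : 1 ≤ k) {b : ℝ} {h : ℂ → ℂ} (hh : AnalyticAt ℂ h 0)
    (ho : (fun w : ℂ => h w - (w + (1 / 2 : ℂ) * w ^ (k + 1)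
      + (((k : ℂ) + 1) / 8 - (b : ℂ) / 2) * w ^ (2 * k + 1))) =o[𝓝 0] fun w : ℂ => w ^ (2 * k + 1)) :
    ∃ C ρ : ℝ, 0 ≤ C ∧ 0 < ρ ∧ ∀ u : ℂ, u ≠ 0 → ‖u‖ < ρ →
      ‖h u / u - 1‖ ≤ 3 / 4 * ‖u‖ ^ k ∧
      ‖-1 / ((k : ℂ) * u ^ k) * (((h u / u) ^ k)⁻¹ - 1) + b * log (h u / u) - 1 / 2‖
        ≤ C * ‖u‖ ^ (k + 1) := by
  have hkc : (k : ℂ) ≠ 0 := by exact_mod_cast (by omega : k ≠ 0)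
  set c : ℂ := ((k : ℂ) + 1) / 8 - (b : ℂ) / 2 with hc
  -- Analyticity turns the remainder `o(w^(2k+1))` into `O(w^(2k+2))`. Without this gain the errors
  -- would only be `o(1/n)` along orbits, which need not be summable.
  have hO := isBigO_pow_succ_of_isLittleO_pow
    (hh.fun_sub (by fun_prop)) ho
  replace hO := hO.mono (nhdsWithin_le_nhds (s := {0}ᶜ))
  have hne : ∀ᶠ u : ℂ in 𝓝[≠] 0, u ≠ 0 := self_mem_nhdsWithin
  have hmono : ∀ {m n : ℕ}, n ≤ m → (fun u : ℂ => u ^ m) =O[𝓝[≠] 0] fun u : ℂ => u ^ n := by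
    intro m n hmn
    refine IsBigO.of_bound 1 ?_
    filter_upwards [mem_nhdsWithin_of_mem_nhds (Metric.ball_mem_nhds (0 : ℂ) one_pos)] with z hz
    rw [mem_ball_zero_iff] at hz
    rw [norm_pow, norm_pow, one_mul]
    exact pow_le_pow_of_le_one (norm_nonneg _) hz.le hmn
  set η : ℂ → ℂ := fun u => h u / u - 1 with hη
  have hη1 : (fun u => η u - (1 / 2 * u ^ k + c * u ^ (2 * k))) =O[𝓝[≠] 0]
      fun u : ℂ => u ^ (2 * k + 1) := by
    have := (isBigO_refl (fun u : ℂ => u⁻¹) (𝓝[≠] 0)).mul hO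
    refine this.congr' ?_ ?_
    · filter_upwards [hne] with u hu
      simp only [hη]
      field_simp
      ring
    · filter_upwards [hne] with u hu
      rw [pow_succ', inv_mul_cancel_left₀ hu]
  have hη2 : (fun u => η u - 1 / 2 * u ^ k) =O[𝓝[≠] 0] fun u : ℂ => u ^ (2 * k) := by
    have := (hη1.trans (hmono (by omega : 2 * k ≤ 2 * k + 1))).add
      ((isBigO_refl (fun u : ℂ => u ^ (2 * k)) (𝓝[≠] 0)).const_mul_left c)
    exact this.congr_left fun u => by ring
  have hη3 : η =O[𝓝[≠] 0] fun u : ℂ => u ^ k := by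
    have := (hη2.trans (hmono (by omega : k ≤ 2 * k))).add
      ((isBigO_refl (fun u : ℂ => u ^ k) (𝓝[≠] 0)).const_mul_left (1 / 2))
    exact this.congr_left fun u => by ring
  have hpow0 : Tendsto (fun u : ℂ => u ^ k) (𝓝[≠] 0) (𝓝 0) := by
    have : Tendsto (fun u : ℂ => u ^ k) (𝓝 0) (𝓝 (0 ^ k)) := (continuous_pow k).tendsto 0
    rw [zero_pow (by omega)] at this
    exact this.mono_left nhdsWithin_le_nhds
  have hη0 : Tendsto η (𝓝[≠] 0) (𝓝 0) := hη3.trans_tendsto hpow0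
  have hsq : (fun u => η u ^ 2 - 1 / 4 * u ^ (2 * k)) =O[𝓝[≠] 0] fun u : ℂ => u ^ (2 * k + 1) := by
    have := (hη2.mul (hη3.add ((isBigO_refl (fun u : ℂ => u ^ k) (𝓝[≠] 0)).const_mul_left (1 / 2))))
    refine (this.congr (fun u => ?_) fun u => ?_ : _ =O[_] fun u : ℂ => u ^ (3 * k)).trans
      (hmono (by omega))
    · ring
    · ring
  have hb1 : (fun u => ((1 + η u) ^ k)⁻¹ - (1 - k * η u + k * (k + 1) / 2 * η u ^ 2)) =O[𝓝[≠] 0]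
      fun u : ℂ => u ^ (2 * k + 1) := by
    have := ((isBigO_inv_one_add_pow k).comp_tendsto hη0).trans (hη3.pow 3)
    exact (this.congr_right fun u => (pow_mul' u 3 k).symm).trans (hmono (by omega))
  have hb2 : (fun u : ℂ => u ^ k * (log (1 + η u) - η u)) =O[𝓝[≠] 0]
      fun u : ℂ => u ^ (2 * k + 1) := by
    have := (isBigO_refl (fun u : ℂ => u ^ k) (𝓝[≠] 0)).mul
      ((isBigO_log_one_add_sub.comp_tendsto hη0).trans (hη3.pow 2))
    exact (this.congr_right fun u => (by ring : _ = u ^ (3 * k))).trans (hmono (by omega))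
  have hb3 : (fun u : ℂ => u ^ k * (η u - 1 / 2 * u ^ k)) =O[𝓝[≠] 0]
      fun u : ℂ => u ^ (2 * k + 1) := by
    have := (isBigO_refl (fun u : ℂ => u ^ k) (𝓝[≠] 0)).mul hη2
    exact (this.congr_right fun u => (by ring : _ = u ^ (3 * k))).trans (hmono (by omega))
  -- The coefficient of `u^(2k)` is `k c - k (k+1) / 8 + k b / 2`, which vanishes by the choice of
  -- `c` in the prenormal form.
  have htot : (fun u : ℂ => -(((1 + η u) ^ k)⁻¹ - 1) + k * b * u ^ k * log (1 + η u) - k / 2 * u ^ k)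
      =O[𝓝[≠] 0] fun u : ℂ => u ^ (2 * k + 1) := by
    have := ((((hb1.const_mul_left (-1)).add (hη1.const_mul_left (k : ℂ))).add
      (hsq.const_mul_left (-(k * (k + 1) / 2 : ℂ)))).add
      (hb2.const_mul_left (k * b : ℂ))).add (hb3.const_mul_left (k * b : ℂ))
    refine this.congr_left fun u => ?_
    rw [hc]; ring
  have hfin : (fun u : ℂ => -1 / ((k : ℂ) * u ^ k) * (((h u / u) ^ k)⁻¹ - 1) + b * log (h u / u) - 1 / 2)
      =O[𝓝[≠] 0] fun u : ℂ => u ^ (k + 1) := by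
    have := (isBigO_refl (fun u : ℂ => (u ^ k)⁻¹) (𝓝[≠] 0)).mul (htot.const_mul_left (k : ℂ)⁻¹)
    refine this.congr' ?_ ?_
    · filter_upwards [hne] with u hu
      have e : 1 + η u = h u / u := by simp [hη]
      rw [e]
      have : u ^ k ≠ 0 := pow_ne_zero _ hu
      field_simp
    · filter_upwards [hne] with u hu
      have : u ^ k ≠ 0 := pow_ne_zero _ hu
      rw [show 2 * k + 1 = k + (k + 1) by ring, pow_add, inv_mul_cancel_left₀ this]
  obtain ⟨C, hC0, hC⟩ := hfin.exists_nonneg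
  -- The leading coefficient 1/2 and a tolerance 1/4 give the factor 3/4; being below 1, it leaves
  -- room for the inverse germ.
  have hlit : (fun u => η u - 1 / 2 * u ^ k) =o[𝓝[≠] 0] fun u : ℂ => u ^ k := by
    refine hη2.trans_isLittleO ?_
    have : (fun u : ℂ => u ^ k * u ^ k) =o[𝓝[≠] 0] fun u : ℂ => u ^ k * 1 :=
      (isBigO_refl (fun u : ℂ => u ^ k) (𝓝[≠] 0)).mul_isLittleO ((isLittleO_one_iff ℂ).2 hpow0)
    exact this.congr (fun u => by ring) fun u => by ring
  have hev := (hlit.def (show (0 : ℝ) < 1 / 4 by norm_num)).and hC.bound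
  rw [eventually_nhdsWithin_iff, Metric.eventually_nhds_iff_ball] at hev
  obtain ⟨ρ, hρ, hball⟩ := hev
  refine ⟨C, ρ, hC0, hρ, fun u hu hur => ?_⟩
  obtain ⟨h1, h2⟩ := hball u (by simpa using hur) hu
  rw [norm_pow] at h1 h2
  refine ⟨?_, h2⟩
  have h3 : ‖(1 / 2 : ℂ) * u ^ k‖ = 1 / 2 * ‖u‖ ^ k := by simp
  have h4 := norm_add_le (η u - 1 / 2 * u ^ k) (1 / 2 * u ^ k)
  rw [sub_add_cancel, h3] at h4
  change ‖η u‖ ≤ _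
  linarith

end AntiParabolic

/-! ### The germ and its inverse as half shifts on rotated sectors -/

namespace AntiParabolic

open Complex Set Filter Asymptotics

/-- The map `F` read in two charts of the sector rotated by `ω`, resp. `conj ω`. -/
def rotated (ω : ℂ) (F : ℂ → ℂ) (x : ℂ) : ℂ := ω * F (ω * x)

theorem IsHalfShift.const_le {k : ℕ} {β C C' r σ : ℝ} {φ : ℂ → ℂ} (h : IsHalfShift k β C r σ φ)
    (hC : C ≤ C') : IsHalfShift k β C' r σ φ :=
  ⟨h.differentiableOn, h.close, fun x hx hy ha => (h.estimate x hx hy ha).trans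
    (mul_le_mul_of_nonneg_right hC (by positivity))⟩

/-- With `u = conj (ω x)`, the relation `ω ^ k = -s` makes the error in the coordinate equal to `s`
times the expression bounded by the germ estimate. -/
theorem isHalfShift_rotated {k : ℕ} (hk : 1 ≤ k) {b C ρ s : ℝ} {f h : ℂ → ℂ} {ω : ℂ}
    (hs : s = 1 ∨ s = -1) (hω : ‖ω‖ = 1) (hωk : ω ^ k = -s) (hf : ∀ z, f z = h (conj z))
    (hd : DifferentiableOn ℂ h (Metric.ball 0 ρ)) (h0 : h 0 = 0)
    (hest : ∀ u : ℂ, u ≠ 0 → ‖u‖ < ρ → ‖h u / u - 1‖ ≤ 3 / 4 * ‖u‖ ^ k ∧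
      ‖-1 / ((k : ℂ) * u ^ k) * (((h u / u) ^ k)⁻¹ - 1) + b * log (h u / u) - 1 / 2‖
        ≤ C * ‖u‖ ^ (k + 1)) :
    IsHalfShift k (s * b) C ρ s (rotated ω f) ∧
      ∀ x, ‖x‖ < ρ → ‖rotated ω f x - conj x‖ ≤ 3 / 4 * ‖x‖ ^ (k + 1) := by
  have hωω : ω * conj ω = 1 := by rw [mul_conj, normSq_eq_norm_sq, hω]; simp
  have hrot : ∀ x, rotated ω f x = ω * h (conj ω * conj x) := fun x => by
    rw [rotated, hf, map_mul]
  have hnu : ∀ x, ‖conj ω * conj x‖ = ‖x‖ := fun x => by simp [hω]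
  have hclose : ∀ x, ‖x‖ < ρ → ‖rotated ω f x - conj x‖ ≤ 3 / 4 * ‖x‖ ^ (k + 1) := by
    intro x hx
    rcases eq_or_ne x 0 with rfl | hx0
    · rw [hrot]; simp [h0]
    set u := conj ω * conj x with hu
    have hu0 : u ≠ 0 := by rw [← norm_pos_iff, hnu]; exact norm_pos_iff.2 hx0
    have h1 := (hest u hu0 (by rw [hnu]; exact hx)).1
    have h2 : rotated ω f x - conj x = ω * u * (h u / u - 1) := by
      rw [hrot, ← hu]
      have : conj x = ω * u := by rw [hu, ← mul_assoc, hωω, one_mul]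
      rw [this]; field_simp
    rw [h2, norm_mul, norm_mul, hω, one_mul, pow_succ]
    rw [hnu] at h1 ⊢
    nlinarith [norm_nonneg x]
  refine ⟨⟨?_, fun x hx => (hclose x hx).trans ?_, ?_⟩, hclose⟩
  · have : (fun x => rotated ω f (conj x)) = fun x => ω * h (conj ω * x) := by
      funext x; rw [hrot, conj_conj]
    rw [this]
    refine (hd.comp (by fun_prop) fun x hx => ?_).const_mul ω
    rw [mem_ball_zero_iff] at *
    simpa [hω] using hx
  · have := pow_nonneg (norm_nonneg x) (k + 1)
    linarith
  · intro x hx hy harg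
    have hkc : (k : ℂ) ≠ 0 := by exact_mod_cast (by omega : k ≠ 0)
    set u := conj ω * conj x with hu
    have hu0 : u ≠ 0 := by rw [← norm_pos_iff, hnu]; exact norm_pos_iff.2 hx.1
    have h2 := (hest u hu0 (by rw [hnu]; exact hx.2.1)).2
    have hcx : conj x = ω * u := by rw [hu, ← mul_assoc, hωω, one_mul]
    have hcx0 : conj x ≠ 0 := by simpa using hx.1
    set y := rotated ω f x with hy'
    set m := h u / u with hm
    have hym : y = conj x * m := by
      rw [hy', hrot, ← hu, hcx, hm]; field_simp
    have hm0 : m ≠ 0 := fun hm0 => hy.1 (by rw [hym, hm0, mul_zero])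
    have hlogc : log (conj x) = conj (log x) :=
      log_conj _ (slitPlane_arg_ne_pi (mem_slitPlane_of_mem_sector hk hx))
    -- The difference of logarithms has imaginary part `arg x + arg y` in `(-π, π)`, so it is the
    -- principal logarithm of the quotient.
    have hlogm : log m = log y - conj (log x) := by
      have e : m = exp (log y - conj (log x)) := by
        rw [exp_sub, ← hlogc, exp_log hy.1, exp_log hcx0, hym, mul_div_cancel_left₀ _ hcx0]
      have him : (log y - conj (log x)).im = arg x + arg y := by
        rw [sub_im, conj_im, log_im, log_im]; ring
      have hab := abs_lt.1 harg
      conv_lhs => rw [e]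
      exact log_exp (by rw [him]; exact hab.1) (by rw [him]; exact hab.2.le)
    have hss : (s : ℂ) * s = 1 := by rcases hs with rfl | rfl <;> simp
    have hs0 : (s : ℂ) ≠ 0 := fun h0 => by rw [h0, zero_mul] at hss; exact zero_ne_one hss
    have huk : conj x ^ k = -s * u ^ k := by rw [hcx, mul_pow, hωk]
    have hukn : u ^ k ≠ 0 := pow_ne_zero _ hu0
    have hmk : m ^ k ≠ 0 := pow_ne_zero _ hm0
    have hinv : (1 : ℂ) / s = s := by rw [div_eq_iff hs0, hss]
    have key : sectorTime k (s * b) y - conj (sectorTime k (s * b) x) - s / 2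
        = s * (-1 / ((k : ℂ) * u ^ k) * ((m ^ k)⁻¹ - 1) + b * log m - 1 / 2) := by
      have e1 : 1 / ((k : ℂ) * y ^ k) = s * (-1 / ((k : ℂ) * u ^ k) * (m ^ k)⁻¹) := by
        rw [hym, mul_pow, huk]
        calc 1 / ((k : ℂ) * (-s * u ^ k * m ^ k)) = 1 / s * (-1 / ((k : ℂ) * u ^ k) * (m ^ k)⁻¹) := by
              field_simp
          _ = _ := by rw [hinv]
      have e2 : conj (1 / ((k : ℂ) * x ^ k)) = s * (-1 / ((k : ℂ) * u ^ k)) := by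
        rw [map_div₀, map_mul, map_pow, huk, map_one, map_natCast]
        calc 1 / ((k : ℂ) * (-s * u ^ k)) = 1 / s * (-1 / ((k : ℂ) * u ^ k)) := by
              field_simp
          _ = _ := by rw [hinv]
      rw [sectorTime, sectorTime, map_add, e1, e2, hlogm, map_mul, conj_ofReal]
      push_cast
      ring
    rw [key, norm_mul]
    have hsn : ‖(s : ℂ)‖ = 1 := by rcases hs with rfl | rfl <;> simp
    rw [hsn, one_mul]
    rwa [hnu] at h2

/-- The inverse of a half shift is a half shift of the opposite sign. -/
theorem isHalfShift_inverse {k : ℕ} {β C ρ r σ : ℝ} {χ χ' : ℂ → ℂ} (hχ : IsHalfShift k β C ρ σ χ)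
    (hC : 0 ≤ C) (hclose : ∀ x, ‖x‖ < ρ → ‖χ x - conj x‖ ≤ 3 / 4 * ‖x‖ ^ (k + 1)) (hr : r ≤ ρ)
    (hρ : (k + 1) * ρ ^ k ≤ 1 / 4)
    (hd : DifferentiableOn ℂ (fun x => χ' (conj x)) (Metric.ball 0 r))
    (hinv : ∀ x, ‖x‖ < r → ‖χ' x‖ < ρ ∧ χ (χ' x) = x) : IsHalfShift k β (2 * C) r (-σ) χ' := by
  have hpow : ∀ x, ‖x‖ < r → ‖χ' x‖ ^ (k + 1) ≤ 4 / 3 * ‖x‖ ^ (k + 1) := by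
    intro x hx
    obtain ⟨h1, h2⟩ := hinv x hx
    set y := χ' x
    have h3 := hclose y h1
    rw [h2] at h3
    have h4 := norm_sub_norm_le (conj y) x
    rw [norm_conj, norm_sub_rev] at h4
    have h5 : ‖y‖ ^ k ≤ ρ ^ k := by gcongr
    have h50 := pow_nonneg (norm_nonneg y) k
    have hk1 : (0 : ℝ) ≤ k := by positivity
    have h6 : (k + 1) * ‖y‖ ^ k ≤ 1 / 4 := le_trans (by gcongr) hρ
    have h7 : ‖y‖ ^ k ≤ 1 / 4 := by nlinarith
    have h8 : ‖y‖ * (1 - ‖y‖ ^ k) ≤ ‖x‖ := by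
      rw [pow_succ] at h3
      nlinarith [norm_nonneg y]
    have h9 : (‖y‖ * (1 - ‖y‖ ^ k)) ^ (k + 1) ≤ ‖x‖ ^ (k + 1) :=
      pow_le_pow_left₀ (mul_nonneg (norm_nonneg _) (by linarith)) h8 _
    -- Bernoulli's inequality gives `(1 - ‖y‖^k)^(k+1) ≥ 3/4`, whence the factor 4/3, which exactly
    -- cancels the 3/4 of the closeness estimate.
    have h10 := one_add_mul_le_pow (a := -‖y‖ ^ k) (by linarith) (k + 1)
    push_cast at h10
    rw [mul_pow] at h9
    have h11 : 3 / 4 ≤ (1 - ‖y‖ ^ k) ^ (k + 1) := by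
      rw [sub_eq_add_neg]; linarith
    have h12 := pow_nonneg (norm_nonneg y) (k + 1)
    nlinarith
  refine ⟨hd, ?_, ?_⟩
  · intro x hx
    obtain ⟨h1, h2⟩ := hinv x hx
    have h3 := hclose _ h1
    rw [h2, ← norm_conj, map_sub, conj_conj, norm_sub_rev] at h3
    linarith [hpow x hx]
  · intro x hx hy harg
    obtain ⟨h1, h2⟩ := hinv x hx.2.1
    have h3 := hχ.estimate (χ' x) (sector_mono hr hy) (by rw [h2]; exact sector_mono hr hx)
      (by rw [h2, add_comm]; exact harg)
    rw [h2] at h3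
    have h4 : sectorTime k β (χ' x) - conj (sectorTime k β x) - ((-σ : ℝ) : ℂ) / 2
        = -conj (sectorTime k β x - conj (sectorTime k β (χ' x)) - σ / 2) := by
      have c2 : conj (2 : ℂ) = 2 := map_ofNat _ 2
      simp only [map_sub, map_div₀, conj_conj, conj_ofReal, c2, ofReal_neg]
      ring
    rw [h4, norm_neg, norm_conj]
    refine h3.trans ?_
    have := hpow x hx.2.1
    have := pow_nonneg (norm_nonneg x) (k + 1)
    nlinarith

/-- A holomorphic germ tangent to the identity has a local inverse. -/
theorem exists_local_inverse {h : ℂ → ℂ} {ρ : ℝ} (hρ : 0 < ρ)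
    (hd : DifferentiableOn ℂ h (Metric.ball 0 ρ)) (h0 : h 0 = 0) (h1 : HasDerivAt h 1 0) :
    ∃ (g : ℂ → ℂ) (r : ℝ), 0 < r ∧ r ≤ ρ ∧ DifferentiableOn ℂ g (Metric.ball 0 r) ∧
      ∀ w, ‖w‖ < r → ‖g w‖ < ρ ∧ h (g w) = w ∧ g (h w) = w := by
  have han := hd.analyticAt (Metric.ball_mem_nhds 0 hρ)
  have hst : HasStrictDerivAt h 1 0 := h1.deriv ▸ han.hasStrictDerivAt
  set g := hst.localInverse h 1 0 one_ne_zero with hg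
  have hl : ∀ᶠ x in 𝓝 (0 : ℂ), g (h x) = x := hst.eventually_left_inverse one_ne_zero
  have hder : ∀ᶠ x in 𝓝 (0 : ℂ), deriv h x ≠ 0 :=
    han.deriv.continuousAt.eventually_ne (by rw [h1.deriv]; exact one_ne_zero)
  obtain ⟨t, ht, hball⟩ := Metric.eventually_nhds_iff_ball.1
    ((hl.and hder).and (Metric.ball_mem_nhds (0 : ℂ) hρ))
  obtain ⟨hopen, hgd⟩ := isOpen_image_and_differentiableOn_leftInverse (Metric.isOpen_ball (x := (0 : ℂ)) (ε := t))
    (hd.mono fun x hx => (hball x hx).2) (fun x hx => (hball x hx).1.2) (fun x hx => (hball x hx).1.1)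
  have hmem : h '' Metric.ball 0 t ∈ 𝓝 (0 : ℂ) :=
    hopen.mem_nhds ⟨0, Metric.mem_ball_self ht, h0⟩
  obtain ⟨t', ht', hsub⟩ := Metric.mem_nhds_iff.1 hmem
  refine ⟨g, min ρ (min t t'), lt_min hρ (lt_min ht ht'), min_le_left _ _, ?_, ?_⟩
  · exact hgd.mono ((Metric.ball_subset_ball ((min_le_right _ _).trans (min_le_right _ _))).trans hsub)
  · intro w hw
    have hwt : w ∈ Metric.ball (0 : ℂ) t := by
      rw [mem_ball_zero_iff]; exact hw.trans_le ((min_le_right _ _).trans (min_le_left _ _))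
    have hwt' : w ∈ Metric.ball (0 : ℂ) t' := by
      rw [mem_ball_zero_iff]; exact hw.trans_le ((min_le_right _ _).trans (min_le_right _ _))
    refine ⟨?_, ?_, (hball w hwt).1.1⟩
    all_goals
      obtain ⟨v, hv, rfl⟩ := hsub hwt'
      rw [(hball v hv).1.1]
    simpa using (hball v hv).2

/-- A prenormalized germ and its inverse, read in the rotated sectors, are half shifts. -/
theorem IsPrenormalized.exists_halfShifts {k : ℕ} (hk : 1 ≤ k) {b : ℝ} {f : ℂ → ℂ}
    (hf : IsPrenormalized k b f) : ∃ (e : ℂ → ℂ) (C ρ : ℝ), 0 ≤ C ∧ 0 < ρ ∧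
      (∀ z, ‖z‖ < ρ → e (f z) = z ∧ f (e z) = z) ∧
      ∀ (s : ℝ) (ω : ℂ), s = 1 ∨ s = -1 → ‖ω‖ = 1 → ω ^ k = -s →
        IsHalfShift k (s * b) C ρ s (rotated ω f) ∧ IsHalfShift k (s * b) C ρ (-s) (rotated ω e) := by
  obtain ⟨hh, ho⟩ := hf
  set h : ℂ → ℂ := fun z => f (conj z) with hhd
  have hfh : ∀ z, f z = h (conj z) := fun z => by simp [hhd]
  have ho' : (fun w : ℂ => h w - (w + (1 / 2 : ℂ) * w ^ (k + 1)
      + (((k : ℂ) + 1) / 8 - (b : ℂ) / 2) * w ^ (2 * k + 1))) =o[𝓝 0] fun w : ℂ => w ^ (2 * k + 1) := by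
    have hc0 : Tendsto (fun w : ℂ => conj w) (𝓝 0) (𝓝 0) := by
      have := continuous_conj.tendsto (0 : ℂ)
      rwa [map_zero] at this
    have h1 := ho.comp_tendsto hc0
    have h2 : (fun w : ℂ => conj w ^ (2 * k + 1)) =O[𝓝 0] fun w : ℂ => w ^ (2 * k + 1) :=
      IsBigO.of_bound 1 (Eventually.of_forall fun w => by simp)
    have h3 := IsLittleO.trans_isBigO (g := fun w : ℂ => conj w ^ (2 * k + 1)) h1 h2
    simpa [Function.comp_def] using h3
  obtain ⟨C, ρ₁, hC, hρ₁, hest⟩ := exists_germ_estimate hk hh ho'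
  have h0 : h 0 = 0 := by
    have h1 := (ho'.def one_pos).self_of_nhds
    simpa using h1
  obtain ⟨ρ₂, hρ₂, hd⟩ : ∃ ρ₂ > 0, DifferentiableOn ℂ h (Metric.ball 0 ρ₂) := by
    obtain ⟨t, ht, hball⟩ := Metric.eventually_nhds_iff_ball.1 hh.eventually_analyticAt
    exact ⟨t, ht, fun z hz => (hball z hz).differentiableAt.differentiableWithinAt⟩
  obtain ⟨ρ₃, hρ₃, hsm⟩ : ∃ ρ₃ > 0, ∀ t : ℝ, 0 < t → t ≤ ρ₃ → (k + 1) * t ^ k ≤ 1 / 4 := by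
    refine ⟨1 / (4 * (k + 1)), by positivity, fun t ht htle => ?_⟩
    have h1 : t ≤ 1 := htle.trans (by
      rw [div_le_one (by positivity)]
      have : (0 : ℝ) ≤ k := by positivity
      linarith)
    have h2 : t ^ k ≤ t := pow_le_of_le_one ht.le h1 (by omega)
    rw [le_div_iff₀ (by positivity)] at htle
    have : (0 : ℝ) ≤ k := by positivity
    nlinarith
  set ρ := min ρ₁ (min ρ₂ ρ₃) with hρdef
  have hρ : 0 < ρ := lt_min hρ₁ (lt_min hρ₂ hρ₃)
  have hdρ : DifferentiableOn ℂ h (Metric.ball 0 ρ) :=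
    hd.mono (Metric.ball_subset_ball ((min_le_right _ _).trans (min_le_left _ _)))
  have hestρ := fun (u : ℂ) (hu : u ≠ 0) (hur : ‖u‖ < ρ) => hest u hu (hur.trans_le (min_le_left _ _))
  have hder : HasDerivAt h 1 0 := by
    rw [hasDerivAt_iff_tendsto_slope, ← tendsto_sub_nhds_zero_iff]
    have hb : Tendsto (fun u : ℂ => 3 / 4 * ‖u‖ ^ k) (𝓝[≠] 0) (𝓝 0) := by
      have : Tendsto (fun u : ℂ => 3 / 4 * ‖u‖ ^ k) (𝓝 0) (𝓝 (3 / 4 * ‖(0 : ℂ)‖ ^ k)) :=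
        Continuous.tendsto (by fun_prop) 0
      rw [norm_zero, zero_pow (by omega), mul_zero] at this
      exact this.mono_left nhdsWithin_le_nhds
    refine squeeze_zero_norm' ?_ hb
    filter_upwards [self_mem_nhdsWithin, mem_nhdsWithin_of_mem_nhds (Metric.ball_mem_nhds (0 : ℂ) hρ)]
      with u hu hur
    have := (hestρ u hu (by simpa using hur)).1
    rwa [slope_def_field, h0, sub_zero, sub_zero]
  obtain ⟨g, r, hr, hrρ, hgd, hg⟩ := exists_local_inverse hρ hdρ h0 hder
  have hconjn : ∀ z : ℂ, ‖conj z‖ = ‖z‖ := norm_conj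
  -- Since `f = h ∘ conj`, its inverse is `conj ∘ h⁻¹`. Read with the rotation `ω`, it inverts the
  -- germ read with `conj ω`.
  refine ⟨fun z => conj (g z), 2 * C, r, by positivity, hr, ?_, ?_⟩
  · intro z hz
    constructor
    · change conj (g (f z)) = z
      rw [hfh, (hg (conj z) (by rwa [hconjn])).2.2, conj_conj]
    · rw [hfh, conj_conj, (hg z hz).2.1]
  · intro s ω hs hω hωk
    obtain ⟨e1, e2⟩ := isHalfShift_rotated hk hs hω hωk hfh hdρ h0 hestρ
    refine ⟨(e1.mono hrρ).const_le (by linarith), ?_⟩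
    have hωω : ω * conj ω = 1 := by rw [mul_conj, normSq_eq_norm_sq, hω]; simp
    have hω' : ‖conj ω‖ = 1 := by rw [hconjn, hω]
    have hωk' : conj ω ^ k = -s := by rw [← map_pow, hωk, map_neg, conj_ofReal]
    obtain ⟨a1, a2⟩ := isHalfShift_rotated hk hs hω' hωk' hfh hdρ h0 hestρ
    refine isHalfShift_inverse a1 hC a2 hrρ (hsm ρ hρ ((min_le_right _ _).trans (min_le_right _ _))) ?_ ?_
    · have : (fun x => rotated ω (fun z => conj (g z)) (conj x))
          = fun x => ω * (conj (g (conj (conj ω * x)))) := by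
        funext x; simp [rotated]
      rw [this]
      refine DifferentiableOn.const_mul ?_ ω
      intro x hx
      have hx' : ‖conj (conj ω * x)‖ < r := by
        rw [hconjn, norm_mul, hω', one_mul]; simpa using hx
      have d1 : DifferentiableAt ℂ g (conj (conj ω * x)) :=
        hgd.differentiableAt (Metric.isOpen_ball.mem_nhds (by simpa using hx'))
      have d2 := d1.conj_conj
      rw [conj_conj] at d2
      have d3 : DifferentiableAt ℂ (fun y => conj ω * y) x := by fun_prop
      exact (DifferentiableAt.comp (g := conj ∘ g ∘ conj) x d2 d3).differentiableWithinAt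
    · intro x hx
      have hx' : ‖ω * x‖ < r := by rw [norm_mul, hω, one_mul]; exact hx
      obtain ⟨b1, b2, -⟩ := hg _ hx'
      constructor
      · rw [rotated, norm_mul, hω, one_mul, hconjn]; exact b1
      · rw [rotated, rotated, ← mul_assoc (conj ω) ω, mul_comm (conj ω) ω, hωω, one_mul, hfh, conj_conj, b2,
          ← mul_assoc, mul_comm (conj ω) ω, hωω, one_mul]

end AntiParabolic

/-! ### Dictionary between the charts and the model sector -/

namespace AntiParabolic

open Complex Set Filter

theorem SectorStep.swap_inverse {k : ℕ} {r : ℝ} {φ₁ φ₂ ψ₁ ψ₂ : ℂ → ℂ}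
    (j₁ : ∀ x, ‖x‖ < r → ψ₂ (φ₁ x) = x) (j₂ : ∀ x, ‖x‖ < r → ψ₁ (φ₂ x) = x) {x x' : ℂ}
    (h : SectorStep k r φ₁ φ₂ x x') : SectorStep k r ψ₁ ψ₂ x' x := by
  obtain ⟨h1, h2, h3, rfl⟩ := h
  have e := j₂ _ h2.2.1
  exact ⟨h3, by rw [e]; exact h2, h1, by rw [e, j₁ _ h1.2.1]⟩

/-- Injectivity makes predecessors unique, so two points whose orbits reach the same point lie on
one orbit. Conversely, orbits starting in `S` remain deep. -/
theorem ParabolicPair.mem_basin_iff {k : ℕ} {β C Λ r : ℝ} {φ₁ φ₂ : ℂ → ℂ}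
    (h : ParabolicPair k β C Λ r φ₁ φ₂) {S : Set ℂ} (hS : S ⊆ deep k β r)
    (hmeet : ∀ w ∈ deep k β r, ∃ v ∈ S, Relation.ReflTransGen (SectorStep k r φ₁ φ₂) w v ∨
      Relation.ReflTransGen (SectorStep k r φ₁ φ₂) v w) {x : ℂ} :
    x ∈ basin k β r φ₁ φ₂ ↔ ∃ v ∈ S, Relation.ReflTransGen (SectorStep k r φ₁ φ₂) x v ∨
      Relation.ReflTransGen (SectorStep k r φ₁ φ₂) v x := by
  have hb : ∀ {z}, z ∈ sector k r → z ∈ Metric.ball (0 : ℂ) r := fun hz => by simpa using hz.2.1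
  have huniq : Relator.RightUnique (Function.swap (SectorStep k r φ₁ φ₂)) := by
    intro z x y hx hy
    refine h.injOn_fst (hb hx.1) (hb hy.1) (h.injOn_snd (hb hx.2.1) (hb hy.2.1) ?_)
    rw [← hx.2.2.2, ← hy.2.2.2]
  constructor
  · rintro ⟨w, hw, hxw⟩
    obtain ⟨v, hv, hwv | hvw⟩ := hmeet w hw
    · exact ⟨v, hv, Or.inl (hxw.trans hwv)⟩
    · have := Relation.ReflTransGen.total_of_right_unique huniq
        (Relation.reflTransGen_swap.2 hxw) (Relation.reflTransGen_swap.2 hvw)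
      exact ⟨v, hv, this.symm.imp Relation.reflTransGen_swap.1 Relation.reflTransGen_swap.1⟩
  · rintro ⟨v, hv, hxv | hvx⟩
    · exact ⟨v, hS hv, hxv⟩
    · refine deep_subset_basin ?_
      induction hvx with
      | refl => exact hS hv
      | tail _ hs ih =>
        rw [hs.2.2.2]
        exact (h.step_of_mem_deep ih).2.1

/-- The rotation `e^{ijπ/k}` of the `j`-th sector. -/
noncomputable def rotor (k : ℕ) (j : ℤ) : ℂ := exp ((j : ℂ) * (Real.pi : ℂ) / (k : ℂ) * I)

/-- `1` for the attracting sectors, `-1` for the repelling ones. -/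
def chartSign (j : ℤ) : ℝ := if Even j then -1 else 1

theorem chartSign_eq (j : ℤ) : chartSign j = 1 ∨ chartSign j = -1 := by
  rw [chartSign]; split_ifs <;> simp

theorem chartSign_neg (j : ℤ) : chartSign (-j) = chartSign j := by
  simp only [chartSign, even_neg]

theorem chartSign_mul_self (j : ℤ) : (chartSign j : ℂ) * chartSign j = 1 := by
  rcases chartSign_eq j with h | h <;> rw [h] <;> simp

theorem chartSign_ne_zero (j : ℤ) : (chartSign j : ℂ) ≠ 0 :=
  left_ne_zero_of_mul (a := (chartSign j : ℂ)) (by rw [chartSign_mul_self j]; exact one_ne_zero)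

theorem rotor_eq (k : ℕ) (j : ℤ) : rotor k j = exp (((j * Real.pi / k : ℝ) : ℂ) * I) := by
  rw [rotor]; push_cast; rfl

theorem norm_rotor (k : ℕ) (j : ℤ) : ‖rotor k j‖ = 1 := by
  rw [rotor_eq, norm_exp_ofReal_mul_I]

theorem rotor_neg (k : ℕ) (j : ℤ) : rotor k (-j) = exp (-((j : ℂ) * (Real.pi : ℂ) / (k : ℂ) * I)) := by
  rw [rotor]; congr 1; push_cast; ring

theorem rotor_mul_rotor_neg (k : ℕ) (j : ℤ) : rotor k j * rotor k (-j) = 1 := by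
  rw [rotor_neg, rotor, ← exp_add, add_neg_cancel, exp_zero]

theorem rotor_neg_mul_rotor (k : ℕ) (j : ℤ) : rotor k (-j) * rotor k j = 1 := by
  rw [mul_comm, rotor_mul_rotor_neg]

theorem rotor_neg_mul_cancel (k : ℕ) (j : ℤ) (x : ℂ) : rotor k (-j) * (rotor k j * x) = x := by
  rw [← mul_assoc, rotor_neg_mul_rotor, one_mul]

theorem rotor_mul_cancel (k : ℕ) (j : ℤ) (x : ℂ) : rotor k j * (rotor k (-j) * x) = x := by
  rw [← mul_assoc, rotor_mul_rotor_neg, one_mul]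

theorem norm_rotor_mul (k : ℕ) (j : ℤ) (x : ℂ) : ‖rotor k j * x‖ = ‖x‖ := by
  rw [norm_mul, norm_rotor, one_mul]

theorem rotor_pow {k : ℕ} (hk : 1 ≤ k) (j : ℤ) : rotor k j ^ k = -chartSign j := by
  have hkc : (k : ℂ) ≠ 0 := by exact_mod_cast (by omega : k ≠ 0)
  have h1 : rotor k j ^ k = (-1 : ℂ) ^ j := by
    rw [rotor, ← exp_nat_mul, show (k : ℂ) * ((j : ℂ) * (Real.pi : ℂ) / (k : ℂ) * I)
      = j * (Real.pi * I) by field_simp, exp_int_mul, exp_pi_mul_I]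
  rw [h1, chartSign]
  split_ifs with hj
  · rw [hj.neg_one_zpow]; simp
  · rw [(Int.not_even_iff_odd.1 hj).neg_one_zpow]; simp

theorem rotor_self {k : ℕ} (hk : 1 ≤ k) : rotor k k = -1 := by
  have hkc : (k : ℂ) ≠ 0 := by exact_mod_cast (by omega : k ≠ 0)
  rw [rotor, show ((k : ℤ) : ℂ) * (Real.pi : ℂ) / (k : ℂ) * I = Real.pi * I by
    push_cast; field_simp, exp_pi_mul_I]

theorem rotor_neg_self {k : ℕ} (hk : 1 ≤ k) : rotor k (-k) = -1 := by
  have := rotor_mul_rotor_neg k k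
  rw [rotor_self hk] at this
  linear_combination -this

theorem mem_chartDomain_iff {k : ℕ} {r : ℝ} {j : ℤ} {z : ℂ} :
    z ∈ chartDomain k r j ↔ rotor k (-j) * z ∈ sector k r := by
  have h : rotor k (-j) ≠ 0 := by rw [rotor]; exact exp_ne_zero _
  rw [chartDomain, sector, mem_ofPred_eq, mem_ofPred_eq, norm_rotor_mul, rotor_neg, mul_comm z,
    ← rotor_neg]
  simp [h]

/-- For `|j| < k` the rotated sector stays within `|arg| < π`. For `j = ±k` the rotation is `-1`,
and the determination of the logarithm supplies `±iπ`. -/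
theorem timeLog_rotor {k : ℕ} (hk : 1 ≤ k) {j : ℤ} (hj : |j| ≤ k) {r : ℝ} {x : ℂ}
    (hx : x ∈ sector k r) : timeLog k j (rotor k j * x) = log x + j * Real.pi / k * I := by
  have hkc : (k : ℂ) ≠ 0 := by exact_mod_cast (by omega : k ≠ 0)
  have hk0 : (0 : ℝ) < k := by exact_mod_cast hk
  rw [timeLog]
  split_ifs with h1 h2
  · subst h1
    rw [rotor_self hk]
    simp only [neg_mul, one_mul, neg_neg]
    push_cast; field_simp
  · subst h2
    rw [rotor_neg_self hk]
    simp only [neg_mul, one_mul, neg_neg]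
    push_cast; field_simp; ring
  · have e : rotor k j * x = exp (log x + j * Real.pi / k * I) := by
      rw [exp_add, exp_log hx.1, rotor, mul_comm]
    have him : (log x + j * Real.pi / k * I).im = arg x + j * Real.pi / k := by
      rw [add_im, log_im, show (j : ℂ) * Real.pi / k * I = ((j * Real.pi / k : ℝ) : ℂ) * I by
        push_cast; rfl, im_ofReal_mul, I_im, mul_one]
    have hx2 := abs_lt.1 hx.2.2
    have hj2 := abs_le.1 hj
    have ha : (j : ℝ) ≤ k - 1 := by
      have : j ≤ k - 1 := by omega
      exact_mod_cast this
    have hb : -(k - 1 : ℝ) ≤ j := by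
      have : -((k : ℤ) - 1) ≤ j := by omega
      exact_mod_cast this
    have hπ := Real.pi_pos
    have e1 : Real.pi / k + (k - 1) * Real.pi / k = Real.pi := by field_simp; ring
    have e2 : (j : ℝ) * Real.pi / k ≤ (k - 1) * Real.pi / k := by gcongr
    have e3 : -(k - 1 : ℝ) * Real.pi / k ≤ j * Real.pi / k := by gcongr
    have e4 : -(k - 1 : ℝ) * Real.pi / k = -((k - 1 : ℝ) * Real.pi / k) := by ring
    rw [e, log_exp (by rw [him]; linarith [hx2.1]) (by rw [him]; linarith [hx2.2])]

/-- The constant `-jiπb/k` in the time coordinate cancels the logarithm of the rotation, and `ω^k =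
-s` gives the sign of the principal part. -/
theorem timeCoord_rotor {k : ℕ} (hk : 1 ≤ k) {j : ℤ} (hj : |j| ≤ k) (b : ℝ) {r : ℝ} {x : ℂ}
    (hx : x ∈ sector k r) :
    timeCoord k b j (rotor k j * x) = chartSign j * sectorTime k (chartSign j * b) x := by
  have hkc : (k : ℂ) ≠ 0 := by exact_mod_cast (by omega : k ≠ 0)
  have hxk : x ^ k ≠ 0 := pow_ne_zero _ hx.1
  have hs := chartSign_mul_self j
  have hs0 := chartSign_ne_zero j
  rw [timeCoord, timeLog_rotor hk hj hx, mul_pow, rotor_pow hk, sectorTime]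
  have e : -1 / ((k : ℂ) * (-(chartSign j : ℂ) * x ^ k)) = chartSign j * (1 / (k * x ^ k)) := by
    have : (1 : ℂ) / chartSign j = chartSign j := by rw [div_eq_iff hs0, hs]
    calc -1 / ((k : ℂ) * (-(chartSign j : ℂ) * x ^ k))
        = 1 / chartSign j * (1 / (k * x ^ k)) := by field_simp
      _ = _ := by rw [this]
  rw [e]
  push_cast
  linear_combination (-(b : ℂ) * log x) * hs

theorem step_iff {k : ℕ} {f : ℂ → ℂ} {r : ℝ} {j : ℤ} {z z' : ℂ} : Step k f r j z z' ↔
    SectorStep k r (rotated (rotor k j) f) (rotated (rotor k (-j)) f)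
      (rotor k (-j) * z) (rotor k (-j) * z') := by
  have h : rotor k (-j) ≠ 0 := by rw [rotor]; exact exp_ne_zero _
  rw [Step, SectorStep, mem_chartDomain_iff, mem_chartDomain_iff, mem_chartDomain_iff]
  simp only [rotated, rotor_mul_cancel, rotor_neg_mul_cancel, neg_neg, mul_right_inj' h]

theorem reflTransGen_step_iff {k : ℕ} {f : ℂ → ℂ} {r : ℝ} {j : ℤ} {z z' : ℂ} :
    Relation.ReflTransGen (Step k f r j) z z' ↔ Relation.ReflTransGen
      (SectorStep k r (rotated (rotor k j) f) (rotated (rotor k (-j)) f))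
      (rotor k (-j) * z) (rotor k (-j) * z') := by
  constructor
  · exact fun h => h.lift _ fun a b hab => step_iff.1 hab
  · intro h
    have : Relation.ReflTransGen (Step k f r j) (rotor k j * (rotor k (-j) * z))
        (rotor k j * (rotor k (-j) * z')) :=
      h.lift (fun x => rotor k j * x) fun a b hab => by
        change Step k f r j (rotor k j * a) (rotor k j * b)
        rw [step_iff, rotor_neg_mul_cancel, rotor_neg_mul_cancel]
        exact hab
    simpa only [rotor_mul_cancel] using this

end AntiParabolic

/-! ### The petal is the basin of the attracting map -/

namespace AntiParabolic

open Complex Set Filter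

/-- A germ `f`, its inverse `e`, and a radius on which all the estimates hold. -/
structure GermChart (k : ℕ) (b C Λ r : ℝ) (f e : ℂ → ℂ) : Prop where
  one_le : 1 ≤ k
  inverse : ∀ z, ‖z‖ < 2 * r → e (f z) = z ∧ f (e z) = z
  half : ∀ (s : ℝ) (ω : ℂ), s = 1 ∨ s = -1 → ‖ω‖ = 1 → ω ^ k = -s →
    IsHalfShift k (s * b) C r s (rotated ω f) ∧ IsHalfShift k (s * b) C r (-s) (rotated ω e)
  small : ∀ s : ℝ, s = 1 ∨ s = -1 → SmallRadius k (s * b) Λ r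
  nonneg : 0 ≤ C
  potential : ∃ (Ψ : ℝ → ℝ) (B : ℝ), (∀ t, 0 ≤ Ψ t ∧ Ψ t ≤ B) ∧
    (∀ t t', t + 1 / 2 ≤ t' → 3 * C * (2 ^ (1 + 1 / (k : ℝ)) * (1 + |t|) ^ (-(1 + 1 / (k : ℝ))))
      ≤ Ψ t' - Ψ t) ∧
    200 + 1000 * C + 10 * (|b| * Real.pi) + 2 * B ≤ Λ

/-- The one of the germ and its inverse for which the `j`-th sector is attracting. -/
def attractingMap (f e : ℂ → ℂ) (j : ℤ) : ℂ → ℂ := if Even j then e else f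

theorem attractingMap_neg (f e : ℂ → ℂ) (j : ℤ) : attractingMap f e (-j) = attractingMap f e j := by
  simp only [attractingMap, even_neg]

theorem chartSign_of_even {j : ℤ} (h : Even j) : chartSign j = -1 := if_pos h

theorem chartSign_of_not_even {j : ℤ} (h : ¬Even j) : chartSign j = 1 := if_neg h

/-- The `j`-th petal in the coordinate of the sector. -/
def sectorPetal (k : ℕ) (b r : ℝ) (f e : ℂ → ℂ) (j : ℤ) : Set ℂ :=
  basin k (chartSign j * b) r (rotated (rotor k j) (attractingMap f e j))
    (rotated (rotor k (-j)) (attractingMap f e j))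

/-- The sign carries the orientation: for even `j` the strip lies to the left of the line in the
sector coordinate. -/
theorem strip_iff {k : ℕ} (hk : 1 ≤ k) {j : ℤ} (hj : |j| ≤ k) {b r δ : ℝ} {f : ℂ → ℂ}
    (hδ : (δ : ℂ) ∈ sector k r)
    (hff : ∀ x ∈ sector k r, (sectorTime k (chartSign j * b) x).re
      = (sectorTime k (chartSign j * b) δ).re →
      rotated (rotor k (-j)) f (rotated (rotor k j) f x) ∈ sector k r)
    {w : ℂ} (hw : w ∈ sector k r) :
    timeCoord k b j (rotor k j * w) ∈ strip k b f r δ j ↔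
      chartSign j * (sectorTime k (chartSign j * b) δ).re
        ≤ chartSign j * (sectorTime k (chartSign j * b) w).re ∧
      ∃ x ∈ sector k r, (sectorTime k (chartSign j * b) x).re
          = (sectorTime k (chartSign j * b) δ).re ∧
        (sectorTime k (chartSign j * b) (rotated (rotor k (-j)) f (rotated (rotor k j) f x))).im
          = (sectorTime k (chartSign j * b) w).im ∧
        chartSign j * (sectorTime k (chartSign j * b) w).re ≤ chartSign j *
          (sectorTime k (chartSign j * b)
            (rotated (rotor k (-j)) f (rotated (rotor k j) f x))).re := by
  have hs0 : chartSign j ≠ 0 := by exact_mod_cast chartSign_ne_zero j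
  have hbase : basePoint k δ j = rotor k j * δ := by rw [basePoint, rotor, mul_comm]
  have hgg : ∀ x, f (f (rotor k j * x))
      = rotor k j * rotated (rotor k (-j)) f (rotated (rotor k j) f x) := fun x => by
    rw [rotated, rotated, rotor_mul_cancel, rotor_neg_mul_cancel]
  rw [strip, mem_ofPred_eq, hbase, timeCoord_rotor hk hj b hδ, timeCoord_rotor hk hj b hw,
    re_ofReal_mul, re_ofReal_mul, im_ofReal_mul]
  refine and_congr_right fun _ => ⟨?_, ?_⟩
  · rintro ⟨_, ⟨z, ⟨hz, hzre⟩, rfl⟩, h1, h2⟩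
    obtain ⟨x, rfl⟩ : ∃ x, z = rotor k j * x := ⟨_, (rotor_mul_cancel k j z).symm⟩
    rw [mem_chartDomain_iff, rotor_neg_mul_cancel] at hz
    rw [hbase, timeCoord_rotor hk hj b hδ, timeCoord_rotor hk hj b hz, re_ofReal_mul,
      re_ofReal_mul, mul_right_inj' hs0] at hzre
    simp only [hgg] at h1 h2
    rw [timeCoord_rotor hk hj b (hff x hz hzre)] at h1 h2
    rw [im_ofReal_mul, mul_right_inj' hs0] at h1
    rw [re_ofReal_mul] at h2
    exact ⟨x, hz, hzre, h1, h2⟩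
  · rintro ⟨x, hx, hxre, h1, h2⟩
    refine ⟨_, ⟨rotor k j * x, ⟨?_, ?_⟩, rfl⟩, ?_, ?_⟩
    · rwa [mem_chartDomain_iff, rotor_neg_mul_cancel]
    · rw [hbase, timeCoord_rotor hk hj b hδ, timeCoord_rotor hk hj b hx, re_ofReal_mul,
        re_ofReal_mul, hxre]
    · simp only [hgg]
      rw [timeCoord_rotor hk hj b (hff x hx hxre), im_ofReal_mul, h1]
    · simp only [hgg]
      rw [timeCoord_rotor hk hj b (hff x hx hxre), re_ofReal_mul]
      exact h2

namespace GermChart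

variable {k : ℕ} {b C Λ r : ℝ} {f e : ℂ → ℂ} (h : GermChart k b C Λ r f e)

include h

theorem pos : 0 < r := (h.small 1 (Or.inl rfl)).pos

theorem attracting (j : ℤ) : IsHalfShift k (chartSign j * b) C r 1
    (rotated (rotor k j) (attractingMap f e j)) := by
  obtain ⟨h1, h2⟩ := h.half _ _ (chartSign_eq j) (norm_rotor k j) (rotor_pow h.one_le j)
  by_cases hj : Even j
  · rw [attractingMap, if_pos hj]
    rw [chartSign_of_even hj, neg_neg] at h2
    rwa [chartSign_of_even hj]
  · rw [attractingMap, if_neg hj]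
    rw [chartSign_of_not_even hj] at h1
    rwa [chartSign_of_not_even hj]

theorem rotated_inverse (j : ℤ) {x : ℂ} (hx : ‖x‖ < 2 * r) :
    rotated (rotor k j) f (rotated (rotor k (-j)) e x) = x ∧
    rotated (rotor k j) e (rotated (rotor k (-j)) f x) = x := by
  obtain ⟨h1, h2⟩ := h.inverse (rotor k (-j) * x) (by rwa [norm_rotor_mul])
  constructor
  · rw [rotated, rotated, rotor_mul_cancel, h2, rotor_mul_cancel]
  · rw [rotated, rotated, rotor_mul_cancel, h1, rotor_mul_cancel]

theorem injOn_rotated (j : ℤ) : InjOn (rotated (rotor k j) (attractingMap f e j)) (Metric.ball 0 r) := by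
  have hr := h.pos
  intro x hx y hy hxy
  rw [mem_ball_zero_iff] at hx hy
  have a := h.rotated_inverse (-j) (x := x) (by linarith)
  have c := h.rotated_inverse (-j) (x := y) (by linarith)
  rw [neg_neg] at a c
  rw [attractingMap] at hxy
  split_ifs at hxy with hj
  · rw [← a.1, ← c.1, hxy]
  · rw [← a.2, ← c.2, hxy]

theorem pair (j : ℤ) : ParabolicPair k (chartSign j * b) C Λ r
    (rotated (rotor k j) (attractingMap f e j)) (rotated (rotor k (-j)) (attractingMap f e j)) := by
  refine ⟨h.small _ (chartSign_eq j), h.nonneg, h.attracting j, ?_, h.injOn_rotated j, ?_, ?_⟩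
  · have := h.attracting (-j)
    rwa [chartSign_neg, attractingMap_neg] at this
  · have := h.injOn_rotated (-j)
    rwa [attractingMap_neg] at this
  · have : |chartSign j * b| = |b| := by
      rw [abs_mul]; rcases chartSign_eq j with hj | hj <;> rw [hj] <;> simp
    rw [this]
    exact h.potential

/-- The hypothesis on `δ` places the line so deep that the strip is deep as well and every deep
orbit meets it. Orbits running in either direction from such a strip fill exactly the basin. -/
theorem mem_petal_iff {j : ℤ} (hj : |j| ≤ k) {δ : ℝ} (hδ : (δ : ℂ) ∈ sector k r)
    (hX : 2 * 4 ^ k * (1 / (k * r ^ k)) + 10 < (sectorTime k (chartSign j * b) δ).re) {z : ℂ} :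
    z ∈ petal k b f r δ j ↔ rotor k (-j) * z ∈ sectorPetal k b r f e j := by
  have hp := h.pair j
  have hr := h.pos
  obtain ⟨hΛ, hCΛ⟩ := hp.bounds
  have hsm := h.small _ (chartSign_eq j)
  have hC := h.nonneg
  obtain ⟨hf1, he1⟩ := h.half _ _ (chartSign_eq j) (norm_rotor k j) (rotor_pow h.one_le j)
  obtain ⟨hf2, he2⟩ := h.half _ (rotor k (-j)) (chartSign_eq j) (norm_rotor k (-j))
    (by rw [rotor_pow h.one_le, chartSign_neg])
  have hσ : |chartSign j| ≤ 1 := by rcases chartSign_eq j with hj | hj <;> rw [hj] <;> simp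
  set X := (sectorTime k (chartSign j * b) δ).re with hXdef
  have hnear : ∀ x ∈ sector k r, (sectorTime k (chartSign j * b) x).re = X →
      rotated (rotor k (-j)) f (rotated (rotor k j) f x) ∈ deep k (chartSign j * b) r := by
    intro x hx hxX
    exact (hf1.comp_near hf2 hsm hσ hΛ hC hCΛ hx (by rw [hxX]; linarith)).2.1
  have hstrip := fun {w : ℂ} (hw : w ∈ sector k r) => strip_iff h.one_le hj (f := f) hδ
    (fun x hx hxX => (hnear x hx hxX).1) hw
  set P := sectorTime k (chartSign j * b) with hP
  set γ : ℂ → ℂ := fun x => rotated (rotor k (-j)) f (rotated (rotor k j) f x) with hγ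
  set S : Set ℂ := {w | w ∈ sector k r ∧ chartSign j * X ≤ chartSign j * (P w).re ∧
      ∃ x ∈ sector k r, (P x).re = X ∧ (P (γ x)).im = (P w).im ∧
        chartSign j * (P w).re ≤ chartSign j * (P (γ x)).re} with hS
  have hpetal : z ∈ petal k b f r δ j ↔ ∃ v ∈ S,
      Relation.ReflTransGen (SectorStep k r (rotated (rotor k j) f) (rotated (rotor k (-j)) f))
        (rotor k (-j) * z) v ∨
      Relation.ReflTransGen (SectorStep k r (rotated (rotor k j) f) (rotated (rotor k (-j)) f))
        v (rotor k (-j) * z) := by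
    rw [petal, mem_ofPred_eq]
    constructor
    · rintro ⟨w, hw, h1, h2⟩
      rw [mem_chartDomain_iff] at hw
      rw [← rotor_mul_cancel k j w, hstrip hw] at h1
      rw [reflTransGen_step_iff, reflTransGen_step_iff] at h2
      exact ⟨_, ⟨hw, h1⟩, h2⟩
    · rintro ⟨v, ⟨hv, h1⟩, h2⟩
      refine ⟨rotor k j * v, ?_, (hstrip hv).2 h1, ?_⟩
      · rwa [mem_chartDomain_iff, rotor_neg_mul_cancel]
      · rwa [reflTransGen_step_iff, reflTransGen_step_iff, rotor_neg_mul_cancel]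
  have hlt : ∀ {x : ℂ}, ‖x‖ < r → ‖x‖ < 2 * r := fun hx => by linarith
  have i1 : ∀ x, ‖x‖ < r → rotated (rotor k j) f (rotated (rotor k (-j)) e x) = x :=
    fun x hx => (h.rotated_inverse j (hlt hx)).1
  have i2 : ∀ x, ‖x‖ < r → rotated (rotor k j) e (rotated (rotor k (-j)) f x) = x :=
    fun x hx => (h.rotated_inverse j (hlt hx)).2
  have i3 : ∀ x, ‖x‖ < r → rotated (rotor k (-j)) f (rotated (rotor k j) e x) = x := fun x hx => by
    have := (h.rotated_inverse (-j) (hlt hx)).1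
    rwa [neg_neg] at this
  have i4 : ∀ x, ‖x‖ < r → rotated (rotor k (-j)) e (rotated (rotor k j) f x) = x := fun x hx => by
    have := (h.rotated_inverse (-j) (hlt hx)).2
    rwa [neg_neg] at this
  rw [hpetal, sectorPetal]
  by_cases hje : Even j
  · have hsign := chartSign_of_even hje
    rw [attractingMap, if_pos hje] at hp ⊢
    -- For even `j` the germ moves to the left, and its steps are those of the inverse germ read
    -- backward. The petal condition is symmetric in the direction of time.
    have hswap : SectorStep k r (rotated (rotor k j) f) (rotated (rotor k (-j)) f)
        = Function.swap (SectorStep k r (rotated (rotor k j) e) (rotated (rotor k (-j)) e)) := by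
      funext x x'
      exact propext ⟨SectorStep.swap_inverse i4 i2, SectorStep.swap_inverse i3 i1⟩
    rw [hswap]
    simp only [Relation.reflTransGen_swap]
    have hSd : S ⊆ deep k (chartSign j * b) r := by
      rintro w ⟨hw, h1, x, hx, hxX, h3, h4⟩
      have := (hnear x hx hxX).2
      refine ⟨hw, ?_⟩
      rw [hsign] at h4
      change _ < (P w).re
      change _ < (P (γ x)).re at this
      linarith
    rw [hp.mem_basin_iff hSd]
    · exact exists_congr fun v => and_congr_right fun _ => or_comm
    · intro w hw
      rw [hsign] at hf1 hf2
      obtain ⟨v, hv, a1, ⟨x, hx, a2, a3, a4⟩, a5⟩ := hp.exists_strip_point_left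
        (ψ₁ := rotated (rotor k j) f) (ψ₂ := rotated (rotor k (-j)) f) (hsign ▸ hf1)
        (hsign ▸ hf2) (fun x hx => i2 x hx) (fun x hx => i4 x hx) (fun x hx => i3 x hx)
        (fun x hx => i1 x hx) hX hw
      refine ⟨v, ⟨hv, ?_, x, hx, a2, a3, ?_⟩, a5⟩
      · rw [hsign]; linarith
      · rw [hsign]
        change (P (γ x)).re ≤ (P v).re at a4
        linarith
  · have hsign := chartSign_of_not_even hje
    rw [attractingMap, if_neg hje] at hp ⊢
    have hSd : S ⊆ deep k (chartSign j * b) r := by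
      rintro w ⟨hw, h1, -⟩
      rw [hsign] at h1
      refine ⟨hw, ?_⟩
      change _ < (P w).re
      linarith
    rw [hp.mem_basin_iff hSd]
    intro w hw
    obtain ⟨v, hv, a1, ⟨x, hx, a2, a3, a4⟩, a5⟩ := hp.exists_strip_point_right
      (ψ₁ := rotated (rotor k j) e) (ψ₂ := rotated (rotor k (-j)) e) (by rwa [hsign] at he1 ⊢)
      (by rwa [hsign] at he2 ⊢) (fun x hx => i1 x hx) (fun x hx => i3 x hx) hX hw
    refine ⟨v, ⟨hv, ?_, x, hx, a2, a3, ?_⟩, a5⟩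
    · rw [hsign]; linarith
    · rw [hsign]
      change (P v).re ≤ (P (γ x)).re at a4
      linarith

end GermChart

end AntiParabolic

/-! ### Fatou systems in the time charts -/

namespace AntiParabolic

open Complex Set Filter

/-- The `j`-th time coordinate in the coordinate of the sector. -/
noncomputable def sectorCoord (k : ℕ) (b : ℝ) (j : ℤ) (x : ℂ) : ℂ :=
  chartSign j * sectorTime k (chartSign j * b) x

/-- The `j`-th Fatou coordinate in the coordinate of the sector. -/
noncomputable def sectorFatou (k : ℕ) (b : ℝ) (f e : ℂ → ℂ) (j : ℤ) (x : ℂ) : ℂ :=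
  chartSign j * fatou k (chartSign j * b) (rotated (rotor k j) (attractingMap f e j))
    (rotated (rotor k (-j)) (attractingMap f e j)) x

/-- The `j`-th Fatou coordinate in the time coordinate. -/
noncomputable def fatouChart (k : ℕ) (b r : ℝ) (f e : ℂ → ℂ) (j : ℤ) (W : ℂ) : ℂ :=
  sectorFatou k b f e j (Function.invFunOn (sectorCoord k b j) (sectorPetal k b r f e j) W)

theorem sectorPetal_neg (k : ℕ) (b r : ℝ) (f e : ℂ → ℂ) (j : ℤ) :
    sectorPetal k b r f e (-j) = basin k (chartSign j * b) r
      (rotated (rotor k (-j)) (attractingMap f e j)) (rotated (rotor k j) (attractingMap f e j)) := by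
  rw [sectorPetal, chartSign_neg, attractingMap_neg, neg_neg]

theorem sectorFatou_neg (k : ℕ) (b : ℝ) (f e : ℂ → ℂ) (j : ℤ) (x : ℂ) :
    sectorFatou k b f e (-j) x = chartSign j * fatou k (chartSign j * b)
      (rotated (rotor k (-j)) (attractingMap f e j)) (rotated (rotor k j) (attractingMap f e j)) x := by
  rw [sectorFatou, chartSign_neg, attractingMap_neg, neg_neg]

theorem sectorCoord_neg (k : ℕ) (b : ℝ) (j : ℤ) : sectorCoord k b (-j) = sectorCoord k b j := by
  funext x; rw [sectorCoord, chartSign_neg, sectorCoord]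

/-- The rotations for `k` and `-k` are both `-1`, so the two indices have the same sector and the
same maps. -/
theorem sectorPetal_neg_self {k : ℕ} (hk : 1 ≤ k) (b r : ℝ) (f e : ℂ → ℂ) :
    sectorPetal k b r f e (-k) = sectorPetal k b r f e k := by
  rw [sectorPetal_neg, sectorPetal, rotor_self hk, rotor_neg_self hk]

theorem fatouChart_neg_self {k : ℕ} (hk : 1 ≤ k) (b r : ℝ) (f e : ℂ → ℂ) (W : ℂ) :
    fatouChart k b r f e (-k) W = fatouChart k b r f e k W := by
  rw [fatouChart, fatouChart, sectorFatou_neg, sectorFatou, sectorPetal_neg_self hk,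
    sectorCoord_neg, rotor_self hk, rotor_neg_self hk]

theorem rotor_mul_mem_petal {k : ℕ} {b r δ : ℝ} {f e : ℂ → ℂ} {j : ℤ}
    (hpet : ∀ z, z ∈ petal k b f r δ j ↔ rotor k (-j) * z ∈ sectorPetal k b r f e j) {x : ℂ} :
    rotor k j * x ∈ petal k b f r δ j ↔ x ∈ sectorPetal k b r f e j := by
  rw [hpet, rotor_neg_mul_cancel]

theorem conj_half : conj (1 / 2 : ℂ) = 1 / 2 := by
  rw [map_div₀, map_one, map_ofNat]

namespace GermChart

variable {k : ℕ} {b C Λ r : ℝ} {f e : ℂ → ℂ} (h : GermChart k b C Λ r f e)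

include h

theorem injOn_sectorCoord (j : ℤ) : InjOn (sectorCoord k b j) (sectorPetal k b r f e j) := by
  intro x hx y hy hxy
  exact (h.pair j).injOn_time_basin hx hy (mul_left_cancel₀ (chartSign_ne_zero j) hxy)

theorem hasDerivAt_sectorCoord (j : ℤ) {x : ℂ} (hx : x ∈ sector k r) :
    HasDerivAt (sectorCoord k b j) (chartSign j * deriv (sectorTime k (chartSign j * b)) x) x :=
  ((h.small _ (chartSign_eq j)).hasDerivAt_time hx).differentiableAt.hasDerivAt.const_mul _

theorem differentiableOn_sectorCoord (j : ℤ) :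
    DifferentiableOn ℂ (sectorCoord k b j) (sectorPetal k b r f e j) := fun _ hx =>
  (h.hasDerivAt_sectorCoord j (basin_subset_sector hx)).differentiableAt.differentiableWithinAt

theorem invFunOn_sectorCoord (j : ℤ) {x : ℂ} (hx : x ∈ sectorPetal k b r f e j) :
    Function.invFunOn (sectorCoord k b j) (sectorPetal k b r f e j) (sectorCoord k b j x) = x :=
  (h.injOn_sectorCoord j).leftInvOn_invFunOn hx

theorem isOpen_image_sectorCoord (j : ℤ) :
    IsOpen (sectorCoord k b j '' sectorPetal k b r f e j) ∧
    DifferentiableOn ℂ (Function.invFunOn (sectorCoord k b j) (sectorPetal k b r f e j))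
      (sectorCoord k b j '' sectorPetal k b r f e j) := by
  refine isOpen_image_and_differentiableOn_leftInverse (h.pair j).isOpen_basin
    (h.differentiableOn_sectorCoord j) (fun x hx => ?_) fun x hx => h.invFunOn_sectorCoord j hx
  rw [(h.hasDerivAt_sectorCoord j (basin_subset_sector hx)).deriv]
  exact mul_ne_zero (chartSign_ne_zero j)
    ((h.small _ (chartSign_eq j)).deriv_time_ne_zero (basin_subset_sector hx))

theorem fatouChart_sectorCoord (j : ℤ) {x : ℂ} (hx : x ∈ sectorPetal k b r f e j) :
    fatouChart k b r f e j (sectorCoord k b j x) = sectorFatou k b f e j x := by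
  rw [fatouChart, h.invFunOn_sectorCoord j hx]

/-- For odd `j` this is the relation of the attracting pair at `x`. For even `j` that relation is
applied to the inverse germ at the image of `x`, and the sign in front turns the shift `-1/2` into
`+1/2`. -/
theorem sectorFatou_conj (j : ℤ) {x : ℂ} (hx : x ∈ sectorPetal k b r f e (-j))
    (hy : rotated (rotor k (-j)) f x ∈ sectorPetal k b r f e j) :
    sectorFatou k b f e j (rotated (rotor k (-j)) f x)
      = conj (sectorFatou k b f e (-j) x + 1 / 2) := by
  have hxr : ‖x‖ < 2 * r := by linarith [(basin_subset_sector hx).2.1, h.pos]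
  rw [map_add, conj_half, sectorFatou_neg, sectorFatou]
  have hp := h.pair j
  by_cases hj : Even j
  · have h1 := hp.fatou_conj hy
    rw [attractingMap, if_pos hj] at h1 ⊢
    rw [(h.rotated_inverse j hxr).2] at h1
    rw [chartSign_of_even hj] at h1 ⊢
    rw [h1]
    simp only [ofReal_neg, ofReal_one, neg_mul, one_mul, map_neg, map_add, conj_conj, conj_half]
    ring
  · rw [sectorPetal_neg] at hx
    have h1 := hp.symm.fatou_conj hx
    rw [attractingMap, if_neg hj] at h1 ⊢
    rw [chartSign_of_not_even hj] at h1 ⊢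
    rw [h1]
    simp

theorem sectorFatou_step (j : ℤ) {x : ℂ} (hx : x ∈ sectorPetal k b r f e j)
    (hy : rotated (rotor k (-j)) f (rotated (rotor k j) f x) ∈ sectorPetal k b r f e j) :
    sectorFatou k b f e j (rotated (rotor k (-j)) f (rotated (rotor k j) f x))
      = sectorFatou k b f e j x + 1 := by
  have hxr := (basin_subset_sector hx).2.1
  have hr := h.pos
  have hp := h.pair j
  obtain ⟨hf1, -⟩ := h.half _ _ (chartSign_eq j) (norm_rotor k j) (rotor_pow h.one_le j)
  have hw := hf1.norm_le' (h.small _ (chartSign_eq j)) (by linarith [hp.bounds.1]) hxr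
  rw [sectorFatou, sectorFatou]
  by_cases hj : Even j
  · have h1 := hp.fatou_step hy
    rw [attractingMap, if_pos hj] at h1 ⊢
    rw [(h.rotated_inverse j (by linarith)).2] at h1
    have h2 := (h.rotated_inverse (-j) (x := x) (by linarith)).2
    rw [neg_neg] at h2
    rw [h2, chartSign_of_even hj] at h1
    rw [chartSign_of_even hj, h1]
    push_cast; ring
  · have h1 := hp.fatou_step hx
    rw [attractingMap, if_neg hj] at h1 ⊢
    rw [h1, chartSign_of_not_even hj]
    push_cast; ring

theorem timeCoord_rotor_mul {j : ℤ} (hj : |j| ≤ k) {x : ℂ} (hx : x ∈ sectorPetal k b r f e j) :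
    timeCoord k b j (rotor k j * x) = sectorCoord k b j x :=
  timeCoord_rotor h.one_le hj b (basin_subset_sector hx)

variable {δ : ℝ} (hpet : ∀ j : ℤ, |j| ≤ k → ∀ z, z ∈ petal k b f r δ j ↔
  rotor k (-j) * z ∈ sectorPetal k b r f e j) {j : ℤ} (hj : |j| ≤ k)

include hpet hj

theorem timeCoord_of_mem_petal {z : ℂ} (hz : z ∈ petal k b f r δ j) :
    timeCoord k b j z = sectorCoord k b j (rotor k (-j) * z) := by
  rw [← h.timeCoord_rotor_mul hj ((hpet j hj z).1 hz), rotor_mul_cancel]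

theorem petalChart_eq : petalChart k b f r δ j = sectorCoord k b j '' sectorPetal k b r f e j := by
  ext W
  constructor
  · rintro ⟨z, hz, rfl⟩
    exact ⟨_, (hpet j hj z).1 hz, (h.timeCoord_of_mem_petal hpet hj hz).symm⟩
  · rintro ⟨x, hx, rfl⟩
    exact ⟨_, (rotor_mul_mem_petal (hpet j hj)).2 hx, h.timeCoord_rotor_mul hj hx⟩

theorem petal_nonempty : (petal k b f r δ j).Nonempty := by
  obtain ⟨x, hx⟩ := (h.pair j).nonempty_deep
  exact ⟨_, (rotor_mul_mem_petal (hpet j hj)).2 (deep_subset_basin hx)⟩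

theorem isOpen_petal : IsOpen (petal k b f r δ j) := by
  have : petal k b f r δ j = (fun z => rotor k (-j) * z) ⁻¹' sectorPetal k b r f e j :=
    Set.ext (hpet j hj)
  rw [this]
  exact (h.pair j).isOpen_basin.preimage (continuous_const_mul _)

theorem isOpen_petalChart : IsOpen (petalChart k b f r δ j) := by
  rw [h.petalChart_eq hpet hj]
  exact (h.isOpen_image_sectorCoord j).1

theorem injOn_timeCoord : InjOn (timeCoord k b j) (petal k b f r δ j) := by
  intro z hz w hw hzw
  rw [h.timeCoord_of_mem_petal hpet hj hz, h.timeCoord_of_mem_petal hpet hj hw] at hzw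
  have := h.injOn_sectorCoord j ((hpet j hj z).1 hz) ((hpet j hj w).1 hw) hzw
  rw [← rotor_mul_cancel k j z, this, rotor_mul_cancel]

theorem fatouChart_timeCoord {z : ℂ} (hz : z ∈ petal k b f r δ j) :
    fatouChart k b r f e j (timeCoord k b j z) = sectorFatou k b f e j (rotor k (-j) * z) := by
  rw [h.timeCoord_of_mem_petal hpet hj hz, h.fatouChart_sectorCoord j ((hpet j hj z).1 hz)]

omit hj

theorem isFatouSystem_fatouChart : IsFatouSystem k b f r δ (fatouChart k b r f e) := by
  refine ⟨fun j hj => ?_, fun j hj => ?_, fun W _ => (fatouChart_neg_self h.one_le b r f e W).symm,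
    fun j hj z hz hfz => ?_⟩
  · rw [h.petalChart_eq hpet hj]
    refine ((h.pair j).differentiableOn_fatou.const_mul _).comp
      (h.isOpen_image_sectorCoord j).2 ?_
    rintro _ ⟨x, hx, rfl⟩
    rwa [h.invFunOn_sectorCoord j hx]
  · rw [h.petalChart_eq hpet hj]
    rintro _ ⟨x, hx, rfl⟩ _ ⟨y, hy, rfl⟩ hxy
    rw [h.fatouChart_sectorCoord j hx, h.fatouChart_sectorCoord j hy] at hxy
    rw [(h.pair j).injOn_fatou hx hy (mul_left_cancel₀ (chartSign_ne_zero j) hxy)]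
  · have hj' : |-j| ≤ k := by rwa [abs_neg]
    rw [h.fatouChart_timeCoord hpet hj hfz, h.fatouChart_timeCoord hpet hj' hz]
    have e1 : rotor k (-j) * f z = rotated (rotor k (-j)) f (rotor k (- -j) * z) := by
      rw [rotated, rotor_mul_cancel]
    rw [hpet j hj, e1] at hfz
    rw [e1]
    exact h.sectorFatou_conj j ((hpet _ hj' z).1 hz) hfz

theorem normalizesSquare_fatouChart : NormalizesSquare k b f r δ (fatouChart k b r f e) := by
  intro j hj z hz hfz
  rw [h.fatouChart_timeCoord hpet hj hfz, h.fatouChart_timeCoord hpet hj hz]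
  have e1 : rotor k (-j) * f (f z)
      = rotated (rotor k (-j)) f (rotated (rotor k j) f (rotor k (-j) * z)) := by
    rw [rotated, rotated, rotor_mul_cancel, rotor_neg_mul_cancel]
  rw [hpet j hj, e1] at hfz
  rw [e1]
  exact h.sectorFatou_step j ((hpet _ hj z).1 hz) hfz

/-- The conjugacy is assumed only where both ends lie in the petals. The attracting map preserves
the basins, so with it the relation holds at every point; for even `j` it is the relation of `f`
read backward. -/
theorem system_conj {Φ : ℤ → ℂ → ℂ} (hΦ : IsFatouSystem k b f r δ Φ) (hj : |j| ≤ k) {x : ℂ}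
    (hx : x ∈ sectorPetal k b r f e j) :
    chartSign j * Φ (-j) (sectorCoord k b (-j) (rotated (rotor k j) (attractingMap f e j) x))
      = conj (chartSign j * Φ j (sectorCoord k b j x)) + 1 / 2 := by
  have hj' : |-j| ≤ k := by rwa [abs_neg]
  have hxr : ‖x‖ < 2 * r := by linarith [(basin_subset_sector hx).2.1, h.pos]
  have hy : rotated (rotor k j) (attractingMap f e j) x ∈ sectorPetal k b r f e (-j) := by
    rw [sectorPetal_neg]
    exact (h.pair j).maps_basin hx
  have hxp := (rotor_mul_mem_petal (hpet j hj)).2 hx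
  have hyp := (rotor_mul_mem_petal (hpet _ hj')).2 hy
  rw [← h.timeCoord_rotor_mul hj hx, ← h.timeCoord_rotor_mul hj' hy]
  by_cases he : Even j
  · rw [attractingMap, if_pos he] at hyp ⊢
    have hff : f (rotor k (-j) * rotated (rotor k j) e x) = rotor k j * x := by
      rw [rotated, rotor_neg_mul_cancel, (h.inverse _ (by rwa [norm_rotor_mul])).2]
    have h1 := hΦ.conjugates j hj _ hyp (by rwa [hff])
    rw [hff] at h1
    rw [h1, chartSign_of_even he]
    simp only [ofReal_neg, ofReal_one, neg_mul, one_mul, map_neg, map_add, conj_conj, conj_half]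
    ring
  · rw [attractingMap, if_neg he] at hyp ⊢
    have hff : f (rotor k j * x) = rotor k (-j) * rotated (rotor k j) f x := by
      rw [rotated, rotor_neg_mul_cancel]
    have h1 := hΦ.conjugates (-j) hj' (rotor k j * x) (by rwa [neg_neg]) (by rwa [hff])
    rw [hff, neg_neg] at h1
    rw [h1, chartSign_of_not_even he, map_add, conj_half]
    simp

theorem system_differentiableOn {Φ : ℤ → ℂ → ℂ} (hΦ : IsFatouSystem k b f r δ Φ) (hj : |j| ≤ k) :
    DifferentiableOn ℂ (fun x => chartSign j * Φ j (sectorCoord k b j x))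
      (sectorPetal k b r f e j) := by
  have h1 := hΦ.holomorphic j hj
  rw [h.petalChart_eq hpet hj] at h1
  exact (h1.comp (h.differentiableOn_sectorCoord j) (mapsTo_image _ _)).const_mul _

theorem system_injOn {Φ : ℤ → ℂ → ℂ} (hΦ : IsFatouSystem k b f r δ Φ) (hj : |j| ≤ k) :
    InjOn (fun x => chartSign j * Φ j (sectorCoord k b j x)) (sectorPetal k b r f e j) := by
  intro x hx y hy hxy
  have h1 := hΦ.injective j hj
  rw [h.petalChart_eq hpet hj] at h1
  exact h.injOn_sectorCoord j hx hy (h1 (mem_image_of_mem _ hx) (mem_image_of_mem _ hy)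
    (mul_left_cancel₀ (chartSign_ne_zero j) hxy))

theorem system_eq_fatouChart_add {Φ : ℤ → ℂ → ℂ} (hΦ : IsFatouSystem k b f r δ Φ) (hj : |j| ≤ k) :
    ∃ c : ℂ, (∀ W ∈ petalChart k b f r δ j, Φ j W = fatouChart k b r f e j W + c) ∧
      ∀ W ∈ petalChart k b f r δ (-j), Φ (-j) W = fatouChart k b r f e (-j) W + conj c := by
  have hj' : |-j| ≤ k := by rwa [abs_neg]
  have hs := chartSign_mul_self j
  have d2 := h.system_differentiableOn hpet hΦ hj'
  have i2 := h.system_injOn hpet hΦ hj'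
  have c2 := fun x hx => h.system_conj hpet hΦ hj' (x := x) hx
  rw [neg_neg, attractingMap_neg] at c2
  rw [chartSign_neg, sectorPetal_neg] at d2 i2 c2
  obtain ⟨c, hc1, hc2⟩ := (h.pair j).eq_fatou_add_const_conj (h.system_differentiableOn hpet hΦ hj)
    d2 (h.system_injOn hpet hΦ hj) i2 (fun x hx => h.system_conj hpet hΦ hj hx) c2
  refine ⟨chartSign j * c, ?_, ?_⟩
  · rw [h.petalChart_eq hpet hj]
    rintro _ ⟨x, hx, rfl⟩
    have := hc1 x hx
    rw [h.fatouChart_sectorCoord j hx, sectorFatou]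
    linear_combination (chartSign j : ℂ) * this - Φ j (sectorCoord k b j x) * hs
  · rw [h.petalChart_eq hpet hj']
    rintro _ ⟨x, hx, rfl⟩
    rw [h.fatouChart_sectorCoord (-j) hx, sectorFatou_neg, map_mul, conj_ofReal]
    rw [sectorPetal_neg] at hx
    have := hc2 x hx
    linear_combination (chartSign j : ℂ) * this - Φ (-j) (sectorCoord k b (-j) x) * hs

/-- Both systems are compared with the constructed one. For `j = 0` the two relations concern the
same map, and for `j = k` the same petal; evaluated at one point they show that the constant equals
its conjugate. -/
theorem system_unique {Φ Φ' : ℤ → ℂ → ℂ} (hΦ : IsFatouSystem k b f r δ Φ)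
    (hΦ' : IsFatouSystem k b f r δ Φ') :
    ∃ C : ℕ → ℂ, (C 0).im = 0 ∧ (C k).im = 0 ∧ ∀ j : ℕ, j ≤ k →
      (∀ W ∈ petalChart k b f r δ (j : ℤ), Φ j W = Φ' j W + C j) ∧
      (∀ W ∈ petalChart k b f r δ (-(j : ℤ)), Φ (-(j : ℤ)) W = Φ' (-(j : ℤ)) W + conj (C j)) := by
  have hcast : ∀ j : ℕ, j ≤ k → |(j : ℤ)| ≤ k := fun j hj => by
    rw [Nat.abs_cast]; exact_mod_cast hj
  have key : ∀ j : ℕ, ∃ c : ℂ, j ≤ k →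
      (∀ W ∈ petalChart k b f r δ (j : ℤ), Φ j W = Φ' j W + c) ∧
      (∀ W ∈ petalChart k b f r δ (-(j : ℤ)), Φ (-(j : ℤ)) W = Φ' (-(j : ℤ)) W + conj c) := by
    intro j
    by_cases hj : j ≤ k
    · obtain ⟨c, h1, h2⟩ := h.system_eq_fatouChart_add hpet hΦ (hcast j hj)
      obtain ⟨c', h1', h2'⟩ := h.system_eq_fatouChart_add hpet hΦ' (hcast j hj)
      refine ⟨c - c', fun _ => ⟨fun W hW => ?_, fun W hW => ?_⟩⟩
      · rw [h1 W hW, h1' W hW]; ring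
      · rw [h2 W hW, h2' W hW, map_sub]; ring
    · exact ⟨0, fun h0 => absurd h0 hj⟩
  choose C hC using key
  refine ⟨C, ?_, ?_, hC⟩
  · obtain ⟨z, hz⟩ := h.petal_nonempty hpet (hcast 0 k.zero_le)
    obtain ⟨h1, h2⟩ := hC 0 k.zero_le
    have e1 := h1 _ (mem_image_of_mem _ hz)
    have e2 := h2 (timeCoord k b (-((0 : ℕ) : ℤ)) z) (mem_image_of_mem _ (by simpa using hz))
    simp only [Nat.cast_zero, neg_zero] at e1 e2
    exact conj_eq_iff_im.1 (by linear_combination e1 - e2)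
  · obtain ⟨z, hz⟩ := h.petal_nonempty hpet (hcast k le_rfl)
    obtain ⟨h1, h2⟩ := hC k le_rfl
    have hW : timeCoord k b k z ∈ petalChart k b f r δ k := mem_image_of_mem _ hz
    have hW' : timeCoord k b k z ∈ petalChart k b f r δ (-k) := by
      rw [h.petalChart_eq hpet (by rw [abs_neg]; exact hcast k le_rfl), sectorCoord_neg,
        sectorPetal_neg_self h.one_le, ← h.petalChart_eq hpet (hcast k le_rfl)]
      exact hW
    have e1 := h1 _ hW
    have e2 := h2 _ hW'
    rw [← hΦ.same_petal _ hW, ← hΦ'.same_petal _ hW] at e2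
    exact conj_eq_iff_im.1 (by linear_combination e1 - e2)

end GermChart

/-- `Λ` is fixed before the radius, and only two values of `β` occur, so one radius serves all
indices. -/
theorem exists_germChart {k : ℕ} (hk : 1 ≤ k) {b : ℝ} {f : ℂ → ℂ} (hf : IsPrenormalized k b f) :
    ∃ (e : ℂ → ℂ) (C Λ r₀ : ℝ), 0 < r₀ ∧ ∀ r, 0 < r → r < r₀ → GermChart k b C Λ r f e := by
  have hk0 : (0 : ℝ) < k := by exact_mod_cast hk
  obtain ⟨e, C, ρ, hC, hρ, hinv, hhalf⟩ := hf.exists_halfShifts hk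
  set a : ℝ := 1 + 1 / (k : ℝ) with ha
  obtain ⟨Φ, K, hΦ, hinc⟩ := exists_potential (a := a) (by
    have : 0 < 1 / (k : ℝ) := by positivity
    linarith)
  set M : ℝ := 3 * C * 2 ^ a with hM
  have hM0 : 0 ≤ M := by positivity
  set Λ := 200 + 1000 * C + 10 * (|b| * Real.pi) + 2 * (M * K) with hΛ
  obtain ⟨r₁, hr₁, h₁⟩ := eventually_smallRadius hk (1 * b) Λ
  obtain ⟨r₂, hr₂, h₂⟩ := eventually_smallRadius hk (-1 * b) Λ
  -- Half of `ρ`, because the inverse relations are needed on the disc of radius `2 r`: a point of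
  -- the disc of radius `r` may leave it slightly under the germ.
  refine ⟨e, C, Λ, min (min r₁ r₂) (ρ / 2), by positivity, fun r hr hrlt => ?_⟩
  simp only [lt_min_iff] at hrlt
  refine ⟨hk, fun z hz => hinv z (by linarith), fun s ω hs hω hωk => ?_, ?_, hC, ?_⟩
  · obtain ⟨a1, a2⟩ := hhalf s ω hs hω hωk
    exact ⟨a1.mono (by linarith), a2.mono (by linarith)⟩
  · rintro s (rfl | rfl)
    · exact h₁ r hr hrlt.1.1
    · exact h₂ r hr hrlt.1.2
  · refine ⟨fun t => M * Φ t, M * K, fun t => ⟨mul_nonneg hM0 (hΦ t).1,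
      mul_le_mul_of_nonneg_left (hΦ t).2 hM0⟩, fun t t' htt => ?_, le_rfl⟩
    have := mul_le_mul_of_nonneg_left (hinc t t' htt) hM0
    rw [hM] at this ⊢
    linarith

/-- At a positive real point the principal part is the real number `1 / (k δ^k)`, which tends to
infinity and dominates the logarithm. -/
theorem SmallRadius.exists_re_time_gt {k : ℕ} {β Λ r : ℝ} (h : SmallRadius k β Λ r) (M : ℝ) :
    ∃ δ₀ > 0, δ₀ ≤ r ∧ ∀ δ : ℝ, 0 < δ → δ < δ₀ →
      (δ : ℂ) ∈ sector k r ∧ M < (sectorTime k β δ).re := by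
  have hk0 := h.cast_pos
  have htop : Tendsto (fun δ : ℝ => 1 / (k * δ ^ k)) (𝓝[>] 0) atTop := by
    have h1 : Tendsto (fun δ : ℝ => k * δ ^ k) (𝓝[>] 0) (𝓝[>] 0) := by
      refine tendsto_nhdsWithin_iff.2 ⟨?_, ?_⟩
      · have : Tendsto (fun δ : ℝ => k * δ ^ k) (𝓝 0) (𝓝 (k * 0 ^ k)) :=
          (continuous_const.mul (continuous_pow k)).tendsto 0
        rw [zero_pow (by have := h.one_le; omega), mul_zero] at this
        exact this.mono_left nhdsWithin_le_nhds
      · filter_upwards [self_mem_nhdsWithin] with δ hδ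
        have : 0 < δ := hδ
        exact mem_Ioi.2 (by positivity)
    exact (tendsto_inv_nhdsGT_zero.comp h1).congr fun δ => (one_div _).symm
  obtain ⟨δ₁, hδ₁, hsub⟩ := mem_nhdsGT_iff_exists_Ioo_subset.1
    (htop.eventually (eventually_gt_atTop (2 * |M|)))
  refine ⟨min δ₁ r, lt_min hδ₁ h.pos, min_le_right _ _, fun δ hδ hlt => ?_⟩
  obtain ⟨hlt1, hlt2⟩ := lt_min_iff.1 hlt
  have harg : arg (δ : ℂ) = 0 := arg_ofReal_of_nonneg hδ.le
  have hnorm : ‖(δ : ℂ)‖ = δ := by rw [norm_real, Real.norm_eq_abs, abs_of_pos hδ]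
  have hmem : (δ : ℂ) ∈ sector k r := by
    refine ⟨by exact_mod_cast hδ.ne', by rwa [hnorm], ?_⟩
    rw [harg, abs_zero]
    exact div_pos Real.pi_pos hk0
  refine ⟨hmem, ?_⟩
  have h1 : 2 * |M| < 1 / (k * δ ^ k) := hsub ⟨hδ, hlt1⟩
  have h2 := (abs_re_le_norm _).trans (h.norm_time_sub_le hmem)
  rw [sub_re, h.principal_re hmem.1, harg, mul_zero, Real.cos_zero, mul_one, hnorm] at h2
  linarith [(abs_le.1 h2).1, le_abs_self M, abs_nonneg M]

theorem GermChart.exists_petal_iff {k : ℕ} {b C Λ r : ℝ} {f e : ℂ → ℂ}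
    (h : GermChart k b C Λ r f e) : ∃ δ₀ > 0, ∀ δ : ℝ, 0 < δ → δ < δ₀ →
      ∀ j : ℤ, |j| ≤ k → ∀ z, z ∈ petal k b f r δ j ↔
        rotor k (-j) * z ∈ sectorPetal k b r f e j := by
  obtain ⟨δ₁, hδ₁, -, h₁⟩ := (h.small 1 (Or.inl rfl)).exists_re_time_gt
    (2 * 4 ^ k * (1 / (k * r ^ k)) + 10)
  obtain ⟨δ₂, hδ₂, -, h₂⟩ := (h.small (-1) (Or.inr rfl)).exists_re_time_gt
    (2 * 4 ^ k * (1 / (k * r ^ k)) + 10)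
  refine ⟨min δ₁ δ₂, lt_min hδ₁ hδ₂, fun δ hδ hlt j hj z => ?_⟩
  obtain ⟨hlt1, hlt2⟩ := lt_min_iff.1 hlt
  obtain ⟨a1, a2⟩ := h₁ δ hδ hlt1
  refine h.mem_petal_iff hj a1 ?_
  rcases chartSign_eq j with hs | hs
  · rwa [hs]
  · rw [hs]; exact (h₂ δ hδ hlt2).2

end AntiParabolic

theorem mainTheorem9 (k : ℕ) (hk : 1 ≤ k) (b : ℝ) (f : ℂ → ℂ)
    (hf : AntiParabolic.IsPrenormalized k b f) :
    ∃ r₀ : ℝ, 0 < r₀ ∧ ∀ r : ℝ, 0 < r → r < r₀ →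
      ∃ δ₀ : ℝ, 0 < δ₀ ∧ ∀ δ : ℝ, 0 < δ → δ < δ₀ →
        -- each `Z_j` is a diffeomorphism of the petal `S_j` onto the chart `U_j`
        (∀ j : ℤ, |j| ≤ (k : ℤ) →
          (AntiParabolic.petal k b f r δ j).Nonempty ∧
          IsOpen (AntiParabolic.petal k b f r δ j) ∧
          IsOpen (AntiParabolic.petalChart k b f r δ j) ∧
          Set.InjOn (AntiParabolic.timeCoord k b j) (AntiParabolic.petal k b f r δ j)) ∧
        -- existence
        (∃ Φ : ℤ → ℂ → ℂ, AntiParabolic.IsFatouSystem k b f r δ Φ ∧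
          AntiParabolic.NormalizesSquare k b f r δ Φ) ∧
        -- uniqueness
        (∀ Φ Φ' : ℤ → ℂ → ℂ, AntiParabolic.IsFatouSystem k b f r δ Φ →
          AntiParabolic.IsFatouSystem k b f r δ Φ' →
          ∃ C : ℕ → ℂ, (C 0).im = 0 ∧ (C k).im = 0 ∧
            ∀ j : ℕ, j ≤ k →
              (∀ W ∈ AntiParabolic.petalChart k b f r δ (j : ℤ),
                Φ j W = Φ' j W + C j) ∧
              (∀ W ∈ AntiParabolic.petalChart k b f r δ (-(j : ℤ)),
                Φ (-(j : ℤ)) W = Φ' (-(j : ℤ)) W + conj (C j))) := by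
  obtain ⟨e, C, Λ, r₀, hr₀, hchart⟩ := AntiParabolic.exists_germChart hk hf
  refine ⟨r₀, hr₀, fun r hr hrlt => ?_⟩
  have h := hchart r hr hrlt
  obtain ⟨δ₀, hδ₀, hpetal⟩ := h.exists_petal_iff
  refine ⟨δ₀, hδ₀, fun δ hδ hδlt => ?_⟩
  have hpet := hpetal δ hδ hδlt
  exact ⟨fun j hj => ⟨h.petal_nonempty hpet hj, h.isOpen_petal hpet hj,
      h.isOpen_petalChart hpet hj, h.injOn_timeCoord hpet hj⟩,
    ⟨_, h.isFatouSystem_fatouChart hpet, h.normalizesSquare_fatouChart hpet⟩,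
    fun Φ Φ' hΦ hΦ' => h.system_unique hpet hΦ hΦ'⟩
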